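/- **Theorem (worst-case bound for $k$-median Sensitivity Sampling).** For a $k$-tuple $S$ of centers in $\mathbb{R}^d$ and a finite set $P\subset\mathbb{R}^d$ let $\mathrm{cost}(p,S)=\min_{c\in S}\|p-c\|_2$ and $\mathrm{cost}(P,S)=\sum_{p\in P}\mathrm{cost}(p,S)$. For every constant $\gamma\ge 1$ there are constants $C>0$ and $c\in\mathbb{N}$, depending only on $\gamma$, such that the following holds for all integers $d\ge 0$, $k\ge 1$, all $\varepsilon\in(0,1)$ and all finite nonempty sets $P\subset\mathbb{R}^d$. Let $A=(a_1,\dots,a_k)$ be a $\gamma$-approximate $k$-median solution of $P$, i.e. $\mathrm{cost}(P,A)\le\gamma\,\mathrm{cost}(P,S)$ for all $k$-tuples $S$, and let $C_1,\dots,C_k$ be the partition of $P$ obtained by assigning each point to a nearest center of $A$, with ties broken arbitrarily. For $p\in C_j$ let $\Delta_p=\mathrm{cost}(C_j,A)/|C_j|$ and $$\mu(p)=\frac14\left(\frac1{k|C_j|}+\frac{\mathrm{cost}(p,A)}{k\,\mathrm{cost}(C_j,A)}+\frac{\mathrm{cost}(p,A)}{\mathrm{cost}(P,A)}+\frac{\Delta_p}{\mathrm{cost}(P,A)}\right),$$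 which is a probability distribution on $P$ if all clusters have positive cost; in the degenerate cases (an empty cluster or a cluster of cost $0$) read $0/0$ as $0$ and divide $\mu$ by its total mass. Let $m$ be any integer with $$m\;\ge\; C\,\min\left(k^{4/3}\varepsilon^{-2},\,k\varepsilon^{-3}\right)\,\log^{c}(2k/\varepsilon),$$ let $q_1,\dots,q_m$ be independent samples from $\mu$, and give $q_i$ the weight $w_i=1/(m\,\mu(q_i))$. Then with probability at least $2/3$ the weighted points $(q_i,w_i)_{i\le m}$ form an $\varepsilon$-coreset of $P$ for $k$-median: $$\Big|\sum_{i=1}^m w_i\,\mathrm{cost}(q_i,S)-\mathrm{cost}(P,S)\Big|\le\varepsilon\,\mathrm{cost}(P,S)\quad\text{for all } k\text{-tuples } S \text{ of centers in } \mathbb{R}^d.$$ -/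

import Mathlib

open MeasureTheory
open scoped ENNReal BigOperators

noncomputable section

namespace KMedian

variable {d k : ℕ}

/-- Points of the Euclidean space `ℝ^d`, with the Euclidean norm. -/
abbrev Pt (d : ℕ) : Type := EuclideanSpace ℝ (Fin d)

/-- The `k`-median cost of a point `p` for the centers `S = (c_1, …, c_k)`: the Euclidean distance
to the nearest center (for `k ≥ 1` the infimum over the finite index set is a minimum). -/
def pointCost (S : Fin k → Pt d) (p : Pt d) : ℝ := ⨅ j, dist p (S j)

/-- The `k`-median cost of a finite point set `P` for the centers `S`. -/
def cost (P : Finset (Pt d)) (S : Fin k → Pt d) : ℝ := ∑ p ∈ P, pointCost S p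

/-- `A` is a `γ`-approximate `k`-median solution for `P`: its cost is at most `γ` times the cost
of every `k`-tuple of centers. -/
def IsApproxSolution (γ : ℝ) (P : Finset (Pt d)) (A : Fin k → Pt d) : Prop :=
  ∀ S : Fin k → Pt d, cost P A ≤ γ * cost P S

/-- `τ` assigns every point of `P` to (the index of) a nearest center of `A`; ties are broken
arbitrarily. Values of `τ` outside `P` play no role. -/
def IsNearestAssignment (P : Finset (Pt d)) (A : Fin k → Pt d) (τ : Pt d → Fin k) : Prop :=
  ∀ p ∈ P, dist p (A (τ p)) = pointCost A p

/-- The cluster `C_j` of the points of `P` that are assigned to the center with index `j`. -/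
def cluster (P : Finset (Pt d)) (τ : Pt d → Fin k) (j : Fin k) : Finset (Pt d) :=
  P.filter (fun p => τ p = j)

/-- The average cost `Δ_p = cost(C_j, A) / |C_j|` of the cluster `C_j` that contains `p`. -/
def avgCost (P : Finset (Pt d)) (A : Fin k → Pt d) (τ : Pt d → Fin k) (p : Pt d) : ℝ :=
  cost (cluster P τ (τ p)) A / ((cluster P τ (τ p)).card : ℝ)

/-- The score of `p ∈ C_j`,
`1/4 (1/(k|C_j|) + cost(p,A)/(k cost(C_j,A)) + cost(p,A)/cost(P,A) + Δ_p/cost(P,A))`.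
A quotient with denominator `0` (its numerator is then `0` as well) is read as `0`. -/
def score (P : Finset (Pt d)) (A : Fin k → Pt d) (τ : Pt d → Fin k) (p : Pt d) : ℝ :=
  (1 / 4) * (1 / ((k : ℝ) * ((cluster P τ (τ p)).card : ℝ))
    + pointCost A p / ((k : ℝ) * cost (cluster P τ (τ p)) A)
    + pointCost A p / cost P A
    + avgCost P A τ p / cost P A)

/-- The sampling distribution `μ` of Sensitivity Sampling. If every cluster has positive cost, the
scores already sum to `1` (see `sum_score_eq_one`), so `μ` is the score itself; dividing by
the sum matters only for degenerate clusterings (empty clusters or clusters of cost `0`). -/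
def prob (P : Finset (Pt d)) (A : Fin k → Pt d) (τ : Pt d → Fin k) (p : Pt d) : ℝ :=
  score P A τ p / ∑ q ∈ P, score P A τ q

/-- The distribution `μ` as a measure on the finite set `P`. -/
def sampleMeasure (P : Finset (Pt d)) (A : Fin k → Pt d) (τ : Pt d → Fin k) :
    Measure P :=
  ∑ p : P, ENNReal.ofReal (prob P A τ p) • Measure.dirac p

/-- The law of the `m` independent samples `q_1, …, q_m` from `μ`. -/
def sampleLaw (P : Finset (Pt d)) (A : Fin k → Pt d) (τ : Pt d → Fin k) (m : ℕ) :
    Measure (Fin m → P) :=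
  Measure.pi (fun _ => sampleMeasure P A τ)

/-- The weight `1 / (m μ(q))` of a sample `q`. -/
def weight (P : Finset (Pt d)) (A : Fin k → Pt d) (τ : Pt d → Fin k) (m : ℕ) (q : Pt d) : ℝ :=
  1 / ((m : ℝ) * prob P A τ q)

/-- The points `q_1, …, q_m` (repetitions allowed) with weights `w_1, …, w_m` are an `ε`-coreset of
`P` for `k`-median: for all `k`-tuples of centers `S`, the weighted cost lies in
`(1 ± ε) cost(P, S)`. -/
def IsCoreset (k : ℕ) (ε : ℝ) (P : Finset (Pt d)) {m : ℕ} (q : Fin m → Pt d) (w : Fin m → ℝ) :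
    Prop :=
  ∀ S : Fin k → Pt d, |∑ i, w i * pointCost S (q i) - cost P S| ≤ ε * cost P S

theorem pointCost_nonneg (S : Fin k → Pt d) (p : Pt d) : 0 ≤ pointCost S p :=
  Real.iInf_nonneg fun _ => dist_nonneg

theorem cost_nonneg (P : Finset (Pt d)) (S : Fin k → Pt d) : 0 ≤ cost P S :=
  Finset.sum_nonneg fun p _ => pointCost_nonneg S p

theorem score_pos (P : Finset (Pt d)) (A : Fin k → Pt d) (τ : Pt d → Fin k) {p : Pt d}
    (hp : p ∈ P) : 0 < score P A τ p := by
  have hk : (0 : ℝ) < k := by exact_mod_cast (τ p).pos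
  have hc : (0 : ℝ) < ((cluster P τ (τ p)).card : ℝ) := by
    exact_mod_cast Finset.card_pos.2 ⟨p, by simp [cluster, hp]⟩
  have h1 := pointCost_nonneg A p
  have h2 := cost_nonneg (cluster P τ (τ p)) A
  have h3 := cost_nonneg P A
  unfold score avgCost
  positivity

/-- The law of one sample is a probability measure. -/
theorem isProbabilityMeasure_sampleMeasure (P : Finset (Pt d)) (A : Fin k → Pt d)
    (τ : Pt d → Fin k) (hP : P.Nonempty) : IsProbabilityMeasure (sampleMeasure P A τ) := by
  have hs : 0 < ∑ q ∈ P, score P A τ q := Finset.sum_pos (fun q hq => score_pos P A τ hq) hP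
  constructor
  simp only [sampleMeasure, Measure.coe_finsetSum, Finset.sum_apply, Measure.smul_apply,
    measure_univ, smul_eq_mul, mul_one]
  have hn : ∀ p ∈ (Finset.univ : Finset P), 0 ≤ prob P A τ p :=
    fun p _ => div_nonneg (score_pos P A τ p.2).le hs.le
  rw [← ENNReal.ofReal_sum_of_nonneg hn]
  rw [Finset.sum_coe_sort P (fun p => prob P A τ p)]
  simp only [prob]
  rw [← Finset.sum_div, div_self hs.ne', ENNReal.ofReal_one]

/-- If all clusters have positive cost (in particular they are nonempty), the scores sum to `1`. -/
theorem sum_score_eq_one (P : Finset (Pt d)) (A : Fin k → Pt d) (τ : Pt d → Fin k) (hk : 0 < k)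
    (h : ∀ j, 0 < cost (cluster P τ j) A) : ∑ p ∈ P, score P A τ p = 1 := by
  have hk' : (k : ℝ) ≠ 0 := by exact_mod_cast hk.ne'
  have hfib : ∀ f : Pt d → ℝ, ∑ p ∈ P, f p = ∑ j, ∑ p ∈ cluster P τ j, f p := fun f =>
    (Finset.sum_fiberwise P τ f).symm
  have hcost : cost P A = ∑ j, cost (cluster P τ j) A := hfib _
  have hpos : 0 < cost P A := by
    rw [hcost]
    exact Finset.sum_pos (fun j _ => h j) ⟨⟨0, hk⟩, Finset.mem_univ _⟩
  have hcard : ∀ j, ((cluster P τ j).card : ℝ) ≠ 0 := by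
    intro j hj
    have h0 : cluster P τ j = ∅ := Finset.card_eq_zero.1 (by exact_mod_cast hj)
    have := h j
    simp [h0, cost] at this
  have key : ∀ j, ∑ p ∈ cluster P τ j, score P A τ p
      = (1 / 4) * (1 / k + 1 / k + cost (cluster P τ j) A / cost P A
        + cost (cluster P τ j) A / cost P A) := by
    intro j
    have hj : ∀ p ∈ cluster P τ j, score P A τ p
        = (1 / 4) * (1 / ((k : ℝ) * ((cluster P τ j).card : ℝ))
          + pointCost A p / ((k : ℝ) * cost (cluster P τ j) A)
          + pointCost A p / cost P A
          + cost (cluster P τ j) A / ((cluster P τ j).card : ℝ) / cost P A) := by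
      intro p hp
      have : τ p = j := (Finset.mem_filter.1 hp).2
      simp only [score, avgCost, this]
    have hs : ∑ p ∈ cluster P τ j, pointCost A p = cost (cluster P τ j) A := rfl
    rw [Finset.sum_congr rfl hj, ← Finset.mul_sum]
    simp only [Finset.sum_add_distrib, Finset.sum_const, nsmul_eq_mul, ← Finset.sum_div, hs]
    have h1 := hcard j
    have h2 := (h j).ne'
    field_simp
  rw [hfib, Finset.sum_congr rfl (fun j _ => key j), ← Finset.mul_sum]
  simp only [Finset.sum_add_distrib, Finset.sum_const, nsmul_eq_mul, ← Finset.sum_div,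
    ← hcost, Finset.card_univ, Fintype.card_fin]
  field_simp
  norm_num

end KMedian

end

/-!
With high probability the sample has roughly the right size and cost in every cluster. For such
samples, drawing a second one and exchanging coordinates at random reduces the theorem to bounding
`∑ i, σ i * w i * (cost(q i, S) - cost(a (cl i), S))` for a fixed sample and random signs `σ`,
uniformly in `S`: the remaining part of the error depends on `S` only through the costs of the `k`
centers of `A` and is controlled by the cluster sizes. This signed sum is bounded by chaining over
the precisions `α = 2⁻ʰ`.

The entropies must not depend on the dimension. The perceptron algorithm approximates all inner
products `⟪u i, v⟫` with `n` unit vectors up to `η` by one of `(2 * n + 1) ^ O(η⁻²)` vectors, and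
so the distances to a single center. For a class of clusters whose centers have cost about `T`
times the average cost of the cluster, the vector of cost differences can be recovered at
precision `α` from `k * T² / α²` bits, by comparing a center of `S` with the nearest sample point.
If the class has `g ≤ k` clusters, `k * (g + α⁻²)` bits also suffice, since the truncated
distances to the `g` centers, known at scale `α`, take the place of the distance to the base
point. The minimum of the two entropies, compared with the allowed error for such `S`, which grows
with the costs `T`, leaves the sample size `k * min(T, k / T²) / ε²`. It is at most
`k ^ (4 / 3) / ε²`, the worst case being `T = k ^ (1 / 3)`, and at most `k / ε³`, because clusters
with `T > 1 / ε` need no net: there `S` changes the cost of a cluster only by a factor `1 ± O(ε)`.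
-/

noncomputable section

namespace KMedian

section Nets

variable {X ι κ β : Type*}

/-- The functions `f a : ι → ℝ` with `a ∈ A` have a net of at most `exp K` functions, with
coordinatewise tolerance `tol`. The number `K` bounds the metric entropy at that scale; the members
of the net need not be of the form `f a`. -/
def HasNet (A : Set X) (f : X → ι → ℝ) (tol : ι → ℝ) (K : ℝ) : Prop :=
  ∃ N : Finset (ι → ℝ), (N.card : ℝ) ≤ Real.exp K ∧
    ∀ a ∈ A, ∃ g ∈ N, ∀ i, |g i - f a i| ≤ tol i

namespace HasNet

variable {A A' : Set X} {f : X → ι → ℝ} {tol : ι → ℝ} {K K' : ℝ}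

theorem mono (h : HasNet A f tol K) (hA : A' ⊆ A) (hK : K ≤ K') : HasNet A' f tol K' := by
  obtain ⟨N, hN, h⟩ := h
  exact ⟨N, hN.trans (Real.exp_le_exp.2 hK), fun a ha => h a (hA ha)⟩

theorem of_const (g : ι → ℝ) (h : ∀ a ∈ A, ∀ i, |g i - f a i| ≤ tol i) : HasNet A f tol 0 :=
  ⟨{g}, by simp, fun a ha => ⟨g, Finset.mem_singleton_self g, h a ha⟩⟩

theorem precomp (h : HasNet A f tol K) {Y : Type*} {B : Set Y} (φ : Y → X)
    (hφ : ∀ b ∈ B, φ b ∈ A) : HasNet B (fun b => f (φ b)) tol K := by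
  obtain ⟨N, hN, h⟩ := h
  exact ⟨N, hN, fun b hb => h (φ b) (hφ b hb)⟩

theorem postcomp (h : HasNet A f tol K) {f' : X → κ → ℝ} {tol' : κ → ℝ} (Φ : (ι → ℝ) → κ → ℝ)
    (hΦ : ∀ a ∈ A, ∀ g : ι → ℝ, (∀ i, |g i - f a i| ≤ tol i) →
      ∀ j, |Φ g j - f' a j| ≤ tol' j) : HasNet A f' tol' K := by
  classical
  obtain ⟨N, hN, h⟩ := h
  refine ⟨N.image Φ, le_trans (by exact_mod_cast Finset.card_image_le) hN, fun a ha => ?_⟩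
  obtain ⟨g, hg, hga⟩ := h a ha
  exact ⟨Φ g, Finset.mem_image_of_mem Φ hg, hΦ a ha g hga⟩

theorem postcomp₂ (h : HasNet A f tol K) {f₂ : X → β → ℝ} {tol₂ : β → ℝ} {K₂ : ℝ}
    (h₂ : HasNet A f₂ tol₂ K₂) {f' : X → κ → ℝ} {tol' : κ → ℝ}
    (Φ : (ι → ℝ) → (β → ℝ) → κ → ℝ)
    (hΦ : ∀ a ∈ A, ∀ g g₂, (∀ i, |g i - f a i| ≤ tol i) → (∀ i, |g₂ i - f₂ a i| ≤ tol₂ i) →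
      ∀ j, |Φ g g₂ j - f' a j| ≤ tol' j) : HasNet A f' tol' (K + K₂) := by
  classical
  obtain ⟨N, hN, h⟩ := h
  obtain ⟨N₂, hN₂, h₂⟩ := h₂
  refine ⟨Finset.image₂ Φ N N₂, ?_, fun a ha => ?_⟩
  · calc ((Finset.image₂ Φ N N₂).card : ℝ) ≤ N.card * N₂.card := by
          exact_mod_cast Finset.card_image₂_le Φ N N₂
      _ ≤ Real.exp K * Real.exp K₂ := by gcongr
      _ = Real.exp (K + K₂) := (Real.exp_add K K₂).symm
  · obtain ⟨g, hg, hga⟩ := h a ha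
    obtain ⟨g₂, hg₂, hga₂⟩ := h₂ a ha
    exact ⟨Φ g g₂, Finset.mem_image₂_of_mem hg hg₂, hΦ a ha g g₂ hga hga₂⟩

theorem iUnion [Fintype β] [Nonempty β] {A : β → Set X} (h : ∀ b, HasNet (A b) f tol K) :
    HasNet (⋃ b, A b) f tol (K + Real.log (Fintype.card β)) := by
  classical
  choose N hN h using h
  refine ⟨Finset.univ.biUnion N, ?_, fun a ha => ?_⟩
  · calc ((Finset.univ.biUnion N).card : ℝ) ≤ ∑ b, ((N b).card : ℝ) := by
          exact_mod_cast Finset.card_biUnion_le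
      _ ≤ ∑ _b : β, Real.exp K := Finset.sum_le_sum fun b _ => hN b
      _ = Real.exp (K + Real.log (Fintype.card β)) := by
          rw [Real.exp_add, Real.exp_log (by exact_mod_cast Fintype.card_pos)]
          simp [mul_comm]
  · obtain ⟨b, hb⟩ := Set.mem_iUnion.1 ha
    obtain ⟨g, hg, hga⟩ := h b a hb
    exact ⟨g, Finset.mem_biUnion.2 ⟨b, Finset.mem_univ b, hg⟩, hga⟩

theorem iInf [Fintype κ] [Nonempty κ] (h : HasNet A f tol K) :
    HasNet {S : κ → X | ∀ l, S l ∈ A} (fun S i => ⨅ l, f (S l) i) tol (Fintype.card κ * K) := by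
  classical
  obtain ⟨N, hN, h⟩ := h
  refine ⟨(Fintype.piFinset fun _ : κ => N).image fun g i => ⨅ l, g l i, ?_, fun S hS => ?_⟩
  · calc _ ≤ (N.card : ℝ) ^ Fintype.card κ := by
          exact_mod_cast Finset.card_image_le.trans_eq (by simp)
      _ ≤ Real.exp K ^ Fintype.card κ := by gcongr
      _ = Real.exp (Fintype.card κ * K) := (Real.exp_nat_mul K _).symm
  · choose g hg hgS using fun l => h (S l) (hS l)
    refine ⟨_, Finset.mem_image_of_mem _ (Fintype.mem_piFinset.2 hg), fun i => ?_⟩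
    have hbdd : ∀ z : κ → ℝ, BddBelow (Set.range z) := fun z => (Set.finite_range z).bddBelow
    rw [abs_sub_le_iff, sub_le_iff_le_add, sub_le_iff_le_add]
    constructor
    · rw [← sub_le_iff_le_add']
      refine le_ciInf fun l => ?_
      linarith [ciInf_le (hbdd fun l => g l i) l, (abs_sub_le_iff.1 (hgS l i)).1]
    · rw [← sub_le_iff_le_add']
      refine le_ciInf fun l => ?_
      linarith [ciInf_le (hbdd fun l => f (S l) i) l, (abs_sub_le_iff.1 (hgS l i)).2]

end HasNet

theorem hasNet_box [Fintype κ] {A : Set X} {f : X → κ → ℝ} {δ : κ → ℝ} (hδ : ∀ j, 0 < δ j) {R : ℝ}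
    (hR : 0 ≤ R) (hf0 : ∀ a ∈ A, ∀ j, 0 ≤ f a j) (hfR : ∀ a ∈ A, ∀ j, f a j ≤ R * δ j) :
    HasNet A f δ (Fintype.card κ * Real.log (R + 1)) := by
  classical
  refine ⟨(Fintype.piFinset fun _ : κ => Finset.range (⌊R⌋₊ + 1)).image fun n j => n j * δ j, ?_,
    fun a ha => ?_⟩
  · calc _ ≤ ((⌊R⌋₊ : ℝ) + 1) ^ Fintype.card κ := by
          exact_mod_cast Finset.card_image_le.trans_eq (by simp)
      _ ≤ (R + 1) ^ Fintype.card κ := by gcongr; exact Nat.floor_le hR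
      _ = Real.exp (Fintype.card κ * Real.log (R + 1)) := by
          rw [Real.exp_nat_mul, Real.exp_log (by positivity)]
  · refine ⟨_, Finset.mem_image_of_mem _ (a := fun j => ⌊f a j / δ j⌋₊) ?_, fun j => ?_⟩
    · refine Fintype.mem_piFinset.2 fun j => Finset.mem_range_succ_iff.2 (Nat.floor_le_floor ?_)
      exact (div_le_iff₀ (hδ j)).2 (hfR a ha j)
    · have hlow := (le_div_iff₀ (hδ j)).1 (Nat.floor_le (div_nonneg (hf0 a ha j) (hδ j).le))
      have hupp := (div_lt_iff₀ (hδ j)).1 (Nat.lt_floor_add_one (f a j / δ j))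
      rw [abs_le]
      constructor <;> linarith

end Nets

section Perceptron

variable {E ι : Type*} [NormedAddCommGroup E] [InnerProductSpace ℝ E]

theorem exists_sq_norm_sub_smul_le {u v : E} {θ : ℝ} (hu : ‖u‖ ≤ 1) (hθ : 0 ≤ θ)
    (h : θ ≤ |inner ℝ u v|) :
    ∃ s : Bool, ‖v - (if s then θ else -θ) • u‖ ^ 2 ≤ ‖v‖ ^ 2 - θ ^ 2 := by
  have hu2 : ‖u‖ ^ 2 ≤ 1 := pow_le_one₀ (norm_nonneg u) hu
  have key : ∀ e : ℝ, e ^ 2 = θ ^ 2 → θ ^ 2 ≤ e * inner ℝ u v →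
      ‖v - e • u‖ ^ 2 ≤ ‖v‖ ^ 2 - θ ^ 2 := by
    intro e he hle
    rw [norm_sub_sq_real, inner_smul_right, real_inner_comm, norm_smul, mul_pow,
      Real.norm_eq_abs, sq_abs, he]
    nlinarith [sq_nonneg θ]
  rcases le_abs.1 h with h | h
  · exact ⟨true, key θ rfl (by nlinarith)⟩
  · exact ⟨false, key (-θ) (by ring) (by nlinarith)⟩

/- Each round of the perceptron algorithm moves the approximation of `v` by `± θ` along a badly
approximated direction, which lowers the squared distance to `v` by `θ²`. -/
theorem exists_perceptron_net [Fintype ι] (u : ι → E) (hu : ∀ i, ‖u i‖ ≤ 1) {θ : ℝ} (hθ : 0 ≤ θ)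
    (R : ℝ) (n : ℕ) :
    ∃ N : Finset E, N.card ≤ (2 * Fintype.card ι + 1) ^ n ∧
      ∀ v : E, ‖v‖ ≤ R → ∃ v' ∈ N, (∀ i, |inner ℝ (u i) (v - v')| ≤ θ) ∨
        ‖v - v'‖ ^ 2 + n * θ ^ 2 ≤ R ^ 2 := by
  classical
  induction n with
  | zero =>
    refine ⟨{0}, by simp, fun v hv => ⟨0, Finset.mem_singleton_self 0, Or.inr ?_⟩⟩
    have := pow_le_pow_left₀ (norm_nonneg v) hv 2
    simpa using this
  | succ n ih =>
    obtain ⟨N, hN, h⟩ := ih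
    let move : Option (ι × Bool) → E := fun o =>
      o.elim 0 fun x => (if x.2 then θ else -θ) • u x.1
    refine ⟨Finset.image₂ (fun v' o => v' + move o) N Finset.univ, ?_, fun v hv => ?_⟩
    · refine (Finset.card_image₂_le _ _ _).trans ?_
      rw [Finset.card_univ, Fintype.card_option, Fintype.card_prod, Fintype.card_bool, pow_succ,
        mul_comm (Fintype.card ι)]
      gcongr
    obtain ⟨v', hv', hor⟩ := h v hv
    have hmem : ∀ o, v' + move o ∈ Finset.image₂ (fun v' o => v' + move o) N Finset.univ :=
      fun o => Finset.mem_image₂_of_mem hv' (Finset.mem_univ o)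
    by_cases hgood : ∀ i, |inner ℝ (u i) (v - v')| ≤ θ
    · exact ⟨_, hmem none, Or.inl (by simpa [move] using hgood)⟩
    · have hle := hor.resolve_left hgood
      push Not at hgood
      obtain ⟨i, hi⟩ := hgood
      obtain ⟨s, hs⟩ := exists_sq_norm_sub_smul_le (hu i) hθ hi.le
      refine ⟨_, hmem (some (i, s)), Or.inr ?_⟩
      have hmove : v - (v' + move (some (i, s))) = v - v' - (if s then θ else -θ) • u i := by
        simp only [move, Option.elim_some]
        abel
      rw [hmove]
      push_cast
      linarith

theorem exists_inner_net_of_norm_le_one [Fintype ι] (u : ι → E) (hu : ∀ i, ‖u i‖ ≤ 1) {η R : ℝ}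
    (hη : 0 < η) (hR : 0 ≤ R) {n : ℕ} (hn : 1 ≤ n * η ^ 2) :
    ∃ N : Finset E, N.card ≤ (2 * Fintype.card ι + 1) ^ n ∧
      ∀ v : E, ‖v‖ ≤ R → ∃ v' ∈ N, ∀ i, |inner ℝ (u i) (v - v')| ≤ η * R := by
  obtain ⟨N, hN, h⟩ := exists_perceptron_net u hu (mul_nonneg hη.le hR) R n
  refine ⟨N, hN, fun v hv => ?_⟩
  obtain ⟨v', hv', hgood | hclose⟩ := h v hv
  · exact ⟨v', hv', hgood⟩
  · have hzero : ‖v - v'‖ ^ 2 ≤ 0 := by nlinarith [mul_nonneg (sub_nonneg.2 hn) (sq_nonneg R)]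
    have hvv' : v - v' = 0 := by simpa using le_antisymm hzero (sq_nonneg _)
    refine ⟨v', hv', fun i => ?_⟩
    rw [hvv', inner_zero_right, abs_zero]
    positivity

theorem hasNet_inner [Fintype ι] (x : ι → E) {η R : ℝ} (hη : 0 < η) (hη1 : η ≤ 1) (hR : 0 ≤ R) :
    HasNet {v : E | ‖v‖ ≤ R} (fun v i => inner ℝ (x i) v) (fun i => η * R * ‖x i‖)
      (2 / η ^ 2 * Real.log (2 * Fintype.card ι + 1)) := by
  classical
  have hunit : ∀ i, ‖‖x i‖⁻¹ • x i‖ ≤ 1 := fun i => by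
    rw [norm_smul, norm_inv, norm_norm]
    exact inv_mul_le_one
  have hη2 : 0 < η ^ 2 := by positivity
  have hn : 1 ≤ (⌈1 / η ^ 2⌉₊ : ℝ) * η ^ 2 := (div_le_iff₀ hη2).1 (Nat.le_ceil _)
  have hn2 : (⌈1 / η ^ 2⌉₊ : ℝ) ≤ 2 / η ^ 2 := by
    have h1 : 1 ≤ 1 / η ^ 2 := (le_div_iff₀ hη2).2 (by nlinarith)
    have h2 := Nat.ceil_lt_add_one (zero_le_one.trans h1)
    rw [show (2 : ℝ) / η ^ 2 = 1 / η ^ 2 + 1 / η ^ 2 by ring]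
    linarith
  obtain ⟨N, hN, h⟩ := exists_inner_net_of_norm_le_one _ hunit hη hR hn
  refine ⟨N.image fun v i => inner ℝ (x i) v, ?_, fun v hv => ?_⟩
  · calc _ ≤ (2 * (Fintype.card ι : ℝ) + 1) ^ ⌈1 / η ^ 2⌉₊ := by
          exact_mod_cast Finset.card_image_le.trans hN
      _ = Real.exp (⌈1 / η ^ 2⌉₊ * Real.log (2 * Fintype.card ι + 1)) := by
          rw [Real.exp_nat_mul, Real.exp_log (by positivity)]
      _ ≤ _ := by
          gcongr
          exact Real.log_nonneg (by linarith [Nat.cast_nonneg (α := ℝ) (Fintype.card ι)])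
  · obtain ⟨v', hv', hvv'⟩ := h v hv
    refine ⟨_, Finset.mem_image_of_mem _ hv', fun i => ?_⟩
    rw [← inner_sub_right, ← neg_sub, inner_neg_right, abs_neg]
    rcases eq_or_ne (x i) 0 with h0 | h0
    · simp [h0]
    · have hi := hvv' i
      rw [real_inner_smul_left, abs_mul, abs_inv, abs_norm,
        inv_mul_le_iff₀ (norm_pos_iff.2 h0)] at hi
      linarith

end Perceptron

section DistanceNets

variable {E ι κ : Type*} [NormedAddCommGroup E]

theorem abs_sqrt_sub_mul_add_le {X t δ : ℝ} (ht : 0 ≤ t) (h : |X - t ^ 2| ≤ δ) :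
    |√X - t| * (√X + t) ≤ δ := by
  have h0 := Real.sqrt_nonneg X
  rw [← abs_of_nonneg (add_nonneg h0 ht), ← abs_mul,
    show (√X - t) * (√X + t) = √X ^ 2 - t ^ 2 by ring]
  rcases le_total 0 X with hX | hX
  · rwa [Real.sq_sqrt hX]
  · rw [Real.sqrt_eq_zero_of_nonpos hX]
    rw [abs_le] at *
    constructor <;> nlinarith

theorem abs_sqrt_sub_le {X t b δ : ℝ} (ht : 0 ≤ t) (hb : 0 ≤ b) (hδ : 0 ≤ δ) (hδ1 : 4 * δ ≤ 1)
    (h : |X - t ^ 2| ≤ δ * (t + b) ^ 2) : |√X - t| ≤ 4 * δ * t + b := by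
  have hprod := abs_sqrt_sub_mul_add_le ht h
  have h0 := Real.sqrt_nonneg X
  rcases le_total b t with hbt | htb
  · rcases ht.eq_or_lt with rfl | htpos
    · obtain rfl : b = 0 := le_antisymm hbt hb
      have : √X * √X ≤ 0 := by simpa [abs_of_nonneg h0] using hprod
      have : √X = 0 := by nlinarith
      simp [this]
    · have hsq : (t + b) ^ 2 ≤ (2 * t) ^ 2 := by gcongr; linarith
      have : |√X - t| * t ≤ 4 * δ * t * t := by
        nlinarith [mul_le_mul_of_nonneg_left hsq hδ, mul_nonneg (abs_nonneg (√X - t)) h0]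
      linarith [le_of_mul_le_mul_right this htpos]
  · have hsq : (t + b) ^ 2 ≤ (2 * b) ^ 2 := by gcongr; linarith
    have habs : |√X - t| ≤ √X + t := by
      rw [abs_le]
      constructor <;> linarith
    have : |√X - t| ^ 2 ≤ b ^ 2 := by
      nlinarith [mul_le_mul_of_nonneg_left hsq hδ,
        mul_le_mul_of_nonneg_left habs (abs_nonneg (√X - t))]
    linarith [abs_le_of_sq_le_sq' this hb |>.2, mul_nonneg hδ ht]

theorem abs_min_sub_min_le_of_abs_sub_le {e t a b B : ℝ} (ha0 : 0 ≤ a) (ha : a ≤ 1) (hb : 0 ≤ b)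
    (hB : 0 ≤ B) (h : |e - t| ≤ a * t + b) : |min e B - min t B| ≤ a * B + b := by
  rw [abs_le] at h ⊢
  have := mul_nonneg ha0 hB
  rcases le_total e B with h1 | h1 <;> rcases le_total t B with h2 | h2 <;>
    simp only [min_eq_left, min_eq_right, h1, h2] <;>
    constructor <;> nlinarith [mul_le_mul_of_nonneg_left h2 ha0,
      mul_nonneg (sub_nonneg.2 ha) (sub_nonneg.2 h2)]

theorem log_mul_add_one_le {L₁ M n : ℝ} (hM : 0 ≤ M) (hn : 1 ≤ n) (hL : Real.log (M + 1) ≤ L₁) :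
    Real.log (M * n + 1) ≤ L₁ + n := by
  calc Real.log (M * n + 1) ≤ Real.log ((M + 1) * n) :=
        Real.log_le_log (by positivity) (by linarith)
    _ = Real.log (M + 1) + Real.log n := Real.log_mul (by positivity) (by positivity)
    _ ≤ L₁ + n := add_le_add hL (Real.log_le_self (by linarith))

/-- The centers `c` at distance roughly `R'` from a base point `p` of scale `σ` that is, up to small
multiples of the scales, at least as close to `c` as every point `q i` with
`‖q i - c‖ ≤ T * s i`. -/
def baseCell (q : ι → E) (s : ι → ℝ) (T α : ℝ) (p : E) (σ R' : ℝ) : Set E :=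
  {c | (∀ i, ‖q i - c‖ ≤ T * s i → ‖c - p‖ + α / 2 * σ ≤ ‖q i - c‖ + α / 2 * s i) ∧
    ‖c - p‖ ≤ R' ∧ R' ≤ ‖c - p‖ + α / (64 * T) * (α / 2 * σ)}

theorem exists_mem_baseCell [Finite ι] (q : ι → E) {s : ι → ℝ} (hs : ∀ i, 0 < s i) {T α : ℝ}
    (hT : 0 < T) (hα : 0 < α) {c : E} (hc : ∃ i, ‖q i - c‖ ≤ T * s i) :
    ∃ i, ∃ l ≤ ⌈128 * (T / α) ^ 2⌉₊,
      c ∈ baseCell q s T α (q i) (s i) (l * (α / (64 * T) * (α / 2 * s i))) := by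
  cases nonempty_fintype ι
  obtain ⟨i, hi, hmin⟩ := Finset.exists_min_image
    (Finset.univ.filter fun i => ‖q i - c‖ ≤ T * s i) (fun i => ‖q i - c‖ + α / 2 * s i)
    (by simpa [Finset.Nonempty] using hc)
  simp only [Finset.mem_filter, Finset.mem_univ, true_and] at hi hmin
  have hsi := hs i
  set grid := α / (64 * T) * (α / 2 * s i) with hgrid
  have hgrid0 : 0 < grid := by positivity
  have hlevel : ‖c - q i‖ / grid ≤ 128 * (T / α) ^ 2 := by
    rw [div_le_iff₀ hgrid0, norm_sub_rev]
    refine hi.trans_eq ?_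
    rw [hgrid]
    field_simp
    ring
  refine ⟨i, ⌈‖c - q i‖ / grid⌉₊, Nat.ceil_le_ceil hlevel, fun i' hi' => ?_,
    (div_le_iff₀ hgrid0).1 (Nat.le_ceil _), ?_⟩
  · simpa only [norm_sub_rev c] using hmin i' hi'
  · have := (Nat.ceil_lt_add_one (div_nonneg (norm_nonneg (c - q i)) hgrid0.le)).le
    rwa [div_add_one hgrid0.ne', le_div_iff₀ hgrid0] at this

variable [InnerProductSpace ℝ E]

theorem norm_sub_sq_eq_inner (q p c : E) :
    ‖q - c‖ ^ 2 = ‖q - p‖ ^ 2 - 2 * inner ℝ (q - p) (c - p) + ‖c - p‖ ^ 2 := by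
  rw [← norm_sub_sq_real, sub_sub_sub_cancel_right]

/- `R'` and `y` approximate the distance from `c` to the base point `p` and the inner product
`⟪q - p, c - p⟫`; since `p` is hardly farther from `c` than `q` is, they determine `‖q - c‖`. -/
theorem abs_sqrt_sub_norm_le_of_base {q p c : E} {y b κ η R' : ℝ} (hb : 0 ≤ b) (hη : 0 ≤ η)
    (hη1 : 32 * η ≤ 1) (hκ : 0 ≤ κ) (hbase : ‖c - p‖ + κ / 2 ≤ ‖q - c‖ + b)
    (hR : ‖c - p‖ ≤ R') (hR' : R' ≤ ‖c - p‖ + η * κ)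
    (hy : |y - inner ℝ (q - p) (c - p)| ≤ η * R' * ‖q - p‖) :
    |√(‖q - p‖ ^ 2 - 2 * y + R' ^ 2) - ‖q - c‖| ≤ 32 * η * ‖q - c‖ + b := by
  set ρ := ‖q - c‖ + b with hρ
  have hR0 := norm_nonneg (c - p)
  have hqp : ‖q - p‖ ≤ 2 * ρ := by
    linarith [norm_sub_le_norm_sub_add_norm_sub q c p]
  have hR'ρ : R' ≤ ρ := by nlinarith
  have hinner : η * R' * ‖q - p‖ ≤ η * ρ * (2 * ρ) := by gcongr
  have hradius : R' ^ 2 - ‖c - p‖ ^ 2 ≤ η * (2 * ρ) * (2 * ρ) := by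
    rw [sq_sub_sq, mul_comm]
    have h1 : R' - ‖c - p‖ ≤ η * (2 * ρ) := by nlinarith
    exact mul_le_mul h1 (by linarith) (by linarith) (by nlinarith)
  have hradius0 : 0 ≤ R' ^ 2 - ‖c - p‖ ^ 2 := by nlinarith
  have hsq : |(‖q - p‖ ^ 2 - 2 * y + R' ^ 2) - ‖q - c‖ ^ 2| ≤ 8 * η * ρ ^ 2 := by
    rw [norm_sub_sq_eq_inner q p c]
    rw [abs_le] at hy ⊢
    constructor <;> nlinarith
  have := abs_sqrt_sub_le (norm_nonneg (q - c)) hb (by positivity) (by linarith) hsq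
  linarith

/- A point for which the estimate from the base point would fail is recognized by
`(T + α / 2) * s i` being small compared to `R'`, and is then at distance more than `T * s i`. -/
theorem hasNet_baseCell [Fintype ι] (q : ι → E) {s : ι → ℝ} (hs : ∀ i, 0 < s i)
    {T α : ℝ} (hT : 1 ≤ T) (hα : 0 < α) (hα1 : α ≤ 1) (p : E) {σ R' : ℝ} (hσ : 0 < σ)
    (hR'0 : 0 ≤ R') :
    HasNet (baseCell q s T α p σ R') (fun c i => min ‖q i - c‖ (T * s i)) (fun i => α * s i)
      (2 / (α / (64 * T)) ^ 2 * Real.log (2 * Fintype.card ι + 1)) := by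
  classical
  set η := α / (64 * T) with hη
  set κ := α / 2 with hκ
  have hη0 : 0 < η := by positivity
  have hηT : 64 * η * T = α := by rw [hη]; field_simp
  have hη1 : 64 * η ≤ 1 := by nlinarith
  have hκσ : 0 < κ * σ := by positivity
  have hησ : η * (κ * σ) ≤ κ * σ / 2 := by nlinarith
  refine ((hasNet_inner (fun i => q i - p) hη0 (by linarith) hR'0).precomp (· - p)
    fun c hc => hc.2.1).postcomp (fun y i => if (T + κ) * s i < R' + κ * σ / 2 then T * s i else
      min √(‖q i - p‖ ^ 2 - 2 * y i + R' ^ 2) (T * s i)) fun c hc y hy i => ?_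
  obtain ⟨hbase, hR, hR'⟩ : (∀ i, ‖q i - c‖ ≤ T * s i → ‖c - p‖ + κ * σ ≤ ‖q i - c‖ + κ * s i) ∧
    ‖c - p‖ ≤ R' ∧ R' ≤ ‖c - p‖ + η * (κ * σ) := hc
  have hsi := hs i
  have hTs : 0 < T * s i := by positivity
  have hκs : 0 < κ * s i := by positivity
  split_ifs with hcase
  · have hirr : T * s i ≤ ‖q i - c‖ := by
      by_contra! hrel
      linarith [hbase i hrel.le]
    rw [min_eq_right hirr, sub_self, abs_zero]
    positivity
  · have hρ : ‖c - p‖ + κ * σ / 2 ≤ ‖q i - c‖ + κ * s i := by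
      by_cases hrel : ‖q i - c‖ ≤ T * s i
      · linarith [hbase i hrel]
      · linarith
    have hsqrt := abs_sqrt_sub_norm_le_of_base hκs.le hη0.le (by linarith) hκσ.le hρ hR hR' (hy i)
    refine (abs_min_sub_min_le_of_abs_sub_le (by positivity) (by linarith) hκs.le hTs.le
      hsqrt).trans_eq ?_
    rw [hκ, ← hηT]
    ring

theorem hasNet_min_norm_sub [Fintype ι] (q : ι → E) {s : ι → ℝ} (hs : ∀ i, 0 < s i) {T α L : ℝ}
    (hT : 1 ≤ T) (hα : 0 < α) (hα1 : α ≤ 1) (hL : 1 ≤ L)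
    (hιL : Real.log (2 * Fintype.card ι + 1) ≤ L) :
    HasNet Set.univ (fun c i => min ‖q i - c‖ (T * s i)) (fun i => α * s i)
      (8400 * (T / α) ^ 2 * L) := by
  set r := T / α with hr
  have hr1 : 1 ≤ r := (one_le_div hα).2 (hα1.trans hT)
  set ν := ⌈128 * r ^ 2⌉₊
  let A : Option (ι × Fin (ν + 1)) → Set E := fun o => o.elim {c | ∀ i, T * s i < ‖q i - c‖}
    fun x => baseCell q s T α (q x.1) (s x.1) ((x.2 : ℕ) * (α / (64 * T) * (α / 2 * s x.1)))
  have hA : ∀ o, HasNet (A o) (fun c i => min ‖q i - c‖ (T * s i)) (fun i => α * s i)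
      (8192 * r ^ 2 * L) := by
    have hη2 : 2 / (α / (64 * T)) ^ 2 = 8192 * r ^ 2 := by
      rw [hr]
      field_simp
      norm_num
    rintro (_ | ⟨i, l⟩)
    · refine (HasNet.of_const (fun i => T * s i) fun c hc i => ?_).mono subset_rfl (by positivity)
      rw [min_eq_right (hc i).le, sub_self, abs_zero]
      exact mul_nonneg hα.le (hs i).le
    · have hsi := hs i
      refine (hasNet_baseCell q hs hT hα hα1 (q i) hsi (by positivity)).mono subset_rfl ?_
      rw [hη2]
      gcongr
  have hcover : Set.univ ⊆ ⋃ o, A o := by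
    intro c _
    by_cases hfar : ∀ i, T * s i < ‖q i - c‖
    · exact Set.mem_iUnion.2 ⟨none, hfar⟩
    · push Not at hfar
      obtain ⟨i, l, hl, hc⟩ := exists_mem_baseCell q hs (by linarith) hα hfar
      exact Set.mem_iUnion.2 ⟨some (i, ⟨l, Nat.lt_succ_of_le hl⟩), hc⟩
  have hcard : Real.log (Fintype.card (Option (ι × Fin (ν + 1)))) ≤ L + 130 * r ^ 2 := by
    have hν1 : (ν : ℝ) + 1 ≤ 130 * r ^ 2 := by
      nlinarith [Nat.ceil_lt_add_one (a := 128 * r ^ 2) (by positivity)]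
    rw [Fintype.card_option, Fintype.card_prod, Fintype.card_fin]
    push_cast
    refine (log_mul_add_one_le (by positivity) (by linarith [Nat.cast_nonneg (α := ℝ) ν])
      ((Real.log_le_log (by positivity) ?_).trans hιL)).trans (by linarith)
    linarith [Nat.cast_nonneg (α := ℝ) (Fintype.card ι)]
  refine (HasNet.iUnion hA).mono hcover ?_
  nlinarith [mul_le_mul_of_nonneg_left hL (sq_nonneg r),
    mul_le_mul_of_nonneg_right (one_le_pow₀ hr1 : 1 ≤ r ^ 2) (zero_le_one.trans hL)]

end DistanceNets

section FarNets

variable {E ι κ : Type*} [NormedAddCommGroup E]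

/-- The centers `c` that are far from all `a j` on the scales `Δ j`, and for which `a j₁` is the
closest among those `a j` that are within reach of `c`. -/
def farCell (a : κ → E) (Δ : κ → ℝ) (T : ℝ) (j₁ : κ) : Set E :=
  {c | (∀ j, T * Δ j ≤ ‖c - a j‖) ∧ ‖c - a j₁‖ ≤ 5 * T * Δ j₁ ∧
    ∀ j, ‖c - a j‖ ≤ 5 * T * Δ j → ‖c - a j₁‖ ≤ ‖c - a j‖}

theorem exists_mem_farCell [Finite κ] {a : κ → E} {Δ : κ → ℝ} {T : ℝ} {c : E}
    (hfar : ∀ j, T * Δ j ≤ ‖c - a j‖) (hreach : ∃ j, ‖c - a j‖ ≤ 5 * T * Δ j) :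
    ∃ j₁, c ∈ farCell a Δ T j₁ := by
  obtain ⟨j₁, hj₁, hmin⟩ := Set.exists_min_image {j | ‖c - a j‖ ≤ 5 * T * Δ j}
    (fun j => ‖c - a j‖) (Set.toFinite _) hreach
  exact ⟨j₁, hfar, hj₁, hmin⟩

theorem le_norm_sub_of_out_of_reach {a c q : E} {Δ T : ℝ} (hT : 0 ≤ T * Δ)
    (hr : ‖q - a‖ ≤ T * Δ / 2) (hc : 5 * T * Δ < ‖c - a‖) : 4 * T * Δ ≤ ‖q - c‖ := by
  linarith [norm_sub_rev c q, norm_sub_le_norm_sub_add_norm_sub c q a]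

variable [InnerProductSpace ℝ E]

theorem abs_sqrt_sub_norm_le_of_far {q a c p : E} {b y Δ α : ℝ} (hα : 0 ≤ α) (hα1 : α ≤ 1)
    (hΔ : 0 < Δ) (hΔA : Δ ≤ ‖c - a‖) (hqa : ‖q - a‖ ≤ ‖c - a‖ / 2)
    (hb : |b - ‖c - a‖| ≤ α / 8 * Δ)
    (hy : |y - inner ℝ (q - a) (c - p)| ≤ α / 4 * ‖c - a‖ * ‖q - a‖) :
    |√(‖q - a‖ ^ 2 - 2 * (inner ℝ (q - a) (p - a) + y) + b ^ 2) - ‖q - c‖|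
      ≤ α * (‖q - a‖ + Δ) := by
  set A := ‖c - a‖ with hA
  have hr := norm_nonneg (q - a)
  have hA0 : 0 < A := hΔ.trans_le hΔA
  have hqc : A / 2 ≤ ‖q - c‖ := by
    linarith [norm_sub_le_norm_sub_add_norm_sub c q a, norm_sub_rev c q]
  have hb2 : |b ^ 2 - A ^ 2| ≤ α / 8 * Δ * (3 * A) := by
    rw [sq_sub_sq, mul_comm, abs_mul]
    have : |b + A| ≤ 3 * A := by
      rw [abs_le] at *
      constructor <;> nlinarith
    gcongr
  have hsq : |(‖q - a‖ ^ 2 - 2 * (inner ℝ (q - a) (p - a) + y) + b ^ 2) - ‖q - c‖ ^ 2|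
      ≤ α * (‖q - a‖ + Δ) * (A / 2) := by
    have hsplit : inner ℝ (q - a) (c - a) = inner ℝ (q - a) (c - p) + inner ℝ (q - a) (p - a) := by
      rw [← inner_add_right, sub_add_sub_cancel]
    have hαΔA : 0 ≤ α * Δ * A := by positivity
    rw [norm_sub_sq_eq_inner q a c, hsplit]
    rw [abs_le] at hb2 hy ⊢
    constructor <;> nlinarith
  have hprod := abs_sqrt_sub_mul_add_le (norm_nonneg (q - c)) hsq
  refine le_of_mul_le_mul_right (le_trans ?_ hprod) (half_pos hA0)
  gcongr
  linarith [Real.sqrt_nonneg (‖q - a‖ ^ 2 - 2 * (inner ℝ (q - a) (p - a) + y) + b ^ 2)]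

/- The net fixes the truncated distances from `c` to all `a j` and the inner products with
`c - a j₁`. A cluster whose center is out of reach of `c` is recognized by its truncated distance,
and its points then have truncated distance `4 * T * Δ j`. -/
theorem hasNet_farCell [Fintype ι] [Fintype κ] (cl : ι → κ) (q : ι → E) (a : κ → E) {Δ : κ → ℝ}
    (hΔ : ∀ j, 0 < Δ j) {T α : ℝ} (hT : 1 ≤ T) (hα : 0 < α) (hα1 : α ≤ 1)
    (hr : ∀ i, ‖q i - a (cl i)‖ ≤ T * Δ (cl i) / 2) (j₁ : κ) :
    HasNet (farCell a Δ T j₁) (fun c i => min ‖q i - c‖ (4 * T * Δ (cl i)))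
      (fun i => α * (‖q i - a (cl i)‖ + Δ (cl i)))
      (Fintype.card κ * Real.log (40 * T / α + 1) +
        2 / (α / 20) ^ 2 * Real.log (2 * Fintype.card ι + 1)) := by
  have hbox : HasNet (farCell a Δ T j₁) (fun c j => min ‖c - a j‖ (5 * T * Δ j))
      (fun j => α / 8 * Δ j) (Fintype.card κ * Real.log (40 * T / α + 1)) := by
    refine hasNet_box (fun j => mul_pos (by positivity) (hΔ j)) (by positivity)
      (fun c _ j => le_min (norm_nonneg _) (by have := hΔ j; positivity)) fun c _ j =>
      (min_le_right _ _).trans_eq ?_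
    field_simp
    ring
  have hR : 0 ≤ 5 * T * Δ j₁ := by have := hΔ j₁; positivity
  have hinner := (hasNet_inner (fun i => q i - a (cl i)) (η := α / 20) (by positivity)
    (by linarith) hR).precomp (fun c => c - a j₁) (B := farCell a Δ T j₁) fun c hc => hc.2.1
  refine hbox.postcomp₂ hinner (fun b y i => if 19 / 4 * T * Δ (cl i) ≤ b (cl i)
    then 4 * T * Δ (cl i) else min √(‖q i - a (cl i)‖ ^ 2 -
      2 * (inner ℝ (q i - a (cl i)) (a j₁ - a (cl i)) + y i) + b (cl i) ^ 2) (4 * T * Δ (cl i)))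
    fun c ⟨hfar, _, hmin⟩ b y hb hy i => ?_
  have hΔi := hΔ (cl i)
  have hTΔ : Δ (cl i) ≤ T * Δ (cl i) := by nlinarith
  have hαΔ : α / 8 * Δ (cl i) ≤ T * Δ (cl i) / 8 := by nlinarith
  have hbi := abs_le.1 (hb (cl i))
  have hri := hr i
  have hr0 := norm_nonneg (q i - a (cl i))
  split_ifs with hcase
  · have htrunc : 4 * T * Δ (cl i) ≤ ‖q i - c‖ := by
      linarith [min_le_left ‖c - a (cl i)‖ (5 * T * Δ (cl i)),
        norm_sub_le_norm_sub_add_norm_sub c (q i) (a (cl i)), norm_sub_rev c (q i)]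
    rw [min_eq_right htrunc, sub_self, abs_zero]
    positivity
  · have hle : ‖c - a (cl i)‖ ≤ 5 * T * Δ (cl i) := by
      by_contra! hlt
      rw [min_eq_right hlt.le] at hbi
      linarith
    have hbase : 5 * T * Δ j₁ ≤ 5 * ‖c - a (cl i)‖ := by linarith [hfar j₁, hmin _ hle]
    have hsqrt := abs_sqrt_sub_norm_le_of_far (q := q i) (p := a j₁) (y := y i) hα.le hα1 hΔi
      (hTΔ.trans (hfar _)) (by linarith [hfar (cl i)]) (min_eq_left hle ▸ hb (cl i))
      ((hy i).trans (by nlinarith [mul_nonneg hα.le (norm_nonneg (q i - a (cl i)))]))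
    exact (abs_inf_sub_inf_le_abs _ _ _).trans hsqrt

theorem hasNet_min_norm_sub_of_far [Fintype ι] [Fintype κ] (cl : ι → κ) (q : ι → E) (a : κ → E)
    {Δ : κ → ℝ} (hΔ : ∀ j, 0 < Δ j) {T α L : ℝ} (hT : 1 ≤ T) (hα : 0 < α) (hα1 : α ≤ 1)
    (hL : 1 ≤ L) (hιL : Real.log (2 * Fintype.card ι + 1) ≤ L)
    (hκL : Real.log (Fintype.card κ + 1) ≤ L)
    (hr : ∀ i, ‖q i - a (cl i)‖ ≤ T * Δ (cl i) / 2) :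
    HasNet {c | ∀ j, T * Δ j ≤ ‖c - a j‖} (fun c i => min ‖q i - c‖ (4 * T * Δ (cl i)))
      (fun i => α * (‖q i - a (cl i)‖ + Δ (cl i)))
      (Fintype.card κ * Real.log (41 * T / α) + 801 / α ^ 2 * L) := by
  let A : Option κ → Set E := fun o => o.elim {c | ∀ j, 5 * T * Δ j < ‖c - a j‖} (farCell a Δ T)
  have hTα : 1 ≤ T / α := (one_le_div hα).2 (hα1.trans hT)
  have hlog : Real.log (40 * T / α + 1) ≤ Real.log (41 * T / α) := by
    refine Real.log_le_log (by positivity) ?_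
    rw [mul_div_assoc, mul_div_assoc]
    linarith
  have hlog0 : 0 ≤ Real.log (41 * T / α) :=
    (Real.log_nonneg (by linarith [show 0 ≤ 40 * T / α by positivity])).trans hlog
  have hA : ∀ o, HasNet (A o) (fun c i => min ‖q i - c‖ (4 * T * Δ (cl i)))
      (fun i => α * (‖q i - a (cl i)‖ + Δ (cl i)))
      (Fintype.card κ * Real.log (41 * T / α) + 2 / (α / 20) ^ 2 * L) := by
    rintro (_ | j₁)
    · refine (HasNet.of_const (fun i => 4 * T * Δ (cl i)) fun c hc i => ?_).mono subset_rfl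
        (by positivity)
      have hΔi := hΔ (cl i)
      rw [min_eq_right (le_norm_sub_of_out_of_reach (by positivity) (hr i) (hc (cl i))), sub_self,
        abs_zero]
      positivity
    · refine (hasNet_farCell cl q a hΔ hT hα hα1 hr j₁).mono subset_rfl ?_
      gcongr
  have hcover : {c | ∀ j, T * Δ j ≤ ‖c - a j‖} ⊆ ⋃ o, A o := by
    intro c hc
    by_cases hnone : ∀ j, 5 * T * Δ j < ‖c - a j‖
    · exact Set.mem_iUnion.2 ⟨none, hnone⟩
    · push Not at hnone
      obtain ⟨j₁, hj₁⟩ := exists_mem_farCell hc hnone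
      exact Set.mem_iUnion.2 ⟨some j₁, hj₁⟩
  refine (HasNet.iUnion hA).mono hcover ?_
  have hα2 : 1 ≤ 1 / α ^ 2 := (one_le_div (by positivity)).2 (pow_le_one₀ hα.le hα1)
  have hcard : Real.log (Fintype.card (Option κ)) ≤ 1 / α ^ 2 * L := by
    rw [Fintype.card_option]
    push_cast
    nlinarith
  have : 2 / (α / 20) ^ 2 * L + 1 / α ^ 2 * L = 801 / α ^ 2 * L := by
    field_simp
    norm_num
  linarith

end FarNets

section CostNets

variable {d k : ℕ} {ι κ : Type*}

theorem pointCost_le (S : Fin k → Pt d) (p : Pt d) (c : Fin k) : pointCost S p ≤ dist p (S c) :=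
  ciInf_le (Set.finite_range _).bddBelow c

theorem pointCost_le_dist_add [NeZero k] (S : Fin k → Pt d) (p a : Pt d) :
    pointCost S p ≤ dist p a + pointCost S a := by
  rw [← sub_le_iff_le_add']
  refine le_ciInf fun c => ?_
  linarith [pointCost_le S p c, dist_triangle p a (S c)]

theorem abs_pointCost_sub_le [NeZero k] (S : Fin k → Pt d) (p a : Pt d) :
    |pointCost S p - pointCost S a| ≤ dist p a := by
  rw [abs_sub_le_iff]
  constructor
  · linarith [pointCost_le_dist_add S p a]
  · linarith [pointCost_le_dist_add S a p, dist_comm p a]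

theorem iInf_min_norm_sub_eq_pointCost [NeZero k] (S : Fin k → Pt d) {p : Pt d} {B : ℝ}
    (h : pointCost S p ≤ B) : ⨅ c, min ‖p - S c‖ B = pointCost S p := by
  refine le_antisymm (le_ciInf fun c => ?_) (le_ciInf fun c => le_min ?_ h)
  · exact (ciInf_le (Set.finite_range _).bddBelow c).trans
      ((min_le_left _ _).trans_eq (dist_eq_norm p (S c)).symm)
  · exact (pointCost_le S p c).trans_eq (dist_eq_norm p (S c))

theorem HasNet.pointCost [NeZero k] {A : Set (Pt d)} {x : ι → Pt d} {B tol : ι → ℝ} {K : ℝ}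
    (h : HasNet A (fun c i => min ‖x i - c‖ (B i)) tol K) :
    HasNet {S : Fin k → Pt d | (∀ l, S l ∈ A) ∧ ∀ i, pointCost S (x i) ≤ B i}
      (fun S i => pointCost S (x i)) tol (k * K) := by
  refine ((h.iInf (κ := Fin k)).mono (fun S hS => hS.1) (by simp)).postcomp id
    fun S hS g hg i => ?_
  have := hg i
  rwa [iInf_min_norm_sub_eq_pointCost S (hS.2 i)] at this

theorem log_two_mul_card_add_one_le {M M' L : ℝ} (hM : 0 ≤ M) (hMM' : M ≤ M')
    (hL : Real.log (2 * M' + 1) ≤ L) : Real.log (2 * M + 1) ≤ L :=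
  (Real.log_le_log (by linarith) (by linarith)).trans hL

/-- The cost of the point `q i` for the centers `S`, compared with that of its reference center
`a (cl i)`. -/
def costDiff (q : ι → Pt d) (a : κ → Pt d) (cl : ι → κ) (S : Fin k → Pt d) (i : ι) : ℝ :=
  pointCost S (q i) - pointCost S (a (cl i))

/-- The scale `‖q i - a (cl i)‖ + Δ (cl i)` at which `costDiff q a cl S i` is approximated; for the
points of a cluster with average cost `Δ` its average is `2 Δ`. -/
def radius (q : ι → Pt d) (a : κ → Pt d) (cl : ι → κ) (Δ : κ → ℝ) (i : ι) : ℝ :=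
  dist (q i) (a (cl i)) + Δ (cl i)

theorem abs_costDiff_le_radius [NeZero k] (q : ι → Pt d) (a : κ → Pt d) (cl : ι → κ) {Δ : κ → ℝ}
    (S : Fin k → Pt d) {i : ι} (hΔ : 0 ≤ Δ (cl i)) :
    |costDiff q a cl S i| ≤ radius q a cl Δ i :=
  (abs_pointCost_sub_le S _ _).trans (le_add_of_nonneg_right hΔ)

theorem hasNet_costDiff_near [NeZero k] [Fintype ι] [Fintype κ] (q : ι → Pt d) (a : κ → Pt d)
    (cl : ι → κ) {Δ : κ → ℝ} (hΔ : ∀ j, 0 < Δ j) {T α L : ℝ} (hT : 1 ≤ T) (hα : 0 < α)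
    (hα1 : α ≤ 1) (hL : 1 ≤ L)
    (hcard : Real.log (2 * (Fintype.card ι + Fintype.card κ) + 1) ≤ L) :
    HasNet {S : Fin k → Pt d | ∀ j, pointCost S (a j) ≤ 2 * T * Δ j}
      (costDiff q a cl) (fun i => α * radius q a cl Δ i) (k * (134400 * (T / α) ^ 2 * L)) := by
  let s : ι ⊕ κ → ℝ := Sum.elim (fun i => dist (q i) (a (cl i)) + Δ (cl i)) Δ
  have hs : ∀ z, 0 < s z := by
    rintro (i | j)
    · exact add_pos_of_nonneg_of_pos dist_nonneg (hΔ _)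
    · exact hΔ j
  have hnet := (hasNet_min_norm_sub (Sum.elim q a) hs (T := 2 * T) (α := α / 2) (L := L)
    (by linarith) (by linarith) (by linarith) hL (by simpa using hcard)).pointCost (k := k)
  refine (hnet.mono (A' := {S | ∀ j, pointCost S (a j) ≤ 2 * T * Δ j}) ?_ (le_of_eq ?_)).postcomp
    (fun g i => g (.inl i) - g (.inr (cl i))) fun S _ g hg i => ?_
  · refine fun S hS => ⟨fun _ => Set.mem_univ _, ?_⟩
    rintro (i | j)
    · have := pointCost_le_dist_add S (q i) (a (cl i))
      have := hS (cl i)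
      simp only [Sum.elim_inl, s]
      nlinarith [dist_nonneg (x := q i) (y := a (cl i))]
    · exact hS j
  · field_simp
    ring
  · have hi := abs_le.1 (hg (.inl i))
    have hj := abs_le.1 (hg (.inr (cl i)))
    have hαr : 0 ≤ α * dist (q i) (a (cl i)) := mul_nonneg hα.le dist_nonneg
    simp only [Sum.elim_inl, Sum.elim_inr, s] at hi hj
    rw [costDiff, radius, abs_le]
    constructor <;> linarith

theorem hasNet_pointCost_far [NeZero k] [Fintype ι] [Fintype κ] (cl : ι → κ) (q : ι → Pt d)
    (a : κ → Pt d) {Δ : κ → ℝ} (hΔ : ∀ j, 0 < Δ j) {T α L : ℝ} (hT : 1 ≤ T) (hα : 0 < α)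
    (hα1 : α ≤ 1) (hL : 1 ≤ L) (hιL : Real.log (2 * Fintype.card ι + 1) ≤ L)
    (hκL : Real.log (Fintype.card κ + 1) ≤ L)
    (hr : ∀ i, ‖q i - a (cl i)‖ ≤ T * Δ (cl i) / 2) :
    HasNet {S : Fin k → Pt d | ∀ j, T * Δ j ≤ pointCost S (a j) ∧ pointCost S (a j) ≤ 2 * T * Δ j}
      (fun S i => pointCost S (q i)) (fun i => α * (‖q i - a (cl i)‖ + Δ (cl i)))
      (k * (Fintype.card κ * Real.log (41 * T / α) + 801 / α ^ 2 * L)) := by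
  refine ((hasNet_min_norm_sub_of_far cl q a hΔ hT hα hα1 hL hιL hκL hr).pointCost (k := k)).mono
    (fun S hS => ⟨fun l j => ?_, fun i => ?_⟩) le_rfl
  · exact (hS j).1.trans ((pointCost_le S (a j) l).trans_eq (dist_comm _ _ |>.trans
      (dist_eq_norm _ _)))
  · have := pointCost_le_dist_add S (q i) (a (cl i))
    rw [dist_eq_norm] at this
    linarith [hr i, (hS (cl i)).2, mul_pos (zero_lt_one.trans_le hT) (hΔ (cl i))]

theorem hasNet_pointCost_of_dist_ge [NeZero k] [Fintype ι] (cl : ι → κ) (q : ι → Pt d)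
    (a : κ → Pt d) {Δ : κ → ℝ} (hΔ : ∀ j, 0 < Δ j) {T α L : ℝ} (hα : 0 < α) (hα1 : α ≤ 1)
    (hL : 1 ≤ L) (hιL : Real.log (2 * Fintype.card ι + 1) ≤ L)
    (hr : ∀ i, T * Δ (cl i) / 2 ≤ dist (q i) (a (cl i))) :
    HasNet {S : Fin k → Pt d | ∀ j, pointCost S (a j) ≤ 2 * T * Δ j}
      (fun S i => pointCost S (q i)) (fun i => α * (dist (q i) (a (cl i)) + Δ (cl i)))
      (k * (210000 / α ^ 2 * L)) := by
  have hs : ∀ i, 0 < dist (q i) (a (cl i)) + Δ (cl i) :=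
    fun i => add_pos_of_nonneg_of_pos dist_nonneg (hΔ _)
  refine ((hasNet_min_norm_sub q hs (T := 5) (by norm_num) hα hα1 hL hιL).pointCost (k := k)).mono
    (fun S hS => ⟨fun _ => Set.mem_univ _, fun i => ?_⟩) (le_of_eq ?_)
  · linarith [pointCost_le_dist_add S (q i) (a (cl i)), hr i, hS (cl i), hΔ (cl i)]
  · field_simp
    ring

theorem hasNet_costDiff_of_split {q : ι → Pt d} {a : κ → Pt d} {cl : ι → κ} {Δ : κ → ℝ} {α K K' : ℝ}
    {A : Set (Fin k → Pt d)} (p : ι → Prop) (hα : 0 ≤ α)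
    (h : HasNet A (fun S z => pointCost S (Sum.elim (fun i : {i // p i} => q i) a z))
      (Sum.elim (fun i : {i // p i} => α / 2 * radius q a cl Δ i) fun j => α / 2 * Δ j) K)
    (h' : HasNet A (fun S (i : {i // ¬ p i}) => pointCost S (q i))
      (fun i => α / 2 * radius q a cl Δ i) K') :
    HasNet A (costDiff q a cl) (fun i => α * radius q a cl Δ i) (K + K') := by
  classical
  refine h.postcomp₂ h' (fun g g' i =>
    (if hi : p i then g (.inl ⟨i, hi⟩) else g' ⟨i, hi⟩) - g (.inr (cl i)))
    fun S _ g g' hg hg' i => ?_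
  have hcenter : |g (.inr (cl i)) - pointCost S (a (cl i))| ≤ α / 2 * Δ (cl i) :=
    hg (.inr (cl i))
  have hpoint : |(if hi : p i then g (.inl ⟨i, hi⟩) else g' ⟨i, hi⟩) - pointCost S (q i)|
      ≤ α / 2 * radius q a cl Δ i := by
    split_ifs with hi
    · exact hg (.inl ⟨i, hi⟩)
    · exact hg' ⟨i, hi⟩
  have hdist : 0 ≤ α * dist (q i) (a (cl i)) := mul_nonneg hα dist_nonneg
  rw [radius] at hpoint ⊢
  rw [costDiff]
  rw [abs_le] at *
  constructor <;> linarith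

theorem hasNet_costDiff_far [NeZero k] [Fintype ι] [Fintype κ] (q : ι → Pt d) (a : κ → Pt d)
    (cl : ι → κ) {Δ : κ → ℝ} (hΔ : ∀ j, 0 < Δ j) {T α L : ℝ} (hT : 1 ≤ T) (hα : 0 < α)
    (hα1 : α ≤ 1) (hL : 1 ≤ L)
    (hcard : Real.log (2 * (Fintype.card ι + Fintype.card κ) + 1) ≤ L) :
    HasNet {S : Fin k → Pt d | ∀ j, T * Δ j ≤ pointCost S (a j) ∧ pointCost S (a j) ≤ 2 * T * Δ j}
      (costDiff q a cl) (fun i => α * radius q a cl Δ i)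
      (k * (Fintype.card κ * Real.log (82 * T / α) + 850000 / α ^ 2 * L)) := by
  classical
  let inner : ι → Prop := fun i => ‖q i - a (cl i)‖ ≤ T * Δ (cl i) / 2
  have : 0 ≤ (Fintype.card ι : ℝ) := Nat.cast_nonneg _
  have hκ : 0 ≤ (Fintype.card κ : ℝ) := Nat.cast_nonneg _
  have hsub : ∀ (p : ι → Prop) [Fintype {i // p i}],
      (Fintype.card {i // p i} : ℝ) ≤ Fintype.card ι := fun p _ => by
    exact_mod_cast Fintype.card_subtype_le p
  have hinner := hasNet_pointCost_far (k := k) (ι := {i // inner i} ⊕ κ) (α := α / 2)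
    (Sum.elim (fun i => cl i) id) (Sum.elim (fun i => q i) a) a hΔ hT (by linarith) (by linarith) hL
    (log_two_mul_card_add_one_le (Nat.cast_nonneg _) (by simpa using hsub inner) hcard)
    ((Real.log_le_log (by linarith) (by linarith)).trans hcard) (by
      rintro (i | j)
      · exact i.2
      · have := hΔ j
        simpa using show 0 ≤ T * Δ j / 2 by positivity)
  have houter := hasNet_pointCost_of_dist_ge (k := k) (ι := {i // ¬ inner i}) (α := α / 2)
    (fun i => cl i) (fun i => q i) a hΔ (T := T) (by linarith) (by linarith) hL
    (log_two_mul_card_add_one_le (Nat.cast_nonneg _)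
      (le_add_of_le_of_nonneg (hsub _) hκ) hcard)
    fun i => (dist_eq_norm (q i) (a (cl i))).symm ▸ (not_le.1 i.2).le
  have htol : (fun z => α / 2 * (‖Sum.elim (fun i : {i // inner i} => q i) a z -
        a (Sum.elim (fun i : {i // inner i} => cl i) id z)‖ +
        Δ (Sum.elim (fun i : {i // inner i} => cl i) id z)))
      = Sum.elim (fun i : {i // inner i} => α / 2 * radius q a cl Δ i) fun j => α / 2 * Δ j := by
    funext z
    rcases z with i | j <;> simp [radius, dist_eq_norm]
  refine (hasNet_costDiff_of_split inner hα.le (htol ▸ hinner)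
    (houter.mono (fun S hS j => (hS j).2) le_rfl)).mono subset_rfl ?_
  have hlog : 41 * T / (α / 2) = 82 * T / α := by
    field_simp
    norm_num
  have hnum : 801 / (α / 2) ^ 2 * L + 210000 / (α / 2) ^ 2 * L = 843204 / α ^ 2 * L := by
    field_simp
    norm_num
  have hle : 843204 / α ^ 2 * L ≤ 850000 / α ^ 2 * L := by gcongr; norm_num
  rw [hlog, ← mul_add]
  refine mul_le_mul_of_nonneg_left ?_ (Nat.cast_nonneg k)
  linarith

end CostNets

section Signs

open ProbabilityTheory

variable {X ι : Type*}

theorem exists_chain_of_hasNet {A : Set X} {f : X → ι → ℝ} {e : ι → ℝ} {B : ℝ} {H : ℕ}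
    (hB : 0 ≤ B) (hf : ∀ a ∈ A, ∀ i, |f a i| ≤ e i)
    (hnet : ∀ h, 1 ≤ h → h ≤ H → HasNet A f (fun i => (1 / 2) ^ h * e i) (B * 4 ^ h)) :
    ∃ N : ℕ → Finset (ι → ℝ), N 0 = {0} ∧
      (∀ h ≤ H, ((N h).card : ℝ) ≤ Real.exp (B * 4 ^ h)) ∧
      ∀ a ∈ A, ∃ g : ℕ → ι → ℝ, ∀ h ≤ H, g h ∈ N h ∧ ∀ i, |g h i - f a i| ≤ (1 / 2) ^ h * e i := by
  choose! N hN hNf using hnet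
  choose! g hg using hNf
  refine ⟨Function.update N 0 {0}, by simp, fun h hh => ?_,
    fun a ha => ⟨Function.update (fun h => g h a) 0 0, fun h hh => ?_⟩⟩
  · rcases eq_or_ne h 0 with rfl | h0
    · simpa using hB
    · simpa [h0] using hN h (Nat.one_le_iff_ne_zero.2 h0) hh
  · rcases eq_or_ne h 0 with rfl | h0
    · simpa using hf a ha
    · simpa [h0] using hg h (Nat.one_le_iff_ne_zero.2 h0) hh a ha

/-- The real sign encoded by a Boolean: a fair Boolean becomes a Rademacher variable. -/
def sgn (b : Bool) : ℝ := bif b then 1 else -1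

/-- The law of independent fair signs, indexed by `ι` and encoded as Booleans. -/
def signLaw (ι : Type*) [Fintype ι] : Measure (ι → Bool) :=
  Measure.pi fun _ => (PMF.uniformOfFintype Bool).toMeasure

variable [Fintype ι]

instance : IsProbabilityMeasure (signLaw ι) := by
  unfold signLaw
  infer_instance

theorem abs_sgn (b : Bool) : |sgn b| = 1 := by cases b <;> simp [sgn]

theorem abs_signed_sum_le (σ : ι → Bool) {z e : ι → ℝ} (h : ∀ i, |z i| ≤ e i) :
    |∑ i, sgn (σ i) * z i| ≤ ∑ i, e i := by
  refine (Finset.abs_sum_le_sum_abs _ _).trans (Finset.sum_le_sum fun i _ => ?_)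
  rw [abs_mul, abs_sgn, one_mul]
  exact h i

theorem hasSubgaussianMGF_sgn_mul (y : ℝ) :
    HasSubgaussianMGF (fun b => sgn b * y) (‖y‖₊ ^ 2) (PMF.uniformOfFintype Bool).toMeasure := by
  have h := hasSubgaussianMGF_of_mem_Icc_of_integral_eq_zero (a := -|y|) (b := |y|)
    (μ := (PMF.uniformOfFintype Bool).toMeasure) (X := fun b => sgn b * y)
    (measurable_of_finite _).aemeasurable
    (.of_forall fun b => by rw [Set.mem_Icc, ← abs_le, abs_mul, abs_sgn, one_mul])
    (by simp [PMF.integral_eq_sum, sgn])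
  convert h using 2
  ext
  push_cast
  rw [Real.norm_eq_abs, Real.norm_eq_abs, sub_neg_eq_add, ← two_mul, abs_mul, abs_abs]
  norm_num

theorem hasSubgaussianMGF_signed_sum (z : ι → ℝ) :
    HasSubgaussianMGF (fun σ => ∑ i, sgn (σ i) * z i) (∑ i, ‖z i‖₊ ^ 2) (signLaw ι) := by
  refine HasSubgaussianMGF.sum_of_iIndepFun
    (iIndepFun_pi fun i => (measurable_of_finite fun b => sgn b * z i).aemeasurable) fun i _ => ?_
  have heval := measurePreserving_eval (fun _ : ι => (PMF.uniformOfFintype Bool).toMeasure) i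
  exact HasSubgaussianMGF.of_map (X := fun b => sgn b * z i) heval.measurable.aemeasurable
    (heval.map_eq.symm ▸ hasSubgaussianMGF_sgn_mul (z i))

theorem signLaw_lt_abs_signed_sum_le (z : ι → ℝ) {V t : ℝ} (hV : 0 < V) (ht : 0 ≤ t)
    (hz : ∑ i, z i ^ 2 ≤ V) :
    (signLaw ι).real {σ | t < |∑ i, sgn (σ i) * z i|} ≤ 2 * Real.exp (-(t ^ 2 / (2 * V))) := by
  have hV' : ((∑ i, ‖z i‖₊ ^ 2 : NNReal) : ℝ) ≤ V := by simpa using hz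
  have tail : ∀ Y : (ι → Bool) → ℝ, HasSubgaussianMGF Y (∑ i, ‖z i‖₊ ^ 2) (signLaw ι) →
      (signLaw ι).real {σ | t ≤ Y σ} ≤ Real.exp (-(t ^ 2 / (2 * V))) := fun Y hY => by
    have hYV : HasSubgaussianMGF Y V.toNNReal (signLaw ι) :=
      ⟨hY.integrable_exp_mul, fun s => (hY.mgf_le s).trans <| Real.exp_le_exp.2 <| by
        rw [Real.coe_toNNReal V hV.le]
        gcongr⟩
    simpa [Real.coe_toNNReal V hV.le, neg_div] using hYV.measure_ge_le ht
  have hle : (signLaw ι).real {σ | t < |∑ i, sgn (σ i) * z i|} ≤ (signLaw ι).real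
      ({σ | t ≤ ∑ i, sgn (σ i) * z i} ∪ {σ | t ≤ (-fun σ => ∑ i, sgn (σ i) * z i) σ}) :=
    measureReal_mono fun σ hσ => (lt_abs.1 hσ).imp le_of_lt fun h => (le_of_lt h : t ≤ _)
  linarith [tail _ (hasSubgaussianMGF_signed_sum z), tail _ (hasSubgaussianMGF_signed_sum z).neg,
    hle.trans (measureReal_union_le _ _)]

theorem measureReal_biUnion_le_card_mul {Ω β : Type*} [MeasurableSpace Ω] (μ : Measure Ω)
    (s : Finset β) (A : β → Set Ω) {δ : ℝ} (h : ∀ b ∈ s, μ.real (A b) ≤ δ) :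
    μ.real (⋃ b ∈ s, A b) ≤ s.card * δ :=
  (measureReal_biUnion_finset_le s A).trans <| by
    simpa using Finset.sum_le_card_nsmul s _ δ h

theorem signLaw_exists_links_le (N N' : Finset (ι → ℝ)) {e : ι → ℝ} {V s t K K' : ℝ} (hV : 0 < V)
    (heV : ∑ i, e i ^ 2 ≤ V) (hs : 0 < s) (ht : 0 ≤ t) (hN : (N.card : ℝ) ≤ Real.exp K)
    (hN' : (N'.card : ℝ) ≤ Real.exp K') :
    (signLaw ι).real {σ | ∃ g ∈ N, ∃ g' ∈ N', (∀ i, |g' i - g i| ≤ s * e i) ∧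
        t < |∑ i, sgn (σ i) * (g' i - g i)|}
      ≤ 2 * Real.exp (K + K' - t ^ 2 / (2 * (s ^ 2 * V))) := by
  classical
  let links := (N ×ˢ N').filter fun g => ∀ i, |g.2 i - g.1 i| ≤ s * e i
  have hlink : ∀ g ∈ links, (signLaw ι).real {σ | t < |∑ i, sgn (σ i) * (g.2 i - g.1 i)|}
      ≤ 2 * Real.exp (-(t ^ 2 / (2 * (s ^ 2 * V)))) := fun g hg => by
    refine signLaw_lt_abs_signed_sum_le _ (by positivity) ht ?_
    calc ∑ i, (g.2 i - g.1 i) ^ 2 ≤ ∑ i, s ^ 2 * e i ^ 2 := Finset.sum_le_sum fun i _ => by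
          rw [← sq_abs, ← mul_pow]
          exact pow_le_pow_left₀ (abs_nonneg _) ((Finset.mem_filter.1 hg).2 i) 2
      _ ≤ s ^ 2 * V := by rw [← Finset.mul_sum]; gcongr
  have hcard : (links.card : ℝ) ≤ Real.exp K * Real.exp K' := by
    calc (links.card : ℝ) ≤ N.card * N'.card := by
          exact_mod_cast (Finset.card_filter_le _ _).trans_eq (Finset.card_product _ _)
      _ ≤ _ := by gcongr
  calc _ ≤ (signLaw ι).real (⋃ g ∈ links, {σ | t < |∑ i, sgn (σ i) * (g.2 i - g.1 i)|}) := by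
        refine measureReal_mono (fun σ hσ => ?_) (measure_ne_top _ _)
        obtain ⟨g, hg, g', hg', hclose, hlt⟩ := hσ
        exact Set.mem_biUnion (x := (g, g'))
          (Finset.mem_filter.2 ⟨Finset.mk_mem_product hg hg', hclose⟩) hlt
    _ ≤ links.card * (2 * Real.exp (-(t ^ 2 / (2 * (s ^ 2 * V))))) :=
        measureReal_biUnion_le_card_mul _ _ _ hlink
    _ ≤ Real.exp K * Real.exp K' * (2 * Real.exp (-(t ^ 2 / (2 * (s ^ 2 * V))))) := by gcongr
    _ = _ := by rw [sub_eq_add_neg, Real.exp_add, Real.exp_add]; ring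

theorem abs_signed_sum_le_of_chain (σ : ι → Bool) {z e : ι → ℝ} {g : ℕ → ι → ℝ} {t : ℝ} {H : ℕ}
    (hg0 : g 0 = 0) (hgz : ∀ i, |g H i - z i| ≤ (1 / 2) ^ H * e i)
    (hlink : ∀ h < H, |∑ i, sgn (σ i) * (g (h + 1) i - g h i)| ≤ t) :
    |∑ i, sgn (σ i) * z i| ≤ (1 / 2) ^ H * ∑ i, e i + H * t := by
  have htel : ∑ i, sgn (σ i) * z i = ∑ i, sgn (σ i) * (z i - g H i)
      + ∑ h ∈ Finset.range H, ∑ i, sgn (σ i) * (g (h + 1) i - g h i) := by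
    rw [Finset.sum_comm, ← Finset.sum_add_distrib]
    refine Finset.sum_congr rfl fun i _ => ?_
    rw [← Finset.mul_sum, Finset.sum_range_sub fun h => g h i, hg0, Pi.zero_apply]
    ring
  rw [htel, Finset.mul_sum]
  refine (abs_add_le _ _).trans (add_le_add (abs_signed_sum_le σ fun i => ?_) ?_)
  · rw [abs_sub_comm]
    exact hgz i
  · refine (Finset.abs_sum_le_sum_abs _ _).trans ?_
    simpa using Finset.sum_le_card_nsmul (Finset.range H) _ t fun h hh =>
      hlink h (Finset.mem_range.1 hh)

theorem half_pow_sq (h : ℕ) : ((1 / 2 : ℝ) ^ h) ^ 2 = 1 / 4 ^ h := by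
  rw [← pow_mul, mul_comm, pow_mul, ← one_div_pow]
  norm_num

theorem signLaw_chaining_le {A : Set X} {f : X → ι → ℝ} {e : ι → ℝ} {V B t : ℝ} (H : ℕ)
    (hV : 0 < V) (heV : ∑ i, e i ^ 2 ≤ V) (hB : 0 ≤ B) (hf : ∀ a ∈ A, ∀ i, |f a i| ≤ e i)
    (hnet : ∀ h, 1 ≤ h → h ≤ H → HasNet A f (fun i => (1 / 2) ^ h * e i) (B * 4 ^ h))
    (ht : 0 ≤ t) (htB : 72 * B * V ≤ t ^ 2) :
    (signLaw ι).real {σ | ∃ a ∈ A, (1 / 2) ^ H * ∑ i, e i + H * t < |∑ i, sgn (σ i) * f a i|}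
      ≤ H * (2 * Real.exp (-(8 * B))) := by
  obtain ⟨N, hN0, hN, hNf⟩ := exists_chain_of_hasNet hB hf hnet
  let bad : ℕ → Set (ι → Bool) := fun h => {σ | ∃ g ∈ N h, ∃ g' ∈ N (h + 1),
    (∀ i, |g' i - g i| ≤ 3 * (1 / 2) ^ (h + 1) * e i) ∧ t < |∑ i, sgn (σ i) * (g' i - g i)|}
  have hbad : ∀ h ∈ Finset.range H, (signLaw ι).real (bad h) ≤ 2 * Real.exp (-(8 * B)) := by
    intro h hh
    have hhH := Finset.mem_range.1 hh
    refine (signLaw_exists_links_le _ _ hV heV (by positivity) ht (hN h hhH.le)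
      (hN (h + 1) hhH)).trans ?_
    have h4 : (1 : ℝ) ≤ 4 ^ h := one_le_pow₀ (by norm_num)
    have hsq : (3 * (1 / 2 : ℝ) ^ (h + 1)) ^ 2 = 9 / (4 * 4 ^ h) := by
      rw [mul_pow, pow_succ _ h, mul_pow, half_pow_sq]
      ring
    have hexp : 16 * (B * 4 ^ h) ≤ t ^ 2 / (2 * ((3 * (1 / 2) ^ (h + 1)) ^ 2 * V)) := by
      rw [hsq, le_div_iff₀ (by positivity)]
      refine le_of_eq_of_le ?_ htB
      field_simp
      ring
    gcongr
    rw [pow_succ]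
    nlinarith [mul_nonneg hB (sub_nonneg.2 h4)]
  refine le_trans (measureReal_mono (fun σ hσ => ?_) (measure_ne_top _ _)) <|
    (measureReal_biUnion_le_card_mul _ (Finset.range H) bad hbad).trans_eq (by simp)
  obtain ⟨a, ha, hlt⟩ := hσ
  obtain ⟨g, hg⟩ := hNf a ha
  have hg0 : g 0 = 0 := by simpa [hN0] using (hg 0 H.zero_le).1
  by_contra hcon
  refine hlt.not_ge (abs_signed_sum_le_of_chain σ hg0 (hg H le_rfl).2 fun h hh => ?_)
  by_contra! hlink
  refine hcon (Set.mem_biUnion (Finset.mem_coe.2 (Finset.mem_range.2 hh))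
    ⟨g h, (hg h hh.le).1, g (h + 1), (hg (h + 1) hh).1, fun i => ?_, hlink⟩)
  have hhalf : (1 / 2 : ℝ) ^ h = 2 * (1 / 2) ^ (h + 1) := by rw [pow_succ]; ring
  have h1 := abs_le.1 ((hg h hh.le).2 i)
  have h2 := abs_le.1 ((hg (h + 1) hh).2 i)
  rw [hhalf] at h1
  rw [abs_le]
  constructor <;> linarith

theorem signLaw_chaining_log_le {A : Set X} {f : X → ι → ℝ} {e : ι → ℝ} {V B W ε : ℝ} {N : ℕ}
    (hV : 0 < V) (heV : ∑ i, e i ^ 2 ≤ V) (hB : 0 ≤ B) (hf : ∀ a ∈ A, ∀ i, |f a i| ≤ e i)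
    (hnet : ∀ h, 1 ≤ h → h ≤ 3 * (N + 1) → HasNet A f (fun i => (1 / 2) ^ h * e i) (B * 4 ^ h))
    (hW : 0 ≤ W) (heW : ∑ i, e i ≤ 4 * W) (hεN : 1 ≤ ε * 2 ^ N)
    (hBV : 2592 * (N + 1) ^ 6 * (B * V) ≤ (ε * W) ^ 2) :
    (signLaw ι).real {σ | ∃ a ∈ A, ε / (N + 1) ^ 2 * W < |∑ i, sgn (σ i) * f a i|}
      ≤ 6 * (N + 1) * Real.exp (-(8 * B)) := by
  have hε : 0 < ε := (pos_iff_pos_of_mul_pos (by linarith)).2 (by positivity : (0 : ℝ) < 2 ^ N)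
  set t : ℝ := ε * W / (6 * (N + 1) ^ 3)
  have hlink : 72 * B * V ≤ t ^ 2 := by
    rw [div_pow, le_div_iff₀ (by positivity)]
    linarith
  have htail : (1 / 2 : ℝ) ^ (3 * (N + 1)) ≤ ε / (N + 1) ^ 2 / 8 := by
    have hsq : ((N : ℝ) + 1) ^ 2 ≤ (2 ^ N) ^ 2 := by
      gcongr
      exact_mod_cast Nat.succ_le_of_lt (Nat.lt_two_pow_self (n := N))
    have hpow : (2 : ℝ) ^ (3 * (N + 1)) = 8 * ((2 ^ N) ^ 2 * 2 ^ N) := by ring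
    rw [one_div_pow, div_div, div_le_div_iff₀ (by positivity) (by positivity), hpow]
    calc 1 * (((N : ℝ) + 1) ^ 2 * 8) ≤ 8 * ((2 ^ N) ^ 2 * 1) := by linarith
      _ ≤ 8 * ((2 ^ N) ^ 2 * (ε * 2 ^ N)) := by gcongr
      _ = ε * (8 * ((2 ^ N) ^ 2 * 2 ^ N)) := by ring
  have hsum : (1 / 2 : ℝ) ^ (3 * (N + 1)) * ∑ i, e i + (3 * (N + 1) : ℕ) * t
      ≤ ε / (N + 1) ^ 2 * W := by
    have hhalf : ((3 * (N + 1) : ℕ) : ℝ) * t = ε / (N + 1) ^ 2 * W / 2 := by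
      simp only [t]
      push_cast
      field_simp
      ring
    calc _ ≤ (1 / 2 : ℝ) ^ (3 * (N + 1)) * (4 * W) + ε / (N + 1) ^ 2 * W / 2 := by
          rw [hhalf]
          gcongr
      _ ≤ ε / (N + 1) ^ 2 / 8 * (4 * W) + ε / (N + 1) ^ 2 * W / 2 := by gcongr
      _ = _ := by ring
  refine (measureReal_mono (fun σ hσ => ?_) (measure_ne_top _ _)).trans <|
    (signLaw_chaining_le (3 * (N + 1)) hV heV hB hf hnet (by positivity) hlink).trans_eq (by
      push_cast; ring)
  obtain ⟨a, ha, hlt⟩ := hσ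
  exact ⟨a, ha, hsum.trans_lt hlt⟩

end Signs

section Classes

variable {d k m N : ℕ} {X ι κ : Type*}

theorem signLaw_chaining_of_sum_le {A : Set X} {f : X → Fin m → ℝ} {e : Fin m → ℝ} {B b Ψ W ε : ℝ}
    (hf : ∀ x ∈ A, ∀ i, |f x i| ≤ e i) (hb : 0 < b) (hΨ : 0 < Ψ) (hm : 0 < m)
    (heb : ∀ i, e i ≤ 4 / m * b) (heΨ : ∑ i, e i ≤ 4 * Ψ) (he : ∀ i, 0 ≤ e i) (hΨW : Ψ ≤ W)
    (hnet : ∀ h, 1 ≤ h → h ≤ 3 * (N + 1) → HasNet A f (fun i => (1 / 2) ^ h * e i) (B * 4 ^ h))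
    (hB : 0 ≤ B) (hεN : 1 ≤ ε * 2 ^ N)
    (hBm : 41472 * (N + 1) ^ 6 * (B * (b * Ψ)) ≤ ε ^ 2 * m * W ^ 2) :
    (signLaw (Fin m)).real {σ | ∃ x ∈ A, ε / (N + 1) ^ 2 * W < |∑ i, sgn (σ i) * f x i|}
      ≤ 6 * (N + 1) * Real.exp (-(8 * B)) := by
  have hm0 : (0 : ℝ) < m := by exact_mod_cast hm
  have heV : ∑ i, e i ^ 2 ≤ 16 * b * Ψ / m := by
    calc ∑ i, e i ^ 2 ≤ ∑ i, 4 / m * b * e i := Finset.sum_le_sum fun i _ => by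
          rw [sq]
          exact mul_le_mul_of_nonneg_right (heb i) (he i)
      _ ≤ 4 / m * b * (4 * Ψ) := by rw [← Finset.mul_sum]; gcongr
      _ = _ := by ring
  refine signLaw_chaining_log_le (by positivity) heV hB hf hnet (hΨ.le.trans hΨW) (by linarith)
    hεN ?_
  calc 2592 * ((N : ℝ) + 1) ^ 6 * (B * (16 * b * Ψ / m))
      = 41472 * (N + 1) ^ 6 * (B * (b * Ψ)) / m := by ring
    _ ≤ (ε * W) ^ 2 := by
      rw [div_le_iff₀ hm0]
      linarith

theorem HasNet.indicator_mul {A : Set X} {s : Set ι} {f : X → ι → ℝ} {e w : ι → ℝ} {α K : ℝ}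
    (h : HasNet A (fun a (i : s) => f a i) (fun i => α * e i) K) (hw : ∀ i, 0 ≤ w i) :
    HasNet A (fun a i => s.indicator w i * f a i) (fun i => α * (s.indicator w i * e i)) K := by
  classical
  refine h.postcomp (fun g i => if hi : i ∈ s then w i * g ⟨i, hi⟩ else 0) fun a _ g hg i => ?_
  by_cases hi : i ∈ s
  · simp only [hi, dite_true, Set.indicator_of_mem]
    rw [← mul_sub, abs_mul, abs_of_nonneg (hw i), mul_left_comm]
    exact mul_le_mul_of_nonneg_left (hg ⟨i, hi⟩) (hw i)
  · simp [hi]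

theorem log_card_subtype_le (s : Set (Fin m)) [Fintype s] (G : Finset (Fin k)) :
    Real.log (2 * (Fintype.card s + Fintype.card G) + 1) ≤ Real.log (2 * (m + k) + 1) := by
  have hs : (Fintype.card s : ℝ) ≤ m := by
    exact_mod_cast (Fintype.card_subtype_le (· ∈ s)).trans_eq (Fintype.card_fin m)
  have hG : (Fintype.card G : ℝ) ≤ k := by
    exact_mod_cast (Fintype.card_coe G).trans_le ((Finset.card_le_univ G).trans_eq
      (Fintype.card_fin k))
  exact Real.log_le_log (by positivity) (by linarith)

theorem one_le_log_two_mul_add_one {x : ℝ} (hx : 1 ≤ x) : 1 ≤ Real.log (2 * x + 1) := by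
  rw [Real.le_log_iff_exp_le (by linarith)]
  linarith [Real.exp_one_lt_d9]

theorem one_le_log_card [NeZero k] : 1 ≤ Real.log (2 * ((m : ℝ) + k) + 1) := by
  have hk : (1 : ℝ) ≤ k := by exact_mod_cast NeZero.one_le
  exact one_le_log_two_mul_add_one (le_add_of_nonneg_of_le (Nat.cast_nonneg m) hk)

/-- The weights `w`, set to zero outside the clusters in `G`. -/
def clusterWeight (cl : Fin m → Fin k) (G : Finset (Fin k)) (w : Fin m → ℝ) : Fin m → ℝ :=
  (cl ⁻¹' ↑G).indicator w

/-- The tuples of centers for which every center `a j` with `j ∈ G` has cost between `2 ^ t * Δ j`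
and `2 * 2 ^ t * Δ j`; the lowest level `t = 0` has no lower bound. -/
def costClass (a : Fin k → Pt d) (Δ : Fin k → ℝ) (G : Finset (Fin k)) (t : ℕ) :
    Set (Fin k → Pt d) :=
  {S | ∀ j ∈ G, pointCost S (a j) ≤ 2 * 2 ^ t * Δ j ∧ (1 ≤ t → 2 ^ t * Δ j ≤ pointCost S (a j))}

theorem log_two_pow_div_half_pow_le {t h : ℕ} (ht : t ≤ N) (hh : h ≤ 3 * (N + 1)) :
    Real.log (82 * 2 ^ t / (1 / 2) ^ h) ≤ 10 * (N + 1) := by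
  have hle : 82 * 2 ^ t / (1 / 2 : ℝ) ^ h ≤ 2 ^ (4 * N + 10) := by
    rw [one_div_pow, div_div_eq_mul_div, div_one]
    calc (82 : ℝ) * 2 ^ t * 2 ^ h ≤ 2 ^ 7 * 2 ^ N * 2 ^ (3 * (N + 1)) := by
          gcongr <;> norm_num
      _ = _ := by ring
  calc Real.log (82 * 2 ^ t / (1 / 2) ^ h) ≤ Real.log (2 ^ (4 * N + 10)) :=
        Real.log_le_log (by positivity) hle
    _ = (4 * N + 10) * Real.log 2 := by rw [Real.log_pow]; push_cast; ring
    _ ≤ (4 * N + 10) * 1 := by gcongr; linarith [Real.log_two_lt_d9]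
    _ ≤ 10 * (N + 1) := by linarith [Nat.cast_nonneg (α := ℝ) N]

variable [NeZero k] {q : Fin m → Pt d} {a : Fin k → Pt d} {cl : Fin m → Fin k} {Δ : Fin k → ℝ}
  {w : Fin m → ℝ} {G : Finset (Fin k)} {t : ℕ}

theorem hasNet_costClass_near (hw : ∀ i, 0 ≤ w i) (hΔ : ∀ j ∈ G, 0 < Δ j) (N h : ℕ) :
    HasNet (costClass a Δ G t) (fun S i => clusterWeight cl G w i * costDiff q a cl S i)
      (fun i => (1 / 2) ^ h * (clusterWeight cl G w i * radius q a cl Δ i))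
      (10 ^ 6 * k * (2 ^ t) ^ 2 * Real.log (2 * (m + k) + 1) * (N + 1) * 4 ^ h) := by
  classical
  have hnet := hasNet_costDiff_near (k := k) (fun i : cl ⁻¹' ↑G => q i) (fun j : G => a j)
    (fun i => ⟨cl i, i.2⟩) (Δ := fun j => Δ j) (fun j => hΔ j j.2) (one_le_pow₀ one_le_two (n := t))
    (α := (1 / 2) ^ h) (by positivity) (pow_le_one₀ (by norm_num) (by norm_num)) one_le_log_card
    (log_card_subtype_le _ G)
  refine HasNet.indicator_mul (hnet.mono (fun S hS j => (hS j j.2).1) ?_) hw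
  have hE : 0 ≤ (k : ℝ) * (2 ^ t) ^ 2 * Real.log (2 * (m + k) + 1) * 4 ^ h := by
    have := one_le_log_card (m := m) (k := k)
    positivity
  rw [div_pow, half_pow_sq]
  calc (k : ℝ) * (134400 * ((2 ^ t) ^ 2 / (1 / 4 ^ h)) * Real.log (2 * (m + k) + 1))
      = 134400 * (k * (2 ^ t) ^ 2 * Real.log (2 * (m + k) + 1) * 4 ^ h) := by
        field_simp
    _ ≤ 10 ^ 6 * (N + 1) * (k * (2 ^ t) ^ 2 * Real.log (2 * (m + k) + 1) * 4 ^ h) := by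
        gcongr
        linarith [Nat.cast_nonneg (α := ℝ) N]
    _ = _ := by ring

theorem hasNet_costClass_far (hw : ∀ i, 0 ≤ w i) (hΔ : ∀ j ∈ G, 0 < Δ j) (hG : G.Nonempty)
    (ht : 1 ≤ t) (htN : t ≤ N) {h : ℕ} (hh : h ≤ 3 * (N + 1)) :
    HasNet (costClass a Δ G t) (fun S i => clusterWeight cl G w i * costDiff q a cl S i)
      (fun i => (1 / 2) ^ h * (clusterWeight cl G w i * radius q a cl Δ i))
      (10 ^ 6 * k * G.card * Real.log (2 * (m + k) + 1) * (N + 1) * 4 ^ h) := by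
  classical
  have hnet := hasNet_costDiff_far (k := k) (fun i : cl ⁻¹' ↑G => q i) (fun j : G => a j)
    (fun i => ⟨cl i, i.2⟩) (Δ := fun j => Δ j) (fun j => hΔ j j.2) (one_le_pow₀ one_le_two (n := t))
    (α := (1 / 2) ^ h) (by positivity) (pow_le_one₀ (by norm_num) (by norm_num)) one_le_log_card
    (log_card_subtype_le _ G)
  refine HasNet.indicator_mul
    (hnet.mono (fun S hS j => ⟨(hS j j.2).2 ht, (hS j j.2).1⟩) ?_) hw
  have hL := one_le_log_card (m := m) (k := k)
  set L := Real.log (2 * ((m : ℝ) + k) + 1)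
  have hG1 : (1 : ℝ) ≤ G.card := by exact_mod_cast hG.card_pos
  have hlog : G.card * Real.log (82 * 2 ^ t / (1 / 2) ^ h)
      ≤ 10 * (G.card * (N + 1) * (L * 4 ^ h)) := by
    calc _ ≤ G.card * (10 * ((N : ℝ) + 1)) * 1 := by
          rw [mul_one]
          gcongr
          exact log_two_pow_div_half_pow_le htN hh
      _ ≤ G.card * (10 * ((N : ℝ) + 1)) * (L * 4 ^ h) := by
          gcongr
          exact one_le_mul_of_one_le_of_one_le hL (one_le_pow₀ (by norm_num))
      _ = _ := by ring
  have hpt : 850000 / ((1 / 2) ^ h) ^ 2 * L ≤ 850000 * (G.card * (N + 1) * (L * 4 ^ h)) := by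
    calc 850000 / ((1 / 2) ^ h) ^ 2 * L = 850000 * (1 * (L * 4 ^ h)) := by
          rw [half_pow_sq, div_div_eq_mul_div, div_one]
          ring
      _ ≤ _ := by
          gcongr
          exact one_le_mul_of_one_le_of_one_le hG1 (le_add_of_nonneg_left N.cast_nonneg)
  rw [Fintype.card_coe]
  calc _ ≤ k * (10 * (G.card * (N + 1) * (L * 4 ^ h))
          + 850000 * (G.card * (N + 1) * (L * 4 ^ h))) := by gcongr
    _ = 850010 * (k * (G.card * (N + 1) * (L * 4 ^ h))) := by ring
    _ ≤ 10 ^ 6 * (k * (G.card * (N + 1) * (L * 4 ^ h))) := by gcongr; norm_num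
    _ = _ := by ring

theorem abs_clusterWeight_mul_costDiff_le (hw : ∀ i, 0 ≤ w i) (hΔ : ∀ j ∈ G, 0 < Δ j)
    (S : Fin k → Pt d) (i : Fin m) :
    |clusterWeight cl G w i * costDiff q a cl S i|
      ≤ clusterWeight cl G w i * radius q a cl Δ i := by
  by_cases hi : cl i ∈ G
  · have hwi : clusterWeight cl G w i = w i := Set.indicator_of_mem (s := cl ⁻¹' ↑G) hi w
    rw [hwi, abs_mul, abs_of_nonneg (hw i)]
    exact mul_le_mul_of_nonneg_left (abs_costDiff_le_radius q a cl S (hΔ _ hi).le) (hw i)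
  · simp [clusterWeight, hi]

theorem signLaw_costClass_le_of_hasNet {b Ψ ε R U W : ℝ} (hw : ∀ i, 0 ≤ w i)
    (hΔ : ∀ j ∈ G, 0 < Δ j) (hb : 0 < b) (hΨ : 0 < Ψ) (hΨW : Ψ ≤ W) (hm : 0 < m)
    (hwb : ∀ i, clusterWeight cl G w i * radius q a cl Δ i ≤ 4 / m * b)
    (hwΨ : ∑ i, clusterWeight cl G w i * radius q a cl Δ i ≤ 4 * Ψ) (hεN : 1 ≤ ε * 2 ^ N)
    (hmR : 41472 * 10 ^ 6 * (N + 1) ^ 7 * Real.log (2 * (m + k) + 1) * R ≤ ε ^ 2 * m)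
    (hU : 1 ≤ U) (hUR : k * U * (b * Ψ) ≤ R * W ^ 2)
    (hnet : ∀ h, 1 ≤ h → h ≤ 3 * (N + 1) → HasNet (costClass a Δ G t)
      (fun S i => clusterWeight cl G w i * costDiff q a cl S i)
      (fun i => (1 / 2) ^ h * (clusterWeight cl G w i * radius q a cl Δ i))
      (10 ^ 6 * k * U * Real.log (2 * (m + k) + 1) * (N + 1) * 4 ^ h)) :
    (signLaw (Fin m)).real {σ | ∃ S ∈ costClass a Δ G t, ε / (N + 1) ^ 2 * W
        < |∑ i, sgn (σ i) * (clusterWeight cl G w i * costDiff q a cl S i)|}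
      ≤ 6 * (N + 1) * Real.exp (-(100 * (k * (N + 1)))) := by
  have hL := one_le_log_card (m := m) (k := k)
  set L := Real.log (2 * ((m : ℝ) + k) + 1)
  have he : ∀ i, 0 ≤ clusterWeight cl G w i * radius q a cl Δ i := fun i =>
    (abs_nonneg _).trans (abs_clusterWeight_mul_costDiff_le (d := d) hw hΔ 0 i)
  refine (signLaw_chaining_of_sum_le (fun S _ => abs_clusterWeight_mul_costDiff_le hw hΔ S) hb hΨ
    hm hwb hwΨ he hΨW hnet (by positivity) hεN ?_).trans ?_
  · calc 41472 * ((N : ℝ) + 1) ^ 6 * (10 ^ 6 * k * U * L * (N + 1) * (b * Ψ))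
        = 41472 * 10 ^ 6 * (N + 1) ^ 7 * L * (k * U * (b * Ψ)) := by ring
      _ ≤ 41472 * 10 ^ 6 * (N + 1) ^ 7 * L * (R * W ^ 2) := by gcongr
      _ = 41472 * 10 ^ 6 * (N + 1) ^ 7 * L * R * W ^ 2 := by ring
      _ ≤ ε ^ 2 * m * W ^ 2 := by gcongr
  · refine mul_le_mul_of_nonneg_left (Real.exp_le_exp.2 (neg_le_neg ?_)) (by positivity)
    calc 100 * (k * ((N : ℝ) + 1)) ≤ 8 * 10 ^ 6 * (k * (N + 1)) * 1 := by
          nlinarith [(by positivity : 0 ≤ (k : ℝ) * (N + 1))]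
      _ ≤ 8 * 10 ^ 6 * (k * (N + 1)) * (U * L) := by
          gcongr
          exact one_le_mul_of_one_le_of_one_le hU hL
      _ = _ := by ring

theorem signLaw_costClass_le {b Φ Ψ ε R : ℝ} (hw : ∀ i, 0 ≤ w i) (hΔ : ∀ j ∈ G, 0 < Δ j)
    (hb : 0 < b) (hbΦ : b ≤ Φ) (hΨ : 0 < Ψ) (hΨΦ : Ψ ≤ Φ) (hm : 0 < m) (hG : G.Nonempty)
    (hGb : G.card * b ≤ 2 * k * Ψ)
    (hwb : ∀ i, clusterWeight cl G w i * radius q a cl Δ i ≤ 4 / m * b)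
    (hwΨ : ∑ i, clusterWeight cl G w i * radius q a cl Δ i ≤ 4 * Ψ)
    (htN : t ≤ N) (hεN : 1 ≤ ε * 2 ^ N)
    (hR : min ((k : ℝ) * 2 ^ t) (2 * k ^ 2 / (2 ^ t) ^ 2) ≤ R)
    (hmR : 41472 * 10 ^ 6 * (N + 1) ^ 7 * Real.log (2 * (m + k) + 1) * R ≤ ε ^ 2 * m) :
    (signLaw (Fin m)).real {σ | ∃ S ∈ costClass a Δ G t, ε / (N + 1) ^ 2 * max Φ (2 ^ t * Ψ)
        < |∑ i, sgn (σ i) * (clusterWeight cl G w i * costDiff q a cl S i)|}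
      ≤ 6 * (N + 1) * Real.exp (-(100 * (k * (N + 1)))) := by
  have hk1 : (1 : ℝ) ≤ k := by exact_mod_cast NeZero.one_le
  have hΦ : 0 < Φ := hΨ.trans_le hΨΦ
  have hR0 : 0 ≤ R := (le_min (by positivity) (by positivity)).trans hR
  by_cases hnear : (k : ℝ) * 2 ^ t ≤ R
  · refine signLaw_costClass_le_of_hasNet (U := (2 ^ t) ^ 2) hw hΔ hb hΨ
      (hΨΦ.trans (le_max_left _ _)) hm hwb hwΨ hεN hmR (one_le_pow₀ (one_le_pow₀ one_le_two)) ?_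
      fun h _ _ => hasNet_costClass_near hw hΔ N h
    calc (k : ℝ) * (2 ^ t) ^ 2 * (b * Ψ) = k * 2 ^ t * (b * (2 ^ t * Ψ)) := by ring
      _ ≤ R * (max Φ (2 ^ t * Ψ) * max Φ (2 ^ t * Ψ)) := by
        gcongr
        exacts [le_max_of_le_left hbΦ, le_max_right _ _]
      _ = _ := by ring
  · have hfar := (min_le_iff.1 hR).resolve_left hnear
    have ht : 1 ≤ t := by
      by_contra! ht
      obtain rfl : t = 0 := by omega
      simp only [pow_zero, one_pow, div_one, mul_one] at hfar hnear
      nlinarith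
    refine signLaw_costClass_le_of_hasNet (U := G.card) hw hΔ hb hΨ
      (hΨΦ.trans (le_max_left _ _)) hm hwb hwΨ hεN hmR (by exact_mod_cast hG.card_pos) ?_
      fun h _ hh => hasNet_costClass_far hw hΔ hG ht htN hh
    calc (k : ℝ) * G.card * (b * Ψ) = k * (G.card * b) * Ψ := by ring
      _ ≤ k * (2 * k * Ψ) * Ψ := by gcongr
      _ = 2 * k ^ 2 / (2 ^ t) ^ 2 * (2 ^ t * Ψ) ^ 2 := by field_simp
      _ ≤ R * max Φ (2 ^ t * Ψ) ^ 2 := by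
        gcongr
        exact le_max_right _ _

end Classes

section LevelClasses

/-- The dyadic level of `x`: the exponent `t` with `2 ^ t ≤ x < 2 ^ (t + 1)` if `1 ≤ x`, and `0`
otherwise. -/
def level (x : ℝ) : ℕ := Nat.log 2 ⌊x⌋₊

theorem lt_two_pow_level_add_one (x : ℝ) : x < 2 ^ (level x + 1) := by
  exact_mod_cast Nat.lt_of_floor_lt (Nat.lt_pow_succ_log_self one_lt_two ⌊x⌋₊)

theorem two_pow_level_le {x : ℝ} (h : 1 ≤ level x) : 2 ^ level x ≤ x := by
  have h0 : ⌊x⌋₊ ≠ 0 := by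
    rintro h0
    simp [level, h0] at h
  calc (2 : ℝ) ^ level x ≤ (⌊x⌋₊ : ℝ) := by exact_mod_cast Nat.pow_log_le_self 2 h0
    _ ≤ x := Nat.floor_le (Nat.pos_of_floor_pos (Nat.pos_of_ne_zero h0)).le

theorem abs_sum_le_sum_abs_fiber_add {κ β : Type*} [Fintype κ] [DecidableEq β] (y : κ → ℝ)
    (c : κ → β) (p : κ → Prop) [DecidablePred p] (R : Finset β) :
    |∑ j, y j| ≤ ∑ x ∈ R, |∑ j with p j ∧ c j = x, y j| + ∑ j with ¬(p j ∧ c j ∈ R), |y j| := by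
  have hfiber : ∑ j with p j ∧ c j ∈ R, y j = ∑ x ∈ R, ∑ j with p j ∧ c j = x, y j := by
    rw [← Finset.sum_fiberwise_of_maps_to (g := c) (t := R)
      fun j hj => (Finset.mem_filter.1 hj).2.2]
    refine Finset.sum_congr rfl fun x hx => Finset.sum_congr ?_ fun _ _ => rfl
    ext j
    simp only [Finset.mem_filter, Finset.mem_univ, true_and]
    grind
  rw [← Finset.sum_filter_add_sum_filter_not Finset.univ (fun j => p j ∧ c j ∈ R), hfiber]
  exact (abs_add_le _ _).trans
    (add_le_add (Finset.abs_sum_le_sum_abs _ _) (Finset.abs_sum_le_sum_abs _ _))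

variable {d k m N : ℕ}

theorem sum_clusterWeight_mul (cl : Fin m → Fin k) (G : Finset (Fin k)) (w z : Fin m → ℝ) :
    ∑ i, clusterWeight cl G w i * z i = ∑ j ∈ G, ∑ i with cl i = j, w i * z i := by
  have hmul : ∀ i, clusterWeight cl G w i * z i = if cl i ∈ G then w i * z i else 0 := fun i => by
    by_cases hi : cl i ∈ G <;> simp [clusterWeight, hi]
  rw [Finset.sum_congr rfl fun i _ => hmul i, ← Finset.sum_filter,
    ← Finset.sum_fiberwise_of_maps_to fun i hi => (Finset.mem_filter.1 hi).2]
  refine Finset.sum_congr rfl fun j hj => Finset.sum_congr ?_ fun _ _ => rfl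
  ext i
  simp only [Finset.mem_filter, Finset.mem_univ, true_and]
  grind

/-- What the signed-sum bound needs to know about a weighted sample `(q i, w i)`, whose points are
assigned to the reference centers `a` by `cl`: a cluster has size `n j` and average cost `Δ j`, and
`radius` is spread evenly enough over the sample and over the clusters. -/
structure IsBalanced (q : Fin m → Pt d) (a : Fin k → Pt d) (cl : Fin m → Fin k)
    (Δ n : Fin k → ℝ) (w : Fin m → ℝ) : Prop where
  weight_nonneg : ∀ i, 0 ≤ w i
  avg_nonneg : ∀ j, 0 ≤ Δ j
  size_nonneg : ∀ j, 0 ≤ n j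
  weight_mul_radius_le : ∀ i, w i * radius q a cl Δ i
    ≤ 4 / m * min (∑ j, n j * Δ j) (k * (n (cl i) * Δ (cl i)))
  sum_weight_mul_radius_le : ∀ j, ∑ i with cl i = j, w i * radius q a cl Δ i ≤ 4 * (n j * Δ j)

/-- The dyadic level of the factor by which the cost of cluster `j` falls short of the average cost
of a cluster. -/
def shareLevel (n Δ : Fin k → ℝ) (j : Fin k) : ℕ := level ((∑ i, n i * Δ i) / (k * (n j * Δ j)))

/-- The clusters of positive cost with `shareLevel` equal to `x.2` whose center has cost of level
`x.1` for the centers `S`, relative to the average cost of the cluster. -/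
def levelClass (a : Fin k → Pt d) (Δ n : Fin k → ℝ) (S : Fin k → Pt d) (x : ℕ × ℕ) :
    Finset (Fin k) :=
  {j | 0 < n j * Δ j ∧ (level (pointCost S (a j) / Δ j), shareLevel n Δ j) = x}

namespace IsBalanced

variable {q : Fin m → Pt d} {a : Fin k → Pt d} {cl : Fin m → Fin k} {Δ n : Fin k → ℝ}
  {w : Fin m → ℝ}

theorem cost_nonneg (H : IsBalanced q a cl Δ n w) (j : Fin k) : 0 ≤ n j * Δ j :=
  mul_nonneg (H.size_nonneg j) (H.avg_nonneg j)

theorem cost_le_total (H : IsBalanced q a cl Δ n w) (j : Fin k) :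
    n j * Δ j ≤ ∑ i, n i * Δ i :=
  Finset.single_le_sum (fun i _ => H.cost_nonneg i) (Finset.mem_univ j)

theorem avg_pos (H : IsBalanced q a cl Δ n w) {j : Fin k} (hj : 0 < n j * Δ j) : 0 < Δ j :=
  pos_of_mul_pos_right hj (H.size_nonneg j)

theorem sum_clusterWeight_mul_radius_le (H : IsBalanced q a cl Δ n w) (G : Finset (Fin k)) :
    ∑ i, clusterWeight cl G w i * radius q a cl Δ i ≤ 4 * ∑ j ∈ G, n j * Δ j := by
  rw [sum_clusterWeight_mul, Finset.mul_sum]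
  exact Finset.sum_le_sum fun j _ => H.sum_weight_mul_radius_le j

theorem abs_weight_mul_costDiff_le [NeZero k] (H : IsBalanced q a cl Δ n w) (S : Fin k → Pt d)
    (i : Fin m) : |w i * costDiff q a cl S i| ≤ w i * radius q a cl Δ i := by
  rw [abs_mul, abs_of_nonneg (H.weight_nonneg i)]
  exact mul_le_mul_of_nonneg_left (abs_costDiff_le_radius q a cl S (H.avg_nonneg _))
    (H.weight_nonneg i)

end IsBalanced

section ShareLevel

variable [NeZero k] {n Δ : Fin k → ℝ} {j : Fin k}

theorem div_two_pow_shareLevel_le (hj : 0 < n j * Δ j) :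
    (∑ i, n i * Δ i) / 2 ^ shareLevel n Δ j ≤ 2 * (k * (n j * Δ j)) := by
  have hk : (0 : ℝ) < k := by exact_mod_cast NeZero.pos k
  have hlt := (lt_two_pow_level_add_one ((∑ i, n i * Δ i) / (k * (n j * Δ j)))).le
  rw [div_le_iff₀ (by positivity), pow_succ] at hlt
  rw [div_le_iff₀ (by positivity), shareLevel]
  linarith

theorem mul_two_pow_shareLevel_le (hj : 0 < n j * Δ j) (hl : 1 ≤ shareLevel n Δ j) :
    2 ^ shareLevel n Δ j * (k * (n j * Δ j)) ≤ ∑ i, n i * Δ i := by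
  have hk : (0 : ℝ) < k := by exact_mod_cast NeZero.pos k
  exact (le_div_iff₀ (by positivity)).1 (two_pow_level_le hl)

theorem min_le_div_two_pow_shareLevel (hj : 0 < n j * Δ j) :
    min (∑ i, n i * Δ i) (k * (n j * Δ j)) ≤ (∑ i, n i * Δ i) / 2 ^ shareLevel n Δ j := by
  rcases Nat.eq_zero_or_pos (shareLevel n Δ j) with h0 | hpos
  · rw [h0, pow_zero, div_one]
    exact min_le_left _ _
  · rw [le_div_iff₀ (by positivity), mul_comm]
    exact (mul_le_mul_of_nonneg_left (min_le_right _ _) (by positivity)).trans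
      (mul_two_pow_shareLevel_le hj hpos)

end ShareLevel

namespace IsBalanced

variable [NeZero k] {q : Fin m → Pt d} {a : Fin k → Pt d} {cl : Fin m → Fin k} {Δ n : Fin k → ℝ}
  {w : Fin m → ℝ} {G : Finset (Fin k)} {t l : ℕ} {ε R : ℝ}

theorem signLaw_costClass_le (H : IsBalanced q a cl Δ n w) (hm : 0 < m) (hG : G.Nonempty)
    (hGl : ∀ j ∈ G, 0 < n j * Δ j ∧ shareLevel n Δ j = l) (htN : t ≤ N) (hεN : 1 ≤ ε * 2 ^ N)
    (hR : min ((k : ℝ) * 2 ^ t) (2 * k ^ 2 / (2 ^ t) ^ 2) ≤ R)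
    (hmR : 41472 * 10 ^ 6 * (N + 1) ^ 7 * Real.log (2 * (m + k) + 1) * R ≤ ε ^ 2 * m) :
    (signLaw (Fin m)).real {σ | ∃ S ∈ costClass a Δ G t,
        ε / (N + 1) ^ 2 * max (∑ j, n j * Δ j) (2 ^ t * ∑ j ∈ G, n j * Δ j)
          < |∑ i, sgn (σ i) * (clusterWeight cl G w i * costDiff q a cl S i)|}
      ≤ 6 * (N + 1) * Real.exp (-(100 * (k * (N + 1)))) := by
  obtain ⟨j₀, hj₀⟩ := hG
  have hΦ : 0 < ∑ j, n j * Δ j := (hGl j₀ hj₀).1.trans_le (H.cost_le_total j₀)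
  refine KMedian.signLaw_costClass_le (b := (∑ j, n j * Δ j) / 2 ^ l) H.weight_nonneg
    (fun j hj => H.avg_pos (hGl j hj).1) (by positivity)
    (div_le_self hΦ.le (one_le_pow₀ one_le_two))
    (Finset.sum_pos (fun j hj => (hGl j hj).1) ⟨j₀, hj₀⟩)
    (Finset.sum_le_univ_sum_of_nonneg H.cost_nonneg) hm ⟨j₀, hj₀⟩ ?_ (fun i => ?_)
    (H.sum_clusterWeight_mul_radius_le G) htN hεN hR hmR
  · rw [Finset.mul_sum, ← nsmul_eq_mul]
    refine Finset.card_nsmul_le_sum _ _ _ fun j hj => ?_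
    obtain ⟨hpos, rfl⟩ := hGl j hj
    linarith [div_two_pow_shareLevel_le hpos]
  · by_cases hi : cl i ∈ G
    · obtain ⟨hpos, rfl⟩ := hGl _ hi
      have hwi : clusterWeight cl G w i = w i := Set.indicator_of_mem (s := cl ⁻¹' ↑G) hi w
      rw [hwi]
      refine (H.weight_mul_radius_le i).trans ?_
      gcongr
      exact min_le_div_two_pow_shareLevel hpos
    · simp only [clusterWeight, Set.indicator_of_notMem (show i ∉ cl ⁻¹' ↑G from hi), zero_mul]
      positivity

theorem cost_le_of_level_gt (H : IsBalanced q a cl Δ n w) (hεN : 1 ≤ ε * 2 ^ N) (hε : 0 ≤ ε)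
    (S : Fin k → Pt d) {j : Fin k}
    (hj : ¬(0 < n j * Δ j ∧ (level (pointCost S (a j) / Δ j), shareLevel n Δ j)
      ∈ Finset.range (N + 1) ×ˢ Finset.range (N + 1))) :
    n j * Δ j ≤ ε * (n j * pointCost S (a j) + (∑ i, n i * Δ i) / k) := by
  have hk : (0 : ℝ) < k := by exact_mod_cast NeZero.pos k
  have hD : 0 ≤ n j * pointCost S (a j) := mul_nonneg (H.size_nonneg j) (pointCost_nonneg S _)
  have hΦ : 0 ≤ (∑ i, n i * Δ i) / k :=
    div_nonneg (Finset.sum_nonneg fun i _ => H.cost_nonneg i) hk.le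
  have hNle : ∀ {x : ℕ}, N < x → ∀ y : ℝ, 0 ≤ y → y ≤ ε * (2 ^ x * y) := fun hx y hy => by
    calc y ≤ ε * 2 ^ N * y := le_mul_of_one_le_left hy hεN
      _ ≤ ε * 2 ^ _ * y := by gcongr; exact one_le_two
      _ = _ := mul_assoc _ _ _
  rcases (H.cost_nonneg j).eq_or_lt with h0 | hpos
  · rw [← h0]
    positivity
  by_cases ht : N < level (pointCost S (a j) / Δ j)
  · have hlev := (le_div_iff₀ (H.avg_pos hpos)).1 (two_pow_level_le (Nat.one_le_of_lt ht))
    calc n j * Δ j ≤ n j * (ε * (2 ^ level (pointCost S (a j) / Δ j) * Δ j)) :=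
          mul_le_mul_of_nonneg_left (hNle ht _ (H.avg_nonneg j)) (H.size_nonneg j)
      _ ≤ n j * (ε * pointCost S (a j)) := by gcongr; exact H.size_nonneg j
      _ = ε * (n j * pointCost S (a j)) := mul_left_comm _ _ _
      _ ≤ _ := by gcongr; linarith
  · have hl : N < shareLevel n Δ j := by
      by_contra hl
      exact hj ⟨hpos, by simp; omega⟩
    have hlev := mul_two_pow_shareLevel_le hpos (Nat.one_le_of_lt hl)
    calc n j * Δ j ≤ ε * (2 ^ shareLevel n Δ j * (n j * Δ j)) := hNle hl _ hpos.le
      _ ≤ ε * ((∑ i, n i * Δ i) / k) := by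
        gcongr
        rw [le_div_iff₀ hk]
        linarith
      _ ≤ _ := by gcongr; linarith

end IsBalanced

end LevelClasses

section ClassUnion

namespace IsBalanced

variable {d k m N : ℕ} {q : Fin m → Pt d} {a : Fin k → Pt d} {cl : Fin m → Fin k}
  {Δ n : Fin k → ℝ} {w : Fin m → ℝ} {ε : ℝ}

theorem mem_costClass_levelClass (H : IsBalanced q a cl Δ n w) (S : Fin k → Pt d) (x : ℕ × ℕ) :
    S ∈ costClass a Δ (levelClass a Δ n S x) x.1 := by
  rintro j hj
  obtain ⟨hpos, rfl⟩ := (Finset.mem_filter.1 hj).2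
  have hΔ := H.avg_pos hpos
  refine ⟨?_, fun h => (le_div_iff₀ hΔ).1 (two_pow_level_le h)⟩
  rw [← pow_succ']
  exact ((div_lt_iff₀ hΔ).1 (lt_two_pow_level_add_one _)).le

theorem total_le_sum_mul_add (H : IsBalanced q a cl Δ n w) (S : Fin k → Pt d) :
    ∑ j, n j * Δ j ≤ ∑ j, n j * (Δ j + pointCost S (a j)) :=
  Finset.sum_le_sum fun j _ => mul_le_mul_of_nonneg_left
    (le_add_of_nonneg_right (pointCost_nonneg S _)) (H.size_nonneg j)

theorem max_levelClass_le (H : IsBalanced q a cl Δ n w) (S : Fin k → Pt d) (x : ℕ × ℕ) :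
    max (∑ j, n j * Δ j) (2 ^ x.1 * ∑ j ∈ levelClass a Δ n S x, n j * Δ j)
      ≤ ∑ j, n j * (Δ j + pointCost S (a j)) := by
  have hterm : ∀ j, 0 ≤ n j * (Δ j + pointCost S (a j)) := fun j =>
    mul_nonneg (H.size_nonneg j) (add_nonneg (H.avg_nonneg j) (pointCost_nonneg S _))
  refine max_le (H.total_le_sum_mul_add S) ?_
  rw [Finset.mul_sum]
  refine (Finset.sum_le_sum fun j hj => ?_).trans (Finset.sum_le_univ_sum_of_nonneg hterm)
  rw [mul_left_comm]
  refine mul_le_mul_of_nonneg_left ?_ (H.size_nonneg j)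
  rcases Nat.eq_zero_or_pos x.1 with h0 | hx
  · rw [h0, pow_zero, one_mul]
    exact le_add_of_nonneg_right (pointCost_nonneg S _)
  · exact ((H.mem_costClass_levelClass S x j hj).2 hx).trans
      (le_add_of_nonneg_left (H.avg_nonneg j))

variable [NeZero k]

theorem abs_fiber_signed_sum_le (H : IsBalanced q a cl Δ n w) (σ : Fin m → Bool)
    (S : Fin k → Pt d) (j : Fin k) :
    |∑ i with cl i = j, w i * (sgn (σ i) * costDiff q a cl S i)| ≤ 4 * (n j * Δ j) := by
  refine (Finset.abs_sum_le_sum_abs _ _).trans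
    ((Finset.sum_le_sum fun i _ => ?_).trans (H.sum_weight_mul_radius_le j))
  rw [mul_left_comm, abs_mul, abs_sgn, one_mul]
  exact H.abs_weight_mul_costDiff_le S i

theorem sum_irregular_le (H : IsBalanced q a cl Δ n w) (hεN : 1 ≤ ε * 2 ^ N) (hε : 0 ≤ ε)
    (S : Fin k → Pt d) :
    ∑ j with ¬(0 < n j * Δ j ∧ (level (pointCost S (a j) / Δ j), shareLevel n Δ j)
      ∈ Finset.range (N + 1) ×ˢ Finset.range (N + 1)), n j * Δ j
      ≤ ε * ∑ j, n j * (Δ j + pointCost S (a j)) := by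
  have hk : (k : ℝ) ≠ 0 := by exact_mod_cast NeZero.ne k
  have hΦ : 0 ≤ ∑ i, n i * Δ i := Finset.sum_nonneg fun i _ => H.cost_nonneg i
  calc _ ≤ ∑ j with ¬(0 < n j * Δ j ∧ (level (pointCost S (a j) / Δ j), shareLevel n Δ j)
          ∈ Finset.range (N + 1) ×ˢ Finset.range (N + 1)),
          ε * (n j * pointCost S (a j) + (∑ i, n i * Δ i) / k) :=
        Finset.sum_le_sum fun j hj => H.cost_le_of_level_gt hεN hε S (Finset.mem_filter.1 hj).2
    _ ≤ ∑ j, ε * (n j * pointCost S (a j) + (∑ i, n i * Δ i) / k) :=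
        Finset.sum_le_univ_sum_of_nonneg fun j => mul_nonneg hε
          (add_nonneg (mul_nonneg (H.size_nonneg j) (pointCost_nonneg S _)) (by positivity))
    _ = ε * ∑ j, n j * (Δ j + pointCost S (a j)) := by
        rw [← Finset.mul_sum, Finset.sum_add_distrib, Finset.sum_const, Finset.card_univ,
          Fintype.card_fin, nsmul_eq_mul, mul_div_cancel₀ _ hk]
        simp only [mul_add, Finset.sum_add_distrib]
        rw [add_comm]

theorem abs_signed_sum_le_of_levelClass (H : IsBalanced q a cl Δ n w) (hεN : 1 ≤ ε * 2 ^ N)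
    (hε : 0 ≤ ε) (σ : Fin m → Bool) (S : Fin k → Pt d)
    (hclass : ∀ x ∈ Finset.range (N + 1) ×ˢ Finset.range (N + 1),
      (levelClass a Δ n S x).Nonempty →
      |∑ i, sgn (σ i) * (clusterWeight cl (levelClass a Δ n S x) w i * costDiff q a cl S i)|
        ≤ ε / (N + 1) ^ 2 *
          max (∑ j, n j * Δ j) (2 ^ x.1 * ∑ j ∈ levelClass a Δ n S x, n j * Δ j)) :
    |∑ i, sgn (σ i) * (w i * costDiff q a cl S i)|
      ≤ 5 * ε * ∑ j, n j * (Δ j + pointCost S (a j)) := by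
  set W := ∑ j, n j * (Δ j + pointCost S (a j))
  have hW0 : 0 ≤ W :=
    (Finset.sum_nonneg fun i _ => H.cost_nonneg i).trans (H.total_le_sum_mul_add S)
  have hregular : ∀ x ∈ Finset.range (N + 1) ×ˢ Finset.range (N + 1),
      |∑ j ∈ levelClass a Δ n S x, ∑ i with cl i = j, w i * (sgn (σ i) * costDiff q a cl S i)|
        ≤ ε / (N + 1) ^ 2 * W := by
    intro x hx
    rcases (levelClass a Δ n S x).eq_empty_or_nonempty with hempty | hne
    · simp only [hempty, Finset.sum_empty, abs_zero]
      positivity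
    · rw [← sum_clusterWeight_mul]
      simp only [mul_left_comm _ (sgn _)]
      refine (hclass x hx hne).trans ?_
      gcongr
      exact H.max_levelClass_le S x
  simp only [mul_left_comm (sgn _)]
  rw [← Finset.sum_fiberwise Finset.univ cl]
  refine (abs_sum_le_sum_abs_fiber_add _
    (fun j => (level (pointCost S (a j) / Δ j), shareLevel n Δ j)) (fun j => 0 < n j * Δ j)
    (Finset.range (N + 1) ×ˢ Finset.range (N + 1))).trans ?_
  calc _ ≤ ((N : ℝ) + 1) ^ 2 * (ε / (N + 1) ^ 2 * W) + 4 * (ε * W) := by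
        refine add_le_add ?_ ?_
        · refine (Finset.sum_le_card_nsmul _ _ _ hregular).trans_eq ?_
          simp only [Finset.card_product, Finset.card_range, nsmul_eq_mul, Nat.cast_mul,
            Nat.cast_add, Nat.cast_one, sq]
        · refine (Finset.sum_le_sum fun j _ => H.abs_fiber_signed_sum_le σ S j).trans ?_
          rw [← Finset.mul_sum]
          exact mul_le_mul_of_nonneg_left (H.sum_irregular_le hεN hε S) (by norm_num)
    _ = 5 * ε * W := by
        field_simp
        ring

end IsBalanced

theorem num_classes_mul_exp_le {k : ℕ} [NeZero k] (N : ℕ) :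
    ((N : ℝ) + 1) ^ 2 * 2 ^ k * (6 * (N + 1) * Real.exp (-(100 * (k * (N + 1))))) ≤ 1 / 100 := by
  have hk1 : (1 : ℝ) ≤ k := by exact_mod_cast NeZero.one_le
  have hN : (N : ℝ) + 1 ≤ Real.exp N := Real.add_one_le_exp _
  have hk2 : (2 : ℝ) ^ k ≤ Real.exp k := by
    rw [← mul_one (k : ℝ), Real.exp_nat_mul]
    gcongr
    linarith [Real.add_one_le_exp (1 : ℝ)]
  have hexp : (600 : ℝ) ≤ Real.exp 25 ^ 2 := by nlinarith [Real.add_one_le_exp (25 : ℝ)]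
  have hle : 3 * N + k + 2 * 25 ≤ 100 * (k * ((N : ℝ) + 1)) := by
    nlinarith [mul_le_mul_of_nonneg_right hk1 (N.cast_nonneg (α := ℝ))]
  calc _ = 6 * (((N : ℝ) + 1) ^ 3 * 2 ^ k * Real.exp (-(100 * (k * (N + 1))))) := by ring
    _ ≤ 6 * (Real.exp N ^ 3 * Real.exp k * Real.exp (-(3 * N + k + 2 * 25))) := by gcongr
    _ = 6 / Real.exp 25 ^ 2 := by
        rw [div_eq_mul_inv, ← Real.exp_nat_mul, ← Real.exp_nat_mul, ← Real.exp_add,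
          ← Real.exp_add, ← Real.exp_neg]
        congr 2
        push_cast
        ring
    _ ≤ 1 / 100 := by
        rw [div_le_div_iff₀ (by positivity) (by norm_num)]
        linarith

variable {d k m N : ℕ} [NeZero k] {q : Fin m → Pt d} {a : Fin k → Pt d} {cl : Fin m → Fin k}
  {Δ n : Fin k → ℝ} {w : Fin m → ℝ} {ε : ℝ}

theorem IsBalanced.signLaw_le (H : IsBalanced q a cl Δ n w) (hm : 0 < m) (hε : 0 ≤ ε)
    (hεN : 1 ≤ ε * 2 ^ N) {R : ℝ}
    (hR : ∀ t ≤ N, min ((k : ℝ) * 2 ^ t) (2 * k ^ 2 / (2 ^ t) ^ 2) ≤ R)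
    (hmR : 41472 * 10 ^ 6 * (N + 1) ^ 7 * Real.log (2 * (m + k) + 1) * R ≤ ε ^ 2 * m) :
    (signLaw (Fin m)).real {σ | ∃ S : Fin k → Pt d,
        5 * ε * ∑ j, n j * (Δ j + pointCost S (a j))
          < |∑ i, sgn (σ i) * (w i * costDiff q a cl S i)|} ≤ 1 / 100 := by
  classical
  let classes : Finset ((ℕ × ℕ) × Finset (Fin k)) :=
    {x ∈ (Finset.range (N + 1) ×ˢ Finset.range (N + 1)) ×ˢ Finset.univ |
      x.2.Nonempty ∧ ∀ j ∈ x.2, 0 < n j * Δ j ∧ shareLevel n Δ j = x.1.2}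
  let bad : (ℕ × ℕ) × Finset (Fin k) → Set (Fin m → Bool) := fun x =>
    {σ | ∃ S ∈ costClass a Δ x.2 x.1.1,
      ε / (N + 1) ^ 2 * max (∑ j, n j * Δ j) (2 ^ x.1.1 * ∑ j ∈ x.2, n j * Δ j)
        < |∑ i, sgn (σ i) * (clusterWeight cl x.2 w i * costDiff q a cl S i)|}
  have hbad : ∀ x ∈ classes, (signLaw (Fin m)).real (bad x)
      ≤ 6 * (N + 1) * Real.exp (-(100 * (k * (N + 1)))) := by
    rintro ⟨⟨t, l⟩, G⟩ hx
    simp only [classes, Finset.mem_filter, Finset.mem_product, Finset.mem_range, Finset.mem_univ,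
      and_true, Nat.lt_succ_iff] at hx
    exact H.signLaw_costClass_le hm hx.2.1 hx.2.2 hx.1.1 hεN (hR t hx.1.1) hmR
  have hcover : {σ | ∃ S : Fin k → Pt d, 5 * ε * ∑ j, n j * (Δ j + pointCost S (a j))
      < |∑ i, sgn (σ i) * (w i * costDiff q a cl S i)|} ⊆ ⋃ x ∈ classes, bad x := by
    rintro σ ⟨S, hS⟩
    by_contra hgood
    simp only [Set.mem_iUnion, not_exists] at hgood
    refine hS.not_ge (H.abs_signed_sum_le_of_levelClass hεN hε σ S fun x hx hne => ?_)
    by_contra hlt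
    refine hgood (x, levelClass a Δ n S x) (Finset.mem_filter.2
      ⟨Finset.mk_mem_product hx (Finset.mem_univ _), hne, fun j hj => ?_⟩)
      ⟨S, H.mem_costClass_levelClass S x, not_le.1 hlt⟩
    obtain ⟨hpos, hlev⟩ := (Finset.mem_filter.1 hj).2
    exact ⟨hpos, (Prod.ext_iff.1 hlev).2⟩
  have hcard : (classes.card : ℝ) ≤ (N + 1) ^ 2 * 2 ^ k := by
    refine (Nat.cast_le.2 (Finset.card_filter_le _ _)).trans_eq ?_
    simp [Finset.card_product, sq]
  calc _ ≤ (signLaw (Fin m)).real (⋃ x ∈ classes, bad x) :=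
        measureReal_mono hcover (measure_ne_top _ _)
    _ ≤ classes.card * (6 * (N + 1) * Real.exp (-(100 * (k * (N + 1))))) :=
        measureReal_biUnion_le_card_mul _ _ _ hbad
    _ ≤ (N + 1) ^ 2 * 2 ^ k * (6 * (N + 1) * Real.exp (-(100 * (k * (N + 1))))) := by gcongr
    _ ≤ 1 / 100 := num_classes_mul_exp_le N

end ClassUnion

section Bernstein

open ProbabilityTheory

variable {α ι : Type*} [MeasurableSpace α] {ν : Measure α} [IsProbabilityMeasure ν] {X : α → ℝ}

theorem mgf_le_exp_of_abs_le {b v l : ℝ} (hX : Measurable X) (hb : ∀ a, |X a| ≤ b)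
    (hv : ∫ a, X a ^ 2 ∂ν ≤ v) (hlb : |l| * b ≤ 1) :
    mgf X ν l ≤ Real.exp (l * ∫ a, X a ∂ν + l ^ 2 * v) := by
  have hint : Integrable X ν :=
    .of_bound hX.aestronglyMeasurable b (.of_forall hb)
  have hint2 : Integrable (fun a => X a ^ 2) ν :=
    .of_bound (hX.pow_const 2).aestronglyMeasurable (b ^ 2) (.of_forall fun a => by
      rw [Real.norm_eq_abs, abs_pow]
      exact pow_le_pow_left₀ (abs_nonneg _) (hb a) 2)
  have hexp : ∀ a, Real.exp (l * X a) ≤ 1 + l * X a + l ^ 2 * X a ^ 2 := fun a => by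
    have hle : |l * X a| ≤ 1 := by
      rw [abs_mul]
      exact (mul_le_mul_of_nonneg_left (hb a) (abs_nonneg l)).trans hlb
    rw [← mul_pow]
    linarith [(abs_le.1 (Real.abs_exp_sub_one_sub_id_le hle)).2]
  have hlin : Integrable (fun a => 1 + l * X a) ν := (integrable_const 1).add (hint.const_mul l)
  calc mgf X ν l ≤ ∫ a, 1 + l * X a + l ^ 2 * X a ^ 2 ∂ν :=
        integral_mono_of_nonneg (.of_forall fun a => (Real.exp_pos _).le)
          (hlin.add (hint2.const_mul _)) (.of_forall hexp)
    _ = l * ∫ a, X a ∂ν + l ^ 2 * ∫ a, X a ^ 2 ∂ν + 1 := by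
        rw [integral_add hlin (hint2.const_mul _), integral_add (integrable_const 1)
          (hint.const_mul l), integral_const_mul, integral_const_mul]
        simp only [integral_const, probReal_univ, smul_eq_mul, mul_one]
        ring
    _ ≤ l * ∫ a, X a ∂ν + l ^ 2 * v + 1 := by gcongr
    _ ≤ _ := Real.add_one_le_exp _

variable [Fintype ι]

theorem mgf_sum_pi (hX : Measurable X) (l : ℝ) :
    mgf (fun q : ι → α => ∑ i, X (q i)) (Measure.pi fun _ => ν) l
      = mgf X ν l ^ Fintype.card ι := by
  have hindep : iIndepFun (fun (i : ι) (q : ι → α) => X (q i)) (Measure.pi fun _ => ν) :=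
    iIndepFun_pi fun _ => hX.aemeasurable
  have heval : ∀ i : ι, mgf (fun q : ι → α => X (q i)) (Measure.pi fun _ => ν) l = mgf X ν l :=
    fun i => by
      have h := measurePreserving_eval (fun _ : ι => ν) i
      conv_rhs => rw [← h.map_eq]
      exact (mgf_map h.measurable.aemeasurable
        ((hX.const_mul l).exp.aestronglyMeasurable)).symm
  have hsum := hindep.mgf_sum (t := l) (fun i => hX.comp (measurable_pi_apply i)) Finset.univ
  simp only [heval, Finset.prod_const, Finset.card_univ] at hsum
  rw [← hsum]
  congr 1
  ext q
  simp

theorem measureReal_add_le_sum_le {b v δ : ℝ} (hX : Measurable X) (hb : ∀ a, |X a| ≤ b)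
    (hv : ∫ a, X a ^ 2 ∂ν ≤ v) (hv0 : 0 < Fintype.card ι * v) (hδ : 0 ≤ δ)
    (hδb : δ * b ≤ 2 * (Fintype.card ι * v)) :
    (Measure.pi fun _ : ι => ν).real {q | Fintype.card ι * ∫ a, X a ∂ν + δ ≤ ∑ i, X (q i)}
      ≤ Real.exp (-(δ ^ 2 / (4 * (Fintype.card ι * v)))) := by
  set n : ℝ := (Fintype.card ι : ℝ)
  set l : ℝ := δ / (2 * (n * v))
  have hl : 0 ≤ l := by positivity
  have hlb : |l| * b ≤ 1 := by
    rw [abs_of_nonneg hl, div_mul_eq_mul_div]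
    exact (div_le_one (by positivity)).2 hδb
  have hint : Integrable (fun q : ι → α => Real.exp (l * ∑ i, X (q i)))
      (Measure.pi fun _ => ν) := by
    have hmeas : Measurable fun q : ι → α => ∑ i, X (q i) :=
      Finset.measurable_sum _ fun i _ => hX.comp (measurable_pi_apply i)
    refine .of_bound (hmeas.const_mul l).exp.aestronglyMeasurable (Real.exp (l * (n * b)))
      (.of_forall fun q => ?_)
    rw [Real.norm_eq_abs, Real.abs_exp]
    gcongr
    simpa [n] using Finset.sum_le_card_nsmul Finset.univ (fun i => X (q i)) b fun i _ =>
      (le_abs_self _).trans (hb (q i))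
  refine (measure_ge_le_exp_mul_mgf _ hl hint).trans ?_
  rw [mgf_sum_pi hX]
  refine (mul_le_mul_of_nonneg_left (pow_le_pow_left₀ mgf_nonneg
    (mgf_le_exp_of_abs_le hX hb hv hlb) _) (Real.exp_pos _).le).trans_eq ?_
  rw [← Real.exp_nat_mul, ← Real.exp_add]
  congr 1
  have hne : n * v ≠ 0 := hv0.ne'
  have hl2 : l * (n * v) = δ / 2 := by
    rw [show l = δ / 2 / (n * v) from (div_div _ _ _).symm, div_mul_cancel₀ _ hne]
  have hsq : δ ^ 2 / (4 * (n * v)) = l * (δ / 2) := by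
    simp only [l]
    field_simp
    norm_num
  rw [hsq]
  linear_combination l * hl2

theorem measureReal_lt_abs_sum_sub_le {b v δ : ℝ} (hX : Measurable X) (hb : ∀ a, |X a| ≤ b)
    (hv : ∫ a, X a ^ 2 ∂ν ≤ v) (hv0 : 0 < Fintype.card ι * v) (hδ : 0 ≤ δ)
    (hδb : δ * b ≤ 2 * (Fintype.card ι * v)) :
    (Measure.pi fun _ : ι => ν).real {q | δ < |∑ i, X (q i) - Fintype.card ι * ∫ a, X a ∂ν|}
      ≤ 2 * Real.exp (-(δ ^ 2 / (4 * (Fintype.card ι * v)))) := by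
  have hupper := measureReal_add_le_sum_le (ι := ι) hX hb hv hv0 hδ hδb
  have hlower := measureReal_add_le_sum_le (ι := ι) hX.neg
    (fun a => (abs_neg (X a)).le.trans (hb a)) (by simpa using hv) hv0 hδ hδb
  refine (measureReal_mono (fun q hq => ?_) (measure_ne_top _ _)).trans
    ((measureReal_union_le _ _).trans ((add_le_add hupper hlower).trans_eq (two_mul _).symm))
  simp only [Pi.neg_apply, integral_neg, Finset.sum_neg_distrib, mul_neg]
  rw [Set.mem_ofPred_eq, lt_abs] at hq
  exact hq.imp (fun h => Set.mem_ofPred.2 (by linarith)) fun h => Set.mem_ofPred.2 (by linarith)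

end Bernstein

section Symmetrization

variable {α β ι κ : Type*} [MeasurableSpace α]

theorem measureReal_prod_eq_integral [MeasurableSpace β] (μ : Measure α)
    (ν : Measure β) [IsFiniteMeasure ν] {D : Set (α × β)} (hD : MeasurableSet D) :
    (μ.prod ν).real D = ∫ a, ν.real (Prod.mk a ⁻¹' D) ∂μ := by
  rw [measureReal_def, Measure.prod_apply hD]
  exact (integral_toReal (measurable_measure_prodMk_left hD).aemeasurable
    (.of_forall fun _ => measure_lt_top _ _)).symm

theorem mul_measureReal_le_prod [MeasurableSpace β] (μ : Measure α) [IsFiniteMeasure μ]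
    (ν : Measure β) [IsFiniteMeasure ν] {A : Set α} {D : Set (α × β)} {c : ℝ}
    (hA : MeasurableSet A) (hD : MeasurableSet D) (h : ∀ a ∈ A, c ≤ ν.real (Prod.mk a ⁻¹' D)) :
    c * μ.real A ≤ (μ.prod ν).real D := by
  rw [measureReal_prod_eq_integral μ ν hD, mul_comm, ← smul_eq_mul, ← integral_indicator_const c hA]
  refine integral_mono ((integrable_const c).indicator hA)
    (Measure.integrable_measure_prodMk_left hD (measure_ne_top _ _)) fun a => ?_
  exact Set.indicator_apply_le' (h a) fun _ => measureReal_nonneg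

theorem measureReal_prod_le_compl_add [MeasurableSpace β] (μ : Measure α) [IsProbabilityMeasure μ]
    (ν : Measure β) [IsProbabilityMeasure ν] {E : Set α} {D : Set (α × β)} {δ : ℝ}
    (hE : MeasurableSet E) (hD : MeasurableSet D) (hδ : 0 ≤ δ)
    (h : ∀ a ∈ E, ν.real (Prod.mk a ⁻¹' D) ≤ δ) :
    (μ.prod ν).real D ≤ μ.real Eᶜ + δ := by
  have hint : Integrable (Eᶜ.indicator fun _ => (1 : ℝ)) μ :=
    (integrable_const 1).indicator hE.compl
  calc (μ.prod ν).real D = ∫ a, ν.real (Prod.mk a ⁻¹' D) ∂μ := measureReal_prod_eq_integral μ ν hD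
    _ ≤ ∫ a, Eᶜ.indicator (fun _ => 1) a + δ ∂μ := by
        refine integral_mono (Measure.integrable_measure_prodMk_left hD (measure_ne_top _ _))
          (hint.add (integrable_const δ)) fun a => ?_
        by_cases ha : a ∈ E
        · simpa [ha] using h a ha
        · simpa [ha] using add_le_add (measureReal_le_one (μ := ν)) hδ
    _ = μ.real Eᶜ + δ := by
        rw [integral_add hint (integrable_const δ), integral_indicator_const _ hE.compl]
        simp

variable [Fintype ι] (ν : Measure α) [IsProbabilityMeasure ν]

/-- The exchange of the `i`-th coordinates of two samples for all `i` with `σ i = false`. -/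
def exchange (σ : ι → Bool) (q : (ι → α) × (ι → α)) : (ι → α) × (ι → α) :=
  (fun i => bif σ i then q.1 i else q.2 i, fun i => bif σ i then q.2 i else q.1 i)

theorem measurePreserving_exchange (σ : ι → Bool) :
    MeasurePreserving (exchange σ) ((Measure.pi fun _ : ι => ν).prod (Measure.pi fun _ => ν))
      ((Measure.pi fun _ : ι => ν).prod (Measure.pi fun _ => ν)) := by
  have hpair := measurePreserving_arrowProdEquivProdArrow α α ι (fun _ => ν) (fun _ => ν)
  have hswap : ∀ i, MeasurePreserving (fun p : α × α => bif σ i then p else p.swap)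
      (ν.prod ν) (ν.prod ν) := fun i => by
    cases σ i
    · exact Measure.measurePreserving_swap
    · exact .id _
  convert hpair.comp ((measurePreserving_pi _ _ hswap).comp hpair.symm) using 1
  ext q i
  · cases hσ : σ i <;> simp [exchange, hσ, MeasurableEquiv.arrowProdEquivProdArrow,
      Equiv.arrowProdEquivProdArrow]
  · cases hσ : σ i <;> simp [exchange, hσ, MeasurableEquiv.arrowProdEquivProdArrow,
      Equiv.arrowProdEquivProdArrow]

variable [Countable α] [MeasurableSingletonClass α]

theorem measureReal_exists_le_two_mul_ghost (f : κ → α → ℝ) (u θ : κ → ℝ)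
    (hghost : ∀ S, (Measure.pi fun _ : ι => ν).real {q | θ S < |∑ i, f S (q i) - u S|} ≤ 1 / 2) :
    (Measure.pi fun _ : ι => ν).real {q | ∃ S, 2 * θ S < |∑ i, f S (q i) - u S|}
      ≤ 2 * ((Measure.pi fun _ : ι => ν).prod (Measure.pi fun _ => ν)).real
        {q | ∃ S, θ S < |∑ i, (f S (q.1 i) - f S (q.2 i))|} := by
  refine (div_le_iff₀' two_pos).1 (le_of_eq_of_le (by ring)
    (mul_measureReal_le_prod (c := 1 / 2) _ _ .of_discrete .of_discrete ?_))
  rintro q ⟨S, hS⟩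
  have hcompl := measureReal_compl (μ := Measure.pi fun _ : ι => ν)
    (s := {q | θ S < |∑ i, f S (q i) - u S|}) .of_discrete
  rw [probReal_univ] at hcompl
  calc 1 / 2 ≤ (Measure.pi fun _ : ι => ν).real {q | θ S < |∑ i, f S (q i) - u S|}ᶜ := by
        linarith [hghost S]
    _ ≤ _ := measureReal_mono (fun q' hq' => ?_) (measure_ne_top _ _)
  refine ⟨S, ?_⟩
  have hclose : |∑ i, f S (q' i) - u S| ≤ θ S := not_lt.1 hq'
  have htri := abs_sub_abs_le_abs_sub (∑ i, f S (q i) - u S) (∑ i, f S (q' i) - u S)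
  rw [sub_sub_sub_cancel_right, ← Finset.sum_sub_distrib] at htri
  linarith

theorem measureReal_prod_exists_le_two_mul_signed (f : κ → α → ℝ) (θ : κ → ℝ) (σ : ι → Bool) :
    ((Measure.pi fun _ : ι => ν).prod (Measure.pi fun _ => ν)).real
        {q | ∃ S, θ S < |∑ i, (f S (q.1 i) - f S (q.2 i))|}
      ≤ 2 * (Measure.pi fun _ : ι => ν).real
        {q | ∃ S, θ S / 2 < |∑ i, sgn (σ i) * f S (q i)|} := by
  set B : Set (ι → α) := {q | ∃ S, θ S / 2 < |∑ i, sgn (σ i) * f S (q i)|}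
  rw [← (measurePreserving_exchange ν σ).measureReal_preimage
    (MeasurableSet.of_discrete).nullMeasurableSet]
  have hfst := measureReal_prod_prod (μ := Measure.pi fun _ : ι => ν)
    (ν := Measure.pi fun _ : ι => ν) B Set.univ
  have hsnd := measureReal_prod_prod (μ := Measure.pi fun _ : ι => ν)
    (ν := Measure.pi fun _ : ι => ν) Set.univ B
  rw [probReal_univ, mul_one] at hfst
  rw [probReal_univ, one_mul] at hsnd
  refine (measureReal_mono (s₂ := B ×ˢ Set.univ ∪ Set.univ ×ˢ B) (fun q hq => ?_)
    (measure_ne_top _ _)).trans ((measureReal_union_le _ _).trans_eq (by rw [hfst, hsnd, two_mul]))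
  obtain ⟨S, hS⟩ := hq
  have hsigned : ∑ i, (f S ((exchange σ q).1 i) - f S ((exchange σ q).2 i))
      = ∑ i, sgn (σ i) * f S (q.1 i) - ∑ i, sgn (σ i) * f S (q.2 i) := by
    rw [← Finset.sum_sub_distrib]
    refine Finset.sum_congr rfl fun i _ => ?_
    cases hσ : σ i <;> simp [exchange, sgn, hσ, neg_add_eq_sub]
  rw [hsigned] at hS
  by_contra hcon
  simp only [Set.mem_union, Set.mem_prod, Set.mem_univ, and_true, true_and, not_or] at hcon
  have hfst' : |∑ i, sgn (σ i) * f S (q.1 i)| ≤ θ S / 2 := not_lt.1 fun h => hcon.1 ⟨S, h⟩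
  have hsnd' : |∑ i, sgn (σ i) * f S (q.2 i)| ≤ θ S / 2 := not_lt.1 fun h => hcon.2 ⟨S, h⟩
  linarith [abs_sub (∑ i, sgn (σ i) * f S (q.1 i)) (∑ i, sgn (σ i) * f S (q.2 i))]

theorem measureReal_exists_le_symmetrization (f : κ → α → ℝ) (u θ : κ → ℝ) (E : Set (ι → α))
    {δ : ℝ} (hδ : 0 ≤ δ)
    (hghost : ∀ S, (Measure.pi fun _ : ι => ν).real {q | θ S < |∑ i, f S (q i) - u S|} ≤ 1 / 2)
    (hE : ∀ q ∈ E, (signLaw ι).real {σ | ∃ S, θ S / 2 < |∑ i, sgn (σ i) * f S (q i)|} ≤ δ) :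
    (Measure.pi fun _ : ι => ν).real {q | ∃ S, 2 * θ S < |∑ i, f S (q i) - u S|}
      ≤ 4 * ((Measure.pi fun _ : ι => ν).real Eᶜ + δ) := by
  set Q : Measure (ι → α) := Measure.pi fun _ => ν
  let D : Set ((ι → Bool) × (ι → α)) := {z | ∃ S, θ S / 2 < |∑ i, sgn (z.1 i) * f S (z.2 i)|}
  have hbad : ∀ σ, Q.real {q | ∃ S, 2 * θ S < |∑ i, f S (q i) - u S|}
      ≤ 4 * Q.real (Prod.mk σ ⁻¹' D) := fun σ => by
    linarith [measureReal_exists_le_two_mul_ghost ν f u θ hghost,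
      show _ ≤ 2 * Q.real (Prod.mk σ ⁻¹' D) from measureReal_prod_exists_le_two_mul_signed ν f θ σ]
  have haverage := mul_measureReal_le_prod (signLaw ι) Q (D := D) .univ .of_discrete
    fun σ _ => (div_le_iff₀' four_pos).2 (hbad σ)
  have hswap : ((signLaw ι).prod Q).real D = (Q.prod (signLaw ι)).real (Prod.swap ⁻¹' D) :=
    (Measure.measurePreserving_swap.measureReal_preimage
      (MeasurableSet.of_discrete (s := D)).nullMeasurableSet).symm
  have hsigns := measureReal_prod_le_compl_add Q (signLaw ι) (D := Prod.swap ⁻¹' D) .of_discrete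
    .of_discrete hδ hE
  rw [probReal_univ, mul_one, hswap] at haverage
  linarith

end Symmetrization

section Scores

variable {d k m : ℕ} (P : Finset (Pt d)) (A : Fin k → Pt d) (τ : Pt d → Fin k)

theorem sum_eq_sum_cluster (f : Pt d → ℝ) : ∑ p ∈ P, f p = ∑ j, ∑ p ∈ cluster P τ j, f p :=
  (Finset.sum_fiberwise P τ f).symm

theorem cost_eq_sum_cost_cluster : cost P A = ∑ j, cost (cluster P τ j) A :=
  sum_eq_sum_cluster P τ _

theorem sum_cluster_score_le (j : Fin k) : ∑ p ∈ cluster P τ j, score P A τ p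
    ≤ (1 / 4) * (1 / k + 1 / k + cost (cluster P τ j) A / cost P A
      + cost (cluster P τ j) A / cost P A) := by
  set n : ℝ := ((cluster P τ j).card : ℝ)
  set c : ℝ := cost (cluster P τ j) A
  have hc : 0 ≤ c := cost_nonneg _ A
  have hP : 0 ≤ cost P A := cost_nonneg P A
  have hscore : ∀ p ∈ cluster P τ j, score P A τ p = (1 / 4) * (1 / (k * n)
      + pointCost A p / (k * c) + pointCost A p / cost P A + c / n / cost P A) := by
    intro p hp
    rw [score, avgCost, (Finset.mem_filter.1 hp).2]
  have hsum : ∑ p ∈ cluster P τ j, pointCost A p = c := rfl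
  rw [Finset.sum_congr rfl hscore, ← Finset.mul_sum]
  simp only [Finset.sum_add_distrib, Finset.sum_const, nsmul_eq_mul, ← Finset.sum_div, hsum]
  have hcard : n * (1 / (k * n)) ≤ 1 / k := by
    rw [mul_one_div, mul_comm (k : ℝ), ← div_div]
    gcongr
    exact div_self_le_one _
  have hcost : c / (k * c) ≤ 1 / k := by
    rw [mul_comm (k : ℝ), ← div_div]
    gcongr
    exact div_self_le_one _
  have havg : n * (c / n / cost P A) ≤ c / cost P A := by
    rw [← mul_div_assoc, mul_div_left_comm]
    gcongr
    exact mul_le_of_le_one_right hc (div_self_le_one _)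
  gcongr

theorem sum_score_le_one : ∑ p ∈ P, score P A τ p ≤ 1 := by
  rw [sum_eq_sum_cluster P τ]
  refine (Finset.sum_le_sum fun j _ => sum_cluster_score_le P A τ j).trans ?_
  rw [← Finset.mul_sum]
  simp only [Finset.sum_add_distrib, Finset.sum_const, nsmul_eq_mul, ← Finset.sum_div,
    ← cost_eq_sum_cost_cluster P A τ, Finset.card_univ, Fintype.card_fin, mul_one_div]
  linarith [div_self_le_one (k : ℝ), div_self_le_one (cost P A)]

theorem score_le_prob {p : Pt d} (hp : p ∈ P) : score P A τ p ≤ prob P A τ p := by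
  have hsum : 0 < ∑ q ∈ P, score P A τ q :=
    Finset.sum_pos (fun q hq => score_pos P A τ hq) ⟨p, hp⟩
  rw [prob, le_div_iff₀ hsum]
  exact mul_le_of_le_one_right (score_pos P A τ hp).le (sum_score_le_one P A τ)

theorem prob_pos {p : Pt d} (hp : p ∈ P) : 0 < prob P A τ p :=
  (score_pos P A τ hp).trans_le (score_le_prob P A τ hp)

theorem weight_nonneg {p : Pt d} (hp : p ∈ P) : 0 ≤ weight P A τ m p :=
  one_div_nonneg.2 (mul_nonneg (Nat.cast_nonneg _) (prob_pos P A τ hp).le)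

theorem prob_mul_weight {p : Pt d} (hp : p ∈ P) : prob P A τ p * weight P A τ m p = 1 / m := by
  rw [weight, mul_one_div, mul_comm (m : ℝ), ← div_div, div_self (prob_pos P A τ hp).ne']

theorem weight_mul_le {p : Pt d} (hp : p ∈ P) {y c : ℝ} (hy : 0 ≤ y)
    (hyc : y ≤ 4 * c * score P A τ p) : weight P A τ m p * y ≤ 4 / m * c := by
  have hscore := score_pos P A τ hp
  have hprob := prob_pos P A τ hp
  have hc : 0 ≤ 4 * c := nonneg_of_mul_nonneg_left (hy.trans hyc) hscore
  rw [weight, one_div_mul_eq_div, mul_comm (m : ℝ), ← div_div, div_mul_eq_mul_div]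
  gcongr
  rw [div_le_iff₀ hprob]
  exact hyc.trans (mul_le_mul_of_nonneg_left (score_le_prob P A τ hp) hc)

theorem card_cluster_pos {p : Pt d} (hp : p ∈ P) : 0 < ((cluster P τ (τ p)).card : ℝ) := by
  exact_mod_cast Finset.card_pos.2 ⟨p, by simp [cluster, hp]⟩

theorem pointCost_le_cost_cluster {p : Pt d} (hp : p ∈ P) :
    pointCost A p ≤ cost (cluster P τ (τ p)) A :=
  Finset.single_le_sum (f := fun p => pointCost A p) (fun q _ => pointCost_nonneg A q)
    (by simp [cluster, hp])

theorem cost_cluster_le_cost (j : Fin k) : cost (cluster P τ j) A ≤ cost P A :=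
  Finset.sum_le_sum_of_subset_of_nonneg (Finset.filter_subset _ _)
    fun q _ _ => pointCost_nonneg A q

theorem avgCost_nonneg (p : Pt d) : 0 ≤ avgCost P A τ p :=
  div_nonneg (cost_nonneg _ _) (Nat.cast_nonneg _)

theorem four_mul_score_eq (p : Pt d) : 4 * score P A τ p =
    1 / ((k : ℝ) * ((cluster P τ (τ p)).card : ℝ))
    + pointCost A p / ((k : ℝ) * cost (cluster P τ (τ p)) A)
    + pointCost A p / cost P A + avgCost P A τ p / cost P A := by
  rw [score]
  ring

theorem one_le_mul_score {p : Pt d} (hp : p ∈ P) :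
    1 ≤ 4 * (k * ((cluster P τ (τ p)).card : ℝ)) * score P A τ p := by
  have hk : (0 : ℝ) < k := by exact_mod_cast (τ p).pos
  have hcard := card_cluster_pos P τ hp
  have hpoint := pointCost_nonneg A p
  have hcluster := cost_nonneg (cluster P τ (τ p)) A
  have hcost := cost_nonneg P A
  have havg := avgCost_nonneg P A τ p
  rw [mul_right_comm, four_mul_score_eq, ← div_le_iff₀ (by positivity), add_assoc, add_assoc]
  exact le_add_of_nonneg_right (by positivity)

theorem pointCost_add_avgCost_le_cost_mul_score {p : Pt d} (hp : p ∈ P) :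
    pointCost A p + avgCost P A τ p ≤ 4 * cost P A * score P A τ p := by
  have hpoint := pointCost_nonneg A p
  have hpoint_le := pointCost_le_cost_cluster P A τ hp
  have hcluster := cost_nonneg (cluster P τ (τ p)) A
  have hcluster_le := cost_cluster_le_cost P A τ (τ p)
  rcases (cost_nonneg P A).eq_or_lt with hzero | hpos
  · rw [avgCost, show cost (cluster P τ (τ p)) A = 0 by linarith,
      show pointCost A p = 0 by linarith, ← hzero]
    simp
  · rw [mul_right_comm, four_mul_score_eq, ← div_le_iff₀ hpos, add_div, add_assoc]
    exact le_add_of_nonneg_left (by positivity)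

theorem pointCost_add_avgCost_le_cost_cluster_mul_score {p : Pt d} (hp : p ∈ P) :
    pointCost A p + avgCost P A τ p ≤ 4 * (k * cost (cluster P τ (τ p)) A) * score P A τ p := by
  have hk : (0 : ℝ) < k := by exact_mod_cast (τ p).pos
  have hcard := card_cluster_pos P τ hp
  have hpoint := pointCost_nonneg A p
  have hpoint_le := pointCost_le_cost_cluster P A τ hp
  have hcost := cost_nonneg P A
  have havg := avgCost_nonneg P A τ p
  rcases (cost_nonneg (cluster P τ (τ p)) A).eq_or_lt with hzero | hpos
  · rw [avgCost, ← hzero, show pointCost A p = 0 by linarith]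
    simp
  · have havg_div : avgCost P A τ p / (k * cost (cluster P τ (τ p)) A)
        = 1 / (k * ((cluster P τ (τ p)).card : ℝ)) := by
      rw [avgCost]
      field_simp
    rw [mul_right_comm, four_mul_score_eq, ← div_le_iff₀ (by positivity), add_div, havg_div,
      add_comm (pointCost A p / _), add_assoc (_ + _)]
    exact le_add_of_nonneg_right (by positivity)

theorem pointCost_le_cost_mul_score {p : Pt d} (hp : p ∈ P) :
    pointCost A p ≤ 4 * cost P A * score P A τ p :=
  (le_add_of_nonneg_right (avgCost_nonneg P A τ p)).trans
    (pointCost_add_avgCost_le_cost_mul_score P A τ hp)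

theorem pointCost_le_cost_cluster_mul_score {p : Pt d} (hp : p ∈ P) :
    pointCost A p ≤ 4 * (k * cost (cluster P τ (τ p)) A) * score P A τ p :=
  (le_add_of_nonneg_right (avgCost_nonneg P A τ p)).trans
    (pointCost_add_avgCost_le_cost_cluster_mul_score P A τ hp)

end Scores

section Deviation

variable {d k m : ℕ} (P : Finset (Pt d)) (A : Fin k → Pt d) (τ : Pt d → Fin k)

theorem integral_sampleMeasure (f : P → ℝ) :
    ∫ p, f p ∂sampleMeasure P A τ = ∑ p : P, prob P A τ p * f p := by
  rw [sampleMeasure, integral_finsetSum_measure fun p _ =>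
    (integrable_dirac (by simp)).smul_measure ENNReal.ofReal_ne_top]
  refine Finset.sum_congr rfl fun p _ => ?_
  rw [integral_smul_measure, integral_dirac, ENNReal.toReal_ofReal (prob_pos P A τ p.2).le,
    smul_eq_mul]

theorem integral_weight_mul (f : Pt d → ℝ) :
    ∫ p : P, weight P A τ m p * f p ∂sampleMeasure P A τ = (∑ p ∈ P, f p) / m := by
  rw [integral_sampleMeasure, Finset.sum_div, ← Finset.sum_coe_sort P]
  refine Finset.sum_congr rfl fun p _ => ?_
  rw [← mul_assoc, prob_mul_weight P A τ p.2, one_div_mul_eq_div]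

theorem integral_weight_mul_sq_le {f : Pt d → ℝ} {c : ℝ}
    (hf : ∀ p ∈ P, |f p| ≤ 4 * c * score P A τ p) :
    ∫ p : P, (weight P A τ m p * f p) ^ 2 ∂sampleMeasure P A τ
      ≤ 4 / m * c * ((∑ p ∈ P, |f p|) / m) := by
  rw [integral_sampleMeasure, Finset.sum_div, Finset.mul_sum, ← Finset.sum_coe_sort P]
  refine Finset.sum_le_sum fun p _ => ?_
  have hsplit : prob P A τ p * (weight P A τ m p * f p) ^ 2
      = prob P A τ p * weight P A τ m p * (weight P A τ m p * |f p|) * |f p| := by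
    rw [mul_pow, ← sq_abs (f p)]
    ring
  rw [hsplit, prob_mul_weight P A τ p.2]
  calc 1 / m * (weight P A τ m p * |f p|) * |f p| ≤ 1 / m * (4 / m * c) * |f p| := by
        refine mul_le_mul_of_nonneg_right (mul_le_mul_of_nonneg_left ?_ (by positivity))
          (abs_nonneg _)
        exact weight_mul_le P A τ p.2 (abs_nonneg _) (hf p p.2)
    _ = 4 / m * c * (|f p| / m) := by ring

theorem sampleLaw_lt_abs_sum_sub_le (hP : P.Nonempty) (hm : 0 < m) {f : Pt d → ℝ} {ε κ s : ℝ}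
    (hε : 0 ≤ ε) (hε2 : ε ≤ 2) (hκ : 0 < κ) (hs : ∑ p ∈ P, |f p| ≤ s)
    (hf : ∀ p ∈ P, |f p| ≤ 4 * (κ * s) * score P A τ p) :
    (sampleLaw P A τ m).real
        {q | ε * s < |∑ i, weight P A τ m (q i) * f (q i) - ∑ p ∈ P, f p|}
      ≤ 2 * Real.exp (-(ε ^ 2 * m / (16 * κ))) := by
  have hprob := isProbabilityMeasure_sampleMeasure P A τ hP
  have hm' : (0 : ℝ) < m := by exact_mod_cast hm
  rcases ((Finset.sum_nonneg fun p _ => abs_nonneg (f p)).trans hs).eq_or_lt with rfl | hspos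
  · have hzero : ∀ p ∈ P, f p = 0 := fun p hp => by simpa using hf p hp
    have hempty : {q : Fin m → P |
        ε * 0 < |∑ i, weight P A τ m (q i) * f (q i) - ∑ p ∈ P, f p|} = ∅ := by
      ext q
      simp [Finset.sum_eq_zero hzero, hzero _ (q _).2]
    rw [hempty, measureReal_empty]
    positivity
  · have hbernstein := measureReal_lt_abs_sum_sub_le (ι := Fin m) (ν := sampleMeasure P A τ)
      (X := fun p => weight P A τ m p * f p) (b := 4 / m * (κ * s)) (v := 4 / m * (κ * s) * (s / m))
      (δ := ε * s) .of_discrete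
      (fun p => by
        rw [abs_mul, abs_of_nonneg (weight_nonneg P A τ p.2)]
        exact weight_mul_le P A τ p.2 (abs_nonneg _) (hf p p.2))
      ((integral_weight_mul_sq_le P A τ hf).trans (by gcongr))
      (by simp only [Fintype.card_fin]; positivity) (by positivity)
      (by
        have heq : 2 * (m * (4 / m * (κ * s) * (s / m))) = 2 * s * (4 / m * (κ * s)) := by
          field_simp
        rw [Fintype.card_fin, heq]
        gcongr)
    rw [integral_weight_mul, Fintype.card_fin, mul_div_cancel₀ _ hm'.ne'] at hbernstein
    have hexp : (ε * s) ^ 2 / (4 * (m * (4 / m * (κ * s) * (s / m)))) = ε ^ 2 * m / (16 * κ) := by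
      field_simp
      norm_num
    rwa [hexp] at hbernstein

theorem sampleLaw_lt_abs_cluster_sum_sub_le (hP : P.Nonempty) (hm : 0 < m) {h : Pt d → ℝ}
    (hh : ∀ p, 0 ≤ h p) {ε : ℝ} (hε : 0 ≤ ε) (hε2 : ε ≤ 2) (j : Fin k)
    (hscore : ∀ p ∈ cluster P τ j, h p ≤ 4 * (k * ∑ p ∈ cluster P τ j, h p) * score P A τ p) :
    (sampleLaw P A τ m).real {q | ε * ∑ p ∈ cluster P τ j, h p <
        |∑ i with τ (q i) = j, weight P A τ m (q i) * h (q i) - ∑ p ∈ cluster P τ j, h p|}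
      ≤ 2 * Real.exp (-(ε ^ 2 * m / (16 * k))) := by
  have hk : (0 : ℝ) < k := by exact_mod_cast j.pos
  have hnn : ∀ p, 0 ≤ if τ p = j then h p else 0 := fun p => by
    split_ifs
    exacts [hh p, le_rfl]
  have hsum : ∑ p ∈ P, (if τ p = j then h p else 0) = ∑ p ∈ cluster P τ j, h p :=
    (Finset.sum_filter _ _).symm
  have hdev := sampleLaw_lt_abs_sum_sub_le P A τ hP hm (f := fun p => if τ p = j then h p else 0)
    hε hε2 hk (s := ∑ p ∈ cluster P τ j, h p) (by simp only [abs_of_nonneg (hnn _), hsum, le_refl])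
    fun p hp => by
      rw [abs_of_nonneg (hnn p)]
      split_ifs with hpj
      · exact hscore p (Finset.mem_filter.2 ⟨hp, hpj⟩)
      · exact mul_nonneg (mul_nonneg zero_le_four (mul_nonneg hk.le
          (Finset.sum_nonneg fun p _ => hh p))) (score_pos P A τ hp).le
  simpa only [hsum, mul_ite, mul_zero, Finset.sum_filter] using hdev

end Deviation

section Coreset

variable {d k m : ℕ} (P : Finset (Pt d)) (A : Fin k → Pt d) (τ : Pt d → Fin k)

/-- The scale against which sampling errors are measured: the cost of `A` plus the cost of moving
every point of `P` to its center in `A` and from there to `S`. -/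
def errScale (S : Fin k → Pt d) : ℝ :=
  cost P A + ∑ j, ((cluster P τ j).card : ℝ) * pointCost S (A j)

theorem cost_le_errScale (S : Fin k → Pt d) : cost P A ≤ errScale P A τ S :=
  le_add_of_nonneg_right (Finset.sum_nonneg fun _ _ =>
    mul_nonneg (Nat.cast_nonneg _) (pointCost_nonneg _ _))

theorem sum_card_mul_le_errScale (S : Fin k → Pt d) :
    ∑ j, ((cluster P τ j).card : ℝ) * pointCost S (A j) ≤ errScale P A τ S :=
  le_add_of_nonneg_left (cost_nonneg P A)

theorem sum_card_mul_eq (S : Fin k → Pt d) :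
    ∑ j, ((cluster P τ j).card : ℝ) * pointCost S (A j) = ∑ p ∈ P, pointCost S (A (τ p)) := by
  rw [sum_eq_sum_cluster P τ]
  refine Finset.sum_congr rfl fun j _ => ?_
  rw [← nsmul_eq_mul, ← Finset.sum_const]
  refine Finset.sum_congr rfl fun p hp => ?_
  rw [(Finset.mem_filter.1 hp).2]

theorem card_mul_avg_eq (j : Fin k) :
    ((cluster P τ j).card : ℝ) * (cost (cluster P τ j) A / (cluster P τ j).card)
      = cost (cluster P τ j) A := by
  rcases (cluster P τ j).eq_empty_or_nonempty with hempty | hne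
  · simp [hempty, cost]
  · exact mul_div_cancel₀ _ (by exact_mod_cast hne.card_pos.ne')

theorem errScale_eq_sum (S : Fin k → Pt d) : errScale P A τ S = ∑ j,
    ((cluster P τ j).card : ℝ) *
      (cost (cluster P τ j) A / (cluster P τ j).card + pointCost S (A j)) := by
  simp only [mul_add, Finset.sum_add_distrib, card_mul_avg_eq, errScale,
    ← cost_eq_sum_cost_cluster]

theorem errScale_le [NeZero k] {γ : ℝ} (hA : IsApproxSolution γ P A)
    (hτ : IsNearestAssignment P A τ) (S : Fin k → Pt d) :
    errScale P A τ S ≤ (1 + 2 * γ) * cost P S := by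
  have hmoved : ∑ p ∈ P, pointCost S (A (τ p)) ≤ cost P A + cost P S := by
    rw [cost, cost, ← Finset.sum_add_distrib]
    refine Finset.sum_le_sum fun p hp => ?_
    rw [← hτ p hp, dist_comm]
    exact pointCost_le_dist_add S _ _
  rw [errScale, sum_card_mul_eq]
  linarith [hA S]

theorem isProbabilityMeasure_sampleLaw (hP : P.Nonempty) :
    IsProbabilityMeasure (sampleLaw P A τ m) := by
  have := isProbabilityMeasure_sampleMeasure P A τ hP
  unfold sampleLaw
  infer_instance

/-- The event that, up to a factor `1 ± ε`, the weighted sample has the size and the cost of every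
cluster. -/
def clusterEvent (ε : ℝ) (m : ℕ) : Set (Fin m → P) :=
  {q | ∀ j, |∑ i with τ (q i) = j, weight P A τ m (q i) - (cluster P τ j).card|
      ≤ ε * (cluster P τ j).card ∧
    |∑ i with τ (q i) = j, weight P A τ m (q i) * pointCost A (q i) - cost (cluster P τ j) A|
      ≤ ε * cost (cluster P τ j) A}

theorem exp_neg_le_of_log_le (hk : 0 < k) {ε : ℝ} (h : 16 * k * Real.log (400 * k) ≤ ε ^ 2 * m) :
    Real.exp (-(ε ^ 2 * m / (16 * k))) ≤ 1 / (400 * k) := by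
  have : (0 : ℝ) < k := by exact_mod_cast hk
  rw [Real.exp_neg, one_div]
  refine inv_anti₀ (by positivity) ?_
  rw [← Real.log_le_iff_le_exp (by positivity), le_div_iff₀ (by positivity)]
  linarith

theorem sampleLaw_compl_clusterEvent_le (hP : P.Nonempty) (hm : 0 < m) {ε : ℝ}
    (hε : 0 ≤ ε) (hε1 : ε ≤ 1) (hmk : 16 * k * Real.log (400 * k) ≤ ε ^ 2 * m) :
    (sampleLaw P A τ m).real (clusterEvent P A τ ε m)ᶜ ≤ 1 / 100 := by
  have hlaw := isProbabilityMeasure_sampleLaw (m := m) P A τ hP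
  have hk : 0 < k := (τ hP.choose).pos
  have : (0 : ℝ) < k := by exact_mod_cast hk
  have hexp := exp_neg_le_of_log_le hk hmk
  let badSize : Fin k → Set (Fin m → P) := fun j => {q | ε * (cluster P τ j).card
    < |∑ i with τ (q i) = j, weight P A τ m (q i) - (cluster P τ j).card|}
  let badCost : Fin k → Set (Fin m → P) := fun j => {q | ε * cost (cluster P τ j) A
    < |∑ i with τ (q i) = j, weight P A τ m (q i) * pointCost A (q i) - cost (cluster P τ j) A|}
  have hsize : ∀ j, (sampleLaw P A τ m).real (badSize j) ≤ 2 * (1 / (400 * k)) := fun j => by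
    have hdev := sampleLaw_lt_abs_cluster_sum_sub_le P A τ hP hm (h := fun _ => 1)
      (fun _ => zero_le_one) hε (hε1.trans one_le_two) j fun p hp => by
        obtain ⟨hpP, rfl⟩ := Finset.mem_filter.1 hp
        simpa using one_le_mul_score P A τ hpP
    simp only [Finset.sum_const, nsmul_eq_mul, mul_one] at hdev
    exact hdev.trans (by gcongr)
  have hcost : ∀ j, (sampleLaw P A τ m).real (badCost j) ≤ 2 * (1 / (400 * k)) := fun j =>
    (sampleLaw_lt_abs_cluster_sum_sub_le P A τ hP hm (pointCost_nonneg A) hε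
      (hε1.trans one_le_two) j fun p hp => by
        obtain ⟨hpP, rfl⟩ := Finset.mem_filter.1 hp
        exact pointCost_le_cost_cluster_mul_score P A τ hpP).trans (by gcongr)
  have hcover : (clusterEvent P A τ ε m)ᶜ ⊆ ⋃ j ∈ Finset.univ, (badSize j ∪ badCost j) := by
    intro q hq
    simpa [clusterEvent, badSize, badCost, imp_iff_not_or, ← not_le] using hq
  calc _ ≤ _ := measureReal_mono hcover (measure_ne_top _ _)
    _ ≤ (Finset.univ : Finset (Fin k)).card * (2 * (1 / (400 * k)) + 2 * (1 / (400 * k))) :=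
      measureReal_biUnion_le_card_mul _ _ _ fun j _ =>
        (measureReal_union_le _ _).trans (add_le_add (hsize j) (hcost j))
    _ = 1 / 100 := by
      rw [Finset.card_univ, Fintype.card_fin]
      field_simp
      norm_num

variable {P A τ}

theorem sampleLaw_lt_abs_sum_costDiff_le [NeZero k] (hP : P.Nonempty) (hm : 0 < m)
    (hτ : IsNearestAssignment P A τ) {ε : ℝ} (hε : 0 ≤ ε) (hε1 : ε ≤ 1) (hmε : 32 ≤ ε ^ 2 * m)
    (S : Fin k → Pt d) :
    (sampleLaw P A τ m).real {q | 10 * ε * errScale P A τ S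
      < |∑ i, weight P A τ m (q i) * costDiff id A τ S (q i : Pt d)
        - ∑ p ∈ P, costDiff id A τ S p|} ≤ 1 / 2 := by
  have hlaw := isProbabilityMeasure_sampleLaw (m := m) P A τ hP
  have hdiff : ∀ p ∈ P, |costDiff id A τ S p| ≤ pointCost A p := fun p hp => by
    rw [← hτ p hp]
    exact abs_pointCost_sub_le S p _
  have hscale : ε * cost P A ≤ 10 * ε * errScale P A τ S := by
    nlinarith [cost_nonneg P A, cost_le_errScale P A τ S,
      mul_le_mul_of_nonneg_left (cost_le_errScale P A τ S) hε, mul_nonneg hε (cost_nonneg P A)]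
  calc _ ≤ _ := measureReal_mono (fun q hq => hscale.trans_lt hq) (measure_ne_top _ _)
    _ ≤ _ := sampleLaw_lt_abs_sum_sub_le P A τ hP hm (s := cost P A) hε (hε1.trans one_le_two)
      one_pos (Finset.sum_le_sum hdiff) fun p hp => by
        rw [one_mul]
        exact (hdiff p hp).trans (pointCost_le_cost_mul_score P A τ hp)
    _ ≤ 2 * Real.exp (-2) := by
      gcongr
      rw [mul_one, le_div_iff₀ (by norm_num)]
      linarith
    _ ≤ 1 / 2 := by
      have h := Real.add_one_le_exp 1
      rw [Real.exp_neg, ← div_eq_mul_inv, div_le_div_iff₀ (Real.exp_pos _) two_pos,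
        show (2 : ℝ) = 1 + 1 by norm_num, Real.exp_add]
      nlinarith

theorem isBalanced_of_mem_clusterEvent (hτ : IsNearestAssignment P A τ) {ε : ℝ}
    (hε1 : ε ≤ 1) {q : Fin m → P} (hq : q ∈ clusterEvent P A τ ε m) :
    IsBalanced (fun i => (q i : Pt d)) A (fun i => τ (q i))
      (fun j => cost (cluster P τ j) A / (cluster P τ j).card)
      (fun j => ((cluster P τ j).card : ℝ)) (fun i => weight P A τ m (q i)) := by
  have hradius : ∀ i, radius (fun i => (q i : Pt d)) A (fun i => τ (q i))
      (fun j => cost (cluster P τ j) A / (cluster P τ j).card) i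
      = pointCost A (q i) + avgCost P A τ (q i) := fun i => by
    rw [radius, hτ _ (q i).2, avgCost]
  refine ⟨fun i => weight_nonneg P A τ (q i).2, fun j => div_nonneg (cost_nonneg _ _)
    (Nat.cast_nonneg _), fun j => Nat.cast_nonneg _, fun i => ?_, fun j => ?_⟩
  · have hnn : 0 ≤ pointCost A (q i) + avgCost P A τ (q i) :=
      add_nonneg (pointCost_nonneg _ _) (avgCost_nonneg _ _ _ _)
    simp only [hradius, card_mul_avg_eq, ← cost_eq_sum_cost_cluster]
    rw [mul_min_of_nonneg _ _ (by positivity)]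
    exact le_min
      (weight_mul_le P A τ (q i).2 hnn (pointCost_add_avgCost_le_cost_mul_score P A τ (q i).2))
      (weight_mul_le P A τ (q i).2 hnn
        (pointCost_add_avgCost_le_cost_cluster_mul_score P A τ (q i).2))
  · obtain ⟨hsize, hcost⟩ := hq j
    have hc := cost_nonneg (cluster P τ j) A
    have hn : (0 : ℝ) ≤ (cluster P τ j).card := Nat.cast_nonneg _
    have hΔ : 0 ≤ cost (cluster P τ j) A / (cluster P τ j).card := div_nonneg hc hn
    have hsize' : ∑ i with τ (q i) = j, weight P A τ m (q i) ≤ 2 * (cluster P τ j).card := by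
      nlinarith [(abs_le.1 hsize).2]
    have hcost' : ∑ i with τ (q i) = j, weight P A τ m (q i) * pointCost A (q i)
        ≤ 2 * cost (cluster P τ j) A := by
      nlinarith [(abs_le.1 hcost).2]
    have havg : ∀ i ∈ Finset.univ.filter (fun i => τ (q i) = j), avgCost P A τ (q i)
        = cost (cluster P τ j) A / (cluster P τ j).card := fun i hi => by
      rw [avgCost, (Finset.mem_filter.1 hi).2]
    simp only [hradius, card_mul_avg_eq, mul_add, Finset.sum_add_distrib]
    rw [Finset.sum_congr rfl fun i hi => congrArg (weight P A τ m (q i) * ·) (havg i hi),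
      ← Finset.sum_mul]
    linarith [mul_le_mul_of_nonneg_right hsize' hΔ, card_mul_avg_eq P A τ j]

theorem abs_sum_weight_sub_cost_le {ε : ℝ} (hε : 0 ≤ ε) {q : Fin m → P}
    (hq : q ∈ clusterEvent P A τ ε m) (S : Fin k → Pt d) :
    |∑ i, weight P A τ m (q i) * pointCost S (q i) - cost P S|
      ≤ |∑ i, weight P A τ m (q i) * costDiff id A τ S (q i : Pt d)
        - ∑ p ∈ P, costDiff id A τ S p| + ε * errScale P A τ S := by
  have hcenters : |∑ i, weight P A τ m (q i) * pointCost S (A (τ (q i)))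
      - ∑ p ∈ P, pointCost S (A (τ p))| ≤ ε * errScale P A τ S := by
    rw [← sum_card_mul_eq, ← Finset.sum_fiberwise _ fun i => τ (q i), ← Finset.sum_sub_distrib]
    calc _ ≤ ∑ j, ε * ((cluster P τ j).card * pointCost S (A j)) := by
          refine (Finset.abs_sum_le_sum_abs _ _).trans (Finset.sum_le_sum fun j _ => ?_)
          have hfiber : ∑ i with τ (q i) = j, weight P A τ m (q i) * pointCost S (A (τ (q i)))
              = (∑ i with τ (q i) = j, weight P A τ m (q i)) * pointCost S (A j) := by
            rw [Finset.sum_mul]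
            refine Finset.sum_congr rfl fun i hi => ?_
            rw [(Finset.mem_filter.1 hi).2]
          rw [hfiber, ← sub_mul, abs_mul, abs_of_nonneg (pointCost_nonneg S (A j)), ← mul_assoc]
          exact mul_le_mul_of_nonneg_right (hq j).1 (pointCost_nonneg S (A j))
      _ ≤ ε * errScale P A τ S := by
          rw [← Finset.mul_sum]
          exact mul_le_mul_of_nonneg_left (sum_card_mul_le_errScale P A τ S) hε
  have hsplit : ∑ i, weight P A τ m (q i) * pointCost S (q i) - cost P S
      = (∑ i, weight P A τ m (q i) * costDiff id A τ S (q i : Pt d)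
        - ∑ p ∈ P, costDiff id A τ S p)
        + (∑ i, weight P A τ m (q i) * pointCost S (A (τ (q i)))
          - ∑ p ∈ P, pointCost S (A (τ p))) := by
    simp only [costDiff, id, mul_sub, Finset.sum_sub_distrib, cost]
    ring
  rw [hsplit]
  exact (abs_add_le _ _).trans (by gcongr)

theorem min_le_min_rpow {κ T B : ℝ} (hκ : 0 < κ) (hT : 0 < T) (hTB : T ≤ B) :
    min (κ * T) (2 * κ ^ 2 / T ^ 2) ≤ min (2 * κ ^ ((4 : ℝ) / 3)) (κ * B) := by
  refine le_min ?_ ((min_le_left _ _).trans (by gcongr))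
  rcases le_total T (κ ^ ((1 : ℝ) / 3)) with hle | hge
  · refine (min_le_left _ _).trans ?_
    calc κ * T ≤ κ * κ ^ ((1 : ℝ) / 3) := by gcongr
      _ = κ ^ ((4 : ℝ) / 3) := by
        rw [← Real.rpow_one_add' hκ.le (by norm_num)]
        norm_num
      _ ≤ 2 * κ ^ ((4 : ℝ) / 3) := by linarith [Real.rpow_pos_of_pos hκ ((4 : ℝ) / 3)]
  · refine (min_le_right _ _).trans ((div_le_iff₀ (by positivity)).2 ?_)
    calc 2 * κ ^ 2 = 2 * κ ^ ((4 : ℝ) / 3) * (κ ^ ((1 : ℝ) / 3)) ^ 2 := by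
          rw [← Real.rpow_natCast (κ ^ _), ← Real.rpow_mul hκ.le, mul_assoc, ← Real.rpow_add hκ,
            ← Real.rpow_natCast κ]
          norm_num
      _ ≤ 2 * κ ^ ((4 : ℝ) / 3) * T ^ 2 := by gcongr

theorem mul_log_le_of_sampleSize [NeZero k] {ε : ℝ} {N : ℕ}
    (hmR : 41472 * 10 ^ 6 * (N + 1) ^ 7 * Real.log (2 * (m + k) + 1)
      * min (2 * (k : ℝ) ^ ((4 : ℝ) / 3)) (k * 2 ^ N) ≤ ε ^ 2 * m) :
    16 * k * Real.log (400 * k) ≤ ε ^ 2 * m ∧ 32 ≤ ε ^ 2 * m := by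
  have hk1 : (1 : ℝ) ≤ k := by exact_mod_cast NeZero.one_le
  set L := Real.log (2 * (m + k) + 1)
  have hL : 1 ≤ L := one_le_log_card
  have hR : (k : ℝ) ≤ min (2 * (k : ℝ) ^ ((4 : ℝ) / 3)) (k * 2 ^ N) := by
    refine le_min ?_ (le_mul_of_one_le_right (by positivity) (one_le_pow₀ one_le_two))
    linarith [Real.self_le_rpow_of_one_le hk1 (show (1 : ℝ) ≤ 4 / 3 by norm_num)]
  have hsize : 41472 * 10 ^ 6 * L * k ≤ ε ^ 2 * m := by
    calc 41472 * 10 ^ 6 * L * k ≤ 41472 * 10 ^ 6 * L * k * (N + 1) ^ 7 :=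
          le_mul_of_one_le_right (by positivity) (one_le_pow₀ (by simp))
      _ = 41472 * 10 ^ 6 * (N + 1) ^ 7 * L * k := by ring
      _ ≤ _ := (mul_le_mul_of_nonneg_left hR (by positivity)).trans hmR
  have hlog : Real.log (400 * k) ≤ 401 * L := by
    have hlogk : Real.log k ≤ L :=
      Real.log_le_log (by positivity) (by linarith [(Nat.cast_nonneg m : (0 : ℝ) ≤ m)])
    rw [Real.log_mul (by norm_num) (by positivity)]
    linarith [Real.log_le_self (x := 400) (by norm_num)]
  have hkL : 1 ≤ L * k := one_le_mul_of_one_le_of_one_le hL hk1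
  constructor
  · calc 16 * k * Real.log (400 * k) ≤ 16 * k * (401 * L) := by gcongr
      _ ≤ 41472 * 10 ^ 6 * L * k := by linarith
      _ ≤ ε ^ 2 * m := hsize
  · linarith

theorem sampleLaw_error_le [NeZero k] (hP : P.Nonempty) (hm : 0 < m)
    (hτ : IsNearestAssignment P A τ) {ε : ℝ} {N : ℕ} (hε : 0 ≤ ε) (hε1 : ε ≤ 1)
    (hεN : 1 ≤ ε * 2 ^ N)
    (hmR : 41472 * 10 ^ 6 * (N + 1) ^ 7 * Real.log (2 * (m + k) + 1)
      * min (2 * (k : ℝ) ^ ((4 : ℝ) / 3)) (k * 2 ^ N) ≤ ε ^ 2 * m) :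
    (sampleLaw P A τ m).real {q | ∃ S : Fin k → Pt d, 21 * ε * errScale P A τ S
      < |∑ i, weight P A τ m (q i) * pointCost S (q i) - cost P S|} ≤ 1 / 3 := by
  have hprob := isProbabilityMeasure_sampleMeasure P A τ hP
  have hlaw := isProbabilityMeasure_sampleLaw (m := m) P A τ hP
  have hk : (0 : ℝ) < k := by exact_mod_cast NeZero.pos k
  obtain ⟨hmk, hmε⟩ := mul_log_le_of_sampleSize hmR
  have hsigns : ∀ q ∈ clusterEvent P A τ ε m, (signLaw (Fin m)).real
      {σ | ∃ S : Fin k → Pt d, 10 * ε * errScale P A τ S / 2 < |∑ i, sgn (σ i) *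
        (weight P A τ m (q i) * costDiff id A τ S (q i : Pt d))|} ≤ 1 / 100 := by
    intro q hq
    have hsigned := (isBalanced_of_mem_clusterEvent hτ hε1 hq).signLaw_le hm hε hεN (fun t ht =>
      min_le_min_rpow hk (pow_pos two_pos t) (pow_le_pow_right₀ one_le_two ht)) hmR
    simp only [← errScale_eq_sum] at hsigned
    simp only [show ∀ S, 10 * ε * errScale P A τ S / 2 = 5 * ε * errScale P A τ S from
      fun S => by ring]
    exact hsigned
  have hcompl := sampleLaw_compl_clusterEvent_le P A τ hP hm hε hε1 hmk
  have hsym := measureReal_exists_le_symmetrization (sampleMeasure P A τ)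
    (fun (S : Fin k → Pt d) (p : P) => weight P A τ m p * costDiff id A τ S (p : Pt d))
    (fun S => ∑ p ∈ P, costDiff id A τ S p) (fun S => 10 * ε * errScale P A τ S)
    (clusterEvent P A τ ε m) (δ := 1 / 100) (by norm_num)
    (fun S => sampleLaw_lt_abs_sum_costDiff_le hP hm hτ hε hε1 hmε S) hsigns
  have hcover : {q : Fin m → P | ∃ S : Fin k → Pt d, 21 * ε * errScale P A τ S
      < |∑ i, weight P A τ m (q i) * pointCost S (q i) - cost P S|}
      ⊆ (clusterEvent P A τ ε m)ᶜ ∪ {q | ∃ S : Fin k → Pt d, 2 * (10 * ε * errScale P A τ S)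
        < |∑ i, weight P A τ m (q i) * costDiff id A τ S (q i : Pt d)
          - ∑ p ∈ P, costDiff id A τ S p|} := by
    rintro q ⟨S, hS⟩
    refine (em (q ∈ clusterEvent P A τ ε m)).elim (fun hq => Or.inr ⟨S, ?_⟩) Or.inl
    linarith [abs_sum_weight_sub_cost_le hε hq S]
  calc _ ≤ _ := measureReal_mono hcover (measure_ne_top _ _)
    _ ≤ _ := measureReal_union_le _ _
    _ ≤ 1 / 100 + 4 * (1 / 100 + 1 / 100) :=
      add_le_add hcompl (hsym.trans (by gcongr; exact hcompl))
    _ ≤ 1 / 3 := by norm_num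

theorem two_thirds_le_sampleLaw_isCoreset [NeZero k] (hP : P.Nonempty) (hm : 0 < m) {γ : ℝ}
    (hγ : 1 ≤ γ) (hA : IsApproxSolution γ P A) (hτ : IsNearestAssignment P A τ) {ε : ℝ} {N : ℕ}
    (hε : 0 ≤ ε) (hε1 : ε ≤ 1) (hεN : 1 ≤ ε / (21 * (1 + 2 * γ)) * 2 ^ N)
    (hmR : 41472 * 10 ^ 6 * (N + 1) ^ 7 * Real.log (2 * (m + k) + 1)
      * min (2 * (k : ℝ) ^ ((4 : ℝ) / 3)) (k * 2 ^ N) ≤ (ε / (21 * (1 + 2 * γ))) ^ 2 * m) :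
    2 / 3 ≤ (sampleLaw P A τ m).real {q | IsCoreset k ε P (fun i => (q i : Pt d))
      (fun i => weight P A τ m (q i))} := by
  have hlaw := isProbabilityMeasure_sampleLaw (m := m) P A τ hP
  have herror := sampleLaw_error_le hP hm hτ (by positivity)
    (div_le_one_of_le₀ (by linarith) (by positivity)) hεN hmR
  have hcoreset : {q : Fin m → P | IsCoreset k ε P (fun i => (q i : Pt d))
      (fun i => weight P A τ m (q i))}ᶜ ⊆ {q | ∃ S : Fin k → Pt d,
        21 * (ε / (21 * (1 + 2 * γ))) * errScale P A τ S
          < |∑ i, weight P A τ m (q i) * pointCost S (q i) - cost P S|} := by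
    intro q hq
    obtain ⟨S, hS⟩ := not_forall.1 hq
    refine ⟨S, lt_of_le_of_lt ?_ (not_le.1 hS)⟩
    calc 21 * (ε / (21 * (1 + 2 * γ))) * errScale P A τ S
        ≤ 21 * (ε / (21 * (1 + 2 * γ))) * ((1 + 2 * γ) * cost P S) := by
          gcongr
          exact errScale_le P A τ hA hτ S
      _ = ε * cost P S := by
          have : 1 + 2 * γ ≠ 0 := by positivity
          field_simp
  have hcompl := (measureReal_mono hcoreset (measure_ne_top _ _)).trans herror
  rw [measureReal_compl .of_discrete, probReal_univ] at hcompl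
  linarith

end Coreset

section SampleSize

theorem mul_log_le_of_mul_le {K X y M : ℝ} (hK : 0 < K) (hX : 0 < X) (hy : 1 / 2 ≤ y)
    (hXy : Real.log X ≤ 3 * y) (hM : 0 < M) (h : 2 * K * (20 * K + 10) * X * y ^ 8 ≤ M) :
    K * y ^ 7 * X * Real.log (5 * M) ≤ M := by
  have hy0 : 0 < y := by linarith
  set B := K * y ^ 7 * X with hB
  have hB0 : 0 < B := by positivity
  have hsplit : Real.log (5 * M) = Real.log (M / (2 * B)) + Real.log (10 * B) := by
    rw [← Real.log_mul (by positivity) (by positivity)]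
    congr 1
    field_simp
    norm_num
  have hlogB : Real.log (10 * B) ≤ (20 * K + 10) * y := by
    rw [show 10 * B = 10 * K * y ^ 7 * X by rw [hB]; ring, Real.log_mul (by positivity) hX.ne',
      Real.log_mul (by positivity) (by positivity), Real.log_pow]
    have hlogK := Real.log_le_self (x := 10 * K) (by positivity)
    have hlogy := Real.log_le_self hy0.le
    push_cast
    nlinarith
  calc B * Real.log (5 * M) ≤ B * (M / (2 * B) + (20 * K + 10) * y) := by
        rw [hsplit]
        gcongr
        exact Real.log_le_self (by positivity)
    _ = M / 2 + 2 * K * (20 * K + 10) * X * y ^ 8 / 2 := by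
        rw [mul_add, hB]
        field_simp
    _ ≤ M := by linarith

variable {κ e : ℝ}

theorem half_le_log_two_mul_div (hκ : 1 ≤ κ) (he : 0 < e) (he1 : e ≤ 1) :
    1 / 2 ≤ Real.log (2 * κ / e) := by
  have htwo : 2 ≤ 2 * κ / e := by
    rw [le_div_iff₀ he]
    linarith
  linarith [Real.log_le_log two_pos htwo, Real.log_two_gt_d9]

theorem le_min_rpow_div_pow (hκ : 1 ≤ κ) (he : 0 < e) (he1 : e ≤ 1) :
    κ ≤ min (κ ^ ((4 : ℝ) / 3) / e ^ 2) (κ / e ^ 3) := by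
  have hκ0 : 0 ≤ κ := zero_le_one.trans hκ
  refine le_min ?_ (le_div_self hκ0 (by positivity) (pow_le_one₀ he.le he1))
  exact (Real.self_le_rpow_of_one_le hκ (by norm_num)).trans
    (le_div_self (by positivity) (by positivity) (pow_le_one₀ he.le he1))

theorem log_min_rpow_div_pow_le (hκ : 1 ≤ κ) (he : 0 < e) (he1 : e ≤ 1) :
    Real.log (min (κ ^ ((4 : ℝ) / 3) / e ^ 2) (κ / e ^ 3)) ≤ 3 * Real.log (2 * κ / e) := by
  rw [show (3 : ℝ) = (3 : ℕ) by norm_num, ← Real.log_pow, div_pow]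
  refine Real.log_le_log (by linarith [le_min_rpow_div_pow hκ he he1]) ?_
  norm_num only
  refine (min_le_right _ _).trans ?_
  gcongr
  calc κ ≤ κ ^ 3 := le_self_pow₀ hκ (by norm_num)
    _ ≤ (2 * κ) ^ 3 := by gcongr; linarith

theorem exists_pow_two_scale {g : ℝ} (hκ : 1 ≤ κ) (he : 0 < e) (he1 : e ≤ 1) (hg : 1 ≤ g) :
    ∃ N : ℕ, 1 ≤ e / g * 2 ^ N ∧ (2 : ℝ) ^ N ≤ 2 * g / e ∧
      (N : ℝ) + 1 ≤ 8 * g * Real.log (2 * κ / e) := by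
  have hy := half_le_log_two_mul_div hκ he he1
  obtain ⟨n, hn, hn'⟩ := exists_nat_pow_near (x := g / e) (y := (2 : ℝ))
    (by rw [le_div_iff₀ he]; linarith) one_lt_two
  have hn2 : (2 : ℝ) ^ (n + 1) ≤ 2 * g / e := by
    rw [pow_succ, mul_comm, mul_div_assoc]
    gcongr
  refine ⟨n + 1, ?_, hn2, ?_⟩
  · rw [div_lt_iff₀ he] at hn'
    rw [div_mul_eq_mul_div, le_div_iff₀ (by positivity)]
    linarith
  · have hlog : ((n + 1 : ℕ) : ℝ) * Real.log 2 ≤ g + Real.log (2 * κ / e) := by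
      rw [← Real.log_pow]
      calc Real.log (2 ^ (n + 1)) ≤ Real.log (g * (2 * κ / e)) := by
            refine Real.log_le_log (by positivity) (hn2.trans ?_)
            rw [mul_comm 2 g, mul_div_assoc]
            gcongr
            linarith
        _ = Real.log g + Real.log (2 * κ / e) := Real.log_mul (by positivity) (by positivity)
        _ ≤ _ := by gcongr; exact Real.log_le_self (by positivity)
    have hhalf : ((n + 1 : ℕ) : ℝ) * (1 / 2) ≤ ((n + 1 : ℕ) : ℝ) * Real.log 2 := by
      gcongr
      linarith [Real.log_two_gt_d9]
    nlinarith

theorem min_two_mul_rpow_le {g T : ℝ} (hκ : 0 ≤ κ) (he : 0 < e) (hg : 1 ≤ g)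
    (hT : T ≤ 2 * g / e) : min (2 * κ ^ ((4 : ℝ) / 3)) (κ * T)
      ≤ 2 * g * e ^ 2 * min (κ ^ ((4 : ℝ) / 3) / e ^ 2) (κ / e ^ 3) := by
  rw [mul_min_of_nonneg _ _ (by positivity)]
  refine min_le_min ?_ ?_
  · rw [mul_assoc, mul_div_cancel₀ _ (by positivity)]
    gcongr
    linarith
  · calc κ * T ≤ κ * (2 * g / e) := by gcongr
      _ = 2 * g * e ^ 2 * (κ / e ^ 3) := by field_simp

/-- The constant of the theorem before the logarithm of the sample size is absorbed; `g` is the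
factor by which the error parameter shrinks. -/
def sizeConst (g : ℝ) : ℝ := 41472 * 10 ^ 6 * 8 ^ 7 * 2 * g ^ 10

theorem sizeConst_pos {g : ℝ} (hg : 0 < g) : 0 < sizeConst g := by
  unfold sizeConst
  positivity

theorem sample_size_suffices {g : ℝ} {k m : ℕ} [NeZero k] (hg : 1 ≤ g) (he : 0 < e) (he1 : e ≤ 1)
    (hm : 2 * sizeConst g * (20 * sizeConst g + 10)
      * min ((k : ℝ) ^ ((4 : ℝ) / 3) / e ^ 2) ((k : ℝ) / e ^ 3)
      * Real.log (2 * (k : ℝ) / e) ^ 8 ≤ m) :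
    0 < m ∧ ∃ N : ℕ, 1 ≤ e / g * 2 ^ N ∧ 41472 * 10 ^ 6 * (N + 1) ^ 7 * Real.log (2 * (m + k) + 1)
      * min (2 * (k : ℝ) ^ ((4 : ℝ) / 3)) (k * 2 ^ N) ≤ (e / g) ^ 2 * m := by
  have hk : (1 : ℝ) ≤ k := by exact_mod_cast NeZero.one_le
  have hK : 100 ≤ sizeConst g := by
    rw [sizeConst]
    linarith [one_le_pow₀ hg (n := 10)]
  have hy := half_le_log_two_mul_div hk he he1
  have hkX := le_min_rpow_div_pow hk he he1
  have hlogX := log_min_rpow_div_pow_le hk he he1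
  obtain ⟨N, hN, hN2, hNlog⟩ := exists_pow_two_scale hk he he1 hg
  set y := Real.log (2 * (k : ℝ) / e)
  set X := min ((k : ℝ) ^ ((4 : ℝ) / 3) / e ^ 2) ((k : ℝ) / e ^ 3)
  set K := sizeConst g with hKdef
  have hX : 0 < X := by linarith
  have hXm : X ≤ m := by
    have hy8 : (1 / 2) ^ 8 ≤ y ^ 8 := by gcongr
    have hK8 : 2 ^ 8 ≤ 2 * K * (20 * K + 10) := by nlinarith
    calc X = 2 ^ 8 * X * (1 / 2) ^ 8 := by ring
      _ ≤ 2 * K * (20 * K + 10) * X * y ^ 8 := by gcongr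
      _ ≤ m := hm
  have hm0 : (0 : ℝ) < m := hX.trans_le hXm
  have hlog : Real.log (2 * (m + k) + 1) ≤ Real.log (5 * m) :=
    Real.log_le_log (by positivity) (by linarith)
  have hlog0 : 0 ≤ Real.log (2 * (m + k) + 1) := zero_le_one.trans one_le_log_card
  refine ⟨by exact_mod_cast hm0, N, hN, ?_⟩
  calc 41472 * 10 ^ 6 * (N + 1) ^ 7 * Real.log (2 * (m + k) + 1)
        * min (2 * (k : ℝ) ^ ((4 : ℝ) / 3)) (k * 2 ^ N)
      ≤ 41472 * 10 ^ 6 * (8 * g * y) ^ 7 * Real.log (5 * m) * (2 * g * e ^ 2 * X) := by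
        gcongr
        · exact mul_nonneg (by positivity) (hlog0.trans hlog)
        · exact min_two_mul_rpow_le (by positivity) he hg hN2
    _ = (e / g) ^ 2 * (K * y ^ 7 * X * Real.log (5 * m)) := by
        rw [hKdef, sizeConst]
        field_simp
    _ ≤ (e / g) ^ 2 * m := by
        gcongr
        exact mul_log_le_of_mul_le (by positivity) hX hy hlogX hm0 hm

end SampleSize

end KMedian

end

theorem mainTheorem6 (γ : ℝ) (hγ : 1 ≤ γ) :
    ∃ (C : ℝ) (c : ℕ), 0 < C ∧
      ∀ (d k m : ℕ) (ε : ℝ) (P : Finset (KMedian.Pt d)) (A : Fin k → KMedian.Pt d)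
        (τ : KMedian.Pt d → Fin k),
        1 ≤ k → 0 < ε → ε < 1 → P.Nonempty →
        KMedian.IsApproxSolution γ P A →
        KMedian.IsNearestAssignment P A τ →
        C * min ((k : ℝ) ^ ((4 : ℝ) / 3) / ε ^ 2) ((k : ℝ) / ε ^ 3)
            * Real.log (2 * (k : ℝ) / ε) ^ c ≤ (m : ℝ) →
        (2 / 3 : ℝ≥0∞) ≤ KMedian.sampleLaw P A τ m
          {q | KMedian.IsCoreset k ε P (fun i => (q i : KMedian.Pt d))
            (fun i => KMedian.weight P A τ m (q i : KMedian.Pt d))} := by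
  have hg : 1 ≤ 21 * (1 + 2 * γ) := by linarith
  have hK := KMedian.sizeConst_pos (zero_lt_one.trans_le hg)
  refine ⟨2 * KMedian.sizeConst (21 * (1 + 2 * γ)) *
    (20 * KMedian.sizeConst (21 * (1 + 2 * γ)) + 10), 8, by positivity, ?_⟩
  intro d k m ε P A τ hk hε hε1 hP hA hτ hsize
  have : NeZero k := ⟨by omega⟩
  have := KMedian.isProbabilityMeasure_sampleLaw (m := m) P A τ hP
  obtain ⟨hm, N, hεN, hmR⟩ := KMedian.sample_size_suffices hg hε hε1.le hsize
  have hcoreset :=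
    KMedian.two_thirds_le_sampleLaw_isCoreset hP hm hγ hA hτ hε.le hε1.le hεN hmR
  calc (2 / 3 : ℝ≥0∞) = ENNReal.ofReal (2 / 3) := by
        rw [ENNReal.ofReal_div_of_pos (by norm_num)]
        simp
    _ ≤ _ := ENNReal.ofReal_le_of_le_toReal hcoreset
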